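/- Let $p$ be a prime with $p\equiv 1 \pmod 4$, let $\lambda\in\mathbb F_p$, and fix a square root $s=\sqrt{\lambda^2-\lambda+1}\in\overline{\mathbb F}_p$. For $\varepsilon\in\{1,-1\}$ put $\Lambda^{\varepsilon}(\lambda)=(1-\lambda)(\lambda+\varepsilon s)^2$ and $$E_{\Lambda^\varepsilon(\lambda)}:\ y^2=x(x-1)\bigl(x-\Lambda^\varepsilon(\lambda)\bigr).$$ Suppose that $E_{\Lambda^+(\lambda)}$ and $E_{\Lambda^-(\lambda)}$ are (nonsingular) supersingular elliptic curves over $\overline{\mathbb F}_p$. Then, for each $\varepsilon\in\{1,-1\}$, the endomorphism ring of $E_{\Lambda^\varepsilon(\lambda)}$ over $\overline{\mathbb F}_p$ contains $\mathbb Z\left[\frac{1+\sqrt{-3p}}{2}\right]$; more precisely, there is an injective ring homomorphism $$\mathbb Z\left[\tfrac{1+\sqrt{-3p}}{2}\right]\hookrightarrow \operatorname{End}(E_{\Lambda^\varepsilon(\lambda)})$$ that sends $\sqrt{-3p}$ to $F\circ\psi^\varepsilon$, where $F(x,y)=(x^p,y^p)$ is the $p$-th power Frobenius map and $\psi^\varepsilon:E_{\Lambda^\varepsilon(\lambda)}\to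 E_{\Lambda^{-\varepsilon}(\lambda)}$ is the following isogeny of degree $3$. Put $$x_\varepsilon=\frac{\lambda+1+2\varepsilon s}{3},\quad A=(\lambda^2-\lambda+1)(2\lambda-1+2\varepsilon s),\quad B=-\frac{2(\lambda^2-\lambda+1)(2\lambda-1)+\varepsilon(5\lambda^2-5\lambda+2)s}{9(\lambda^2-\lambda+1)},\quad r=\frac{2\lambda-2\varepsilon s-1}{9}.$$ Then $\psi^\varepsilon$ maps the point at infinity and the points with $x=x_\varepsilon$ to the point at infinity, and for every other point $(x,y)$, with $X=x-x_\varepsilon$, $$\psi^\varepsilon(x,y)=\left(r^2\cdot\frac{3(6y^2+6AB^2-3X^3-2AX^2)}{X^2}+x_{-\varepsilon},\ \ r^3\cdot\frac{27y(8AB^2-X^3-4ABX)}{X^3}\right).$$ -/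

import Mathlib

open scoped Polynomial Polynomial.Bivariate

namespace EllipticEnd

open WeierstrassCurve WeierstrassCurve.Affine Filter

section General

variable {k : Type*} [Field k] (W : WeierstrassCurve.Affine k)

/-- A map `φ` from the group `W(k)` to itself is given by rational functions: there are polynomials
`u, v, w` in the two affine coordinates such that, for all but finitely many points `P` of `W(k)`,
`P = (x, y)` is affine, `w(x, y) ≠ 0` and `φ(P) = (u(x, y) / w(x, y), v(x, y) / w(x, y))`. -/
def IsRational (φ : W.Point → W.Point) : Prop :=
  ∃ u v w : k[X][Y], ∀ᶠ P : W.Point in cofinite,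
    ∃ (x y : k) (h : W.Nonsingular x y), P = .some x y h ∧ w.evalEval x y ≠ 0 ∧
      ∃ h' : W.Nonsingular (u.evalEval x y / w.evalEval x y) (v.evalEval x y / w.evalEval x y),
        φ P = .some _ _ h'

/-- The first affine coordinate (with the value `0` at infinity). -/
def xc : W.Point → k
  | .zero => 0
  | .some x _ _ => x

/-- The second affine coordinate (with the value `0` at infinity). -/
def yc : W.Point → k
  | .zero => 0
  | .some _ y _ => y

/-- Rational functions on the points of `W`, up to finitely many points. -/
def IsRatFun (f : W.Point → k) : Prop :=
  ∃ u w : k[X][Y], ∀ᶠ P : W.Point in cofinite, w.evalEval (xc W P) (yc W P) ≠ 0 ∧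
    f P = u.evalEval (xc W P) (yc W P) / w.evalEval (xc W P) (yc W P)

variable {W}

lemma exists_some {P : W.Point} (hP : P ≠ .zero) :
    ∃ h : W.Nonsingular (xc W P) (yc W P), P = .some (xc W P) (yc W P) h := by
  cases P with
  | zero => exact absurd rfl hP
  | some x y h => exact ⟨h, rfl⟩

lemma eventually_ne (Q : W.Point) : ∀ᶠ P : W.Point in cofinite, P ≠ Q := by
  simp [Filter.eventually_cofinite]

lemma isRational_iff (φ : W.Point → W.Point) : IsRational W φ ↔
    IsRatFun W (fun P ↦ xc W (φ P)) ∧ IsRatFun W (fun P ↦ yc W (φ P)) ∧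
      ∀ᶠ P in cofinite, φ P ≠ .zero := by
  constructor
  · rintro ⟨u, v, w, H⟩
    refine ⟨⟨u, w, H.mono ?_⟩, ⟨v, w, H.mono ?_⟩, H.mono ?_⟩
    · rintro P ⟨x, y, h, rfl, hw, h', e⟩
      exact ⟨hw, by simp only [e]; rfl⟩
    · rintro P ⟨x, y, h, rfl, hw, h', e⟩
      exact ⟨hw, by simp only [e]; rfl⟩
    · rintro P ⟨x, y, h, rfl, hw, h', e⟩
      rw [e]
      exact fun h ↦ by cases h
  · rintro ⟨⟨u, w, H⟩, ⟨v, w', H'⟩, H0⟩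
    refine ⟨u * w', v * w, w * w', ?_⟩
    filter_upwards [H, H', H0, eventually_ne .zero] with P h1 h2 h3 h4
    obtain ⟨hP, eP⟩ := exists_some h4
    refine ⟨xc W P, yc W P, hP, eP, ?_, ?_⟩
    · rw [Polynomial.evalEval_mul]
      exact mul_ne_zero h1.1 h2.1
    · obtain ⟨hφ, eφ⟩ := exists_some h3
      have a1 : (u * w').evalEval (xc W P) (yc W P) / (w * w').evalEval (xc W P) (yc W P)
          = xc W (φ P) := by
        rw [h1.2, Polynomial.evalEval_mul, Polynomial.evalEval_mul, mul_div_mul_right _ _ h2.1]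
      have a2 : (v * w).evalEval (xc W P) (yc W P) / (w * w').evalEval (xc W P) (yc W P)
          = yc W (φ P) := by
        rw [h2.2, Polynomial.evalEval_mul, Polynomial.evalEval_mul, mul_comm (w.evalEval _ _),
          mul_div_mul_right _ _ h1.1]
      rw [a1, a2]
      exact ⟨hφ, eφ⟩

lemma IsRatFun.congr {f g : W.Point → k} (hf : IsRatFun W f) (h : ∀ᶠ P in cofinite, f P = g P) :
    IsRatFun W g := by
  obtain ⟨u, w, H⟩ := hf
  exact ⟨u, w, by filter_upwards [H, h] with P h1 h2; exact ⟨h1.1, h2 ▸ h1.2⟩⟩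

lemma isRatFun_evalEval (u : k[X][Y]) :
    IsRatFun W (fun P ↦ u.evalEval (xc W P) (yc W P)) :=
  ⟨u, 1, .of_forall fun P ↦ by simp⟩

lemma isRatFun_xc : IsRatFun W (xc W) :=
  (isRatFun_evalEval (Polynomial.C Polynomial.X)).congr (.of_forall fun P ↦ by
    rw [Polynomial.evalEval_C, Polynomial.eval_X])

lemma isRatFun_yc : IsRatFun W (yc W) :=
  (isRatFun_evalEval Polynomial.X).congr (.of_forall fun P ↦ by simp)

lemma isRatFun_const (c : k) : IsRatFun W (fun _ ↦ c) :=
  (isRatFun_evalEval (Polynomial.C (Polynomial.C c))).congr (.of_forall fun P ↦ by simp)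

lemma IsRatFun.add {f g : W.Point → k} (hf : IsRatFun W f) (hg : IsRatFun W g) :
    IsRatFun W (fun P ↦ f P + g P) := by
  obtain ⟨u, w, H⟩ := hf
  obtain ⟨u', w', H'⟩ := hg
  refine ⟨u * w' + w * u', w * w', ?_⟩
  filter_upwards [H, H'] with P h1 h2
  simp only [Polynomial.evalEval_mul, Polynomial.evalEval_add]
  exact ⟨mul_ne_zero h1.1 h2.1, by rw [h1.2, h2.2, div_add_div _ _ h1.1 h2.1]⟩

lemma IsRatFun.mul {f g : W.Point → k} (hf : IsRatFun W f) (hg : IsRatFun W g) :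
    IsRatFun W (fun P ↦ f P * g P) := by
  obtain ⟨u, w, H⟩ := hf
  obtain ⟨u', w', H'⟩ := hg
  refine ⟨u * u', w * w', ?_⟩
  filter_upwards [H, H'] with P h1 h2
  simp only [Polynomial.evalEval_mul]
  exact ⟨mul_ne_zero h1.1 h2.1, by rw [h1.2, h2.2, div_mul_div_comm]⟩

lemma IsRatFun.neg {f : W.Point → k} (hf : IsRatFun W f) : IsRatFun W (fun P ↦ -f P) :=
  ((isRatFun_const (-1)).mul hf).congr (.of_forall fun P ↦ by ring)

lemma IsRatFun.sub {f g : W.Point → k} (hf : IsRatFun W f) (hg : IsRatFun W g) :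
    IsRatFun W (fun P ↦ f P - g P) :=
  (hf.add hg.neg).congr (.of_forall fun P ↦ by ring)

/-- Only finitely many points have their first coordinate in a given finite set. -/
lemma finite_xc {s : Set k} (hs : s.Finite) : {P : W.Point | xc W P ∈ s}.Finite := by
  classical
  refine Set.Finite.preimage' hs fun x _ ↦ ?_
  by_cases hx : ∃ P : W.Point, P ≠ .zero ∧ xc W P = x
  · obtain ⟨P, hP, rfl⟩ := hx
    refine (Set.toFinite {.zero, P, -P}).subset fun Q hQ ↦ ?_
    cases P with
    | zero => exact absurd rfl hP
    | some x y h =>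
      cases Q with
      | zero => simp
      | some x' y' h' => exact Or.inr (Point.X_eq_iff.mp hQ)
  · refine (Set.toFinite {.zero}).subset fun Q hQ ↦ ?_
    by_contra h
    exact hx ⟨Q, h, hQ⟩

/-- A polynomial in the coordinates has finitely many zeros on `W` or vanishes on `W`. -/
lemma evalEval_dichotomy (u : k[X][Y]) :
    (∀ᶠ P in cofinite, u.evalEval (xc W P) (yc W P) = 0) ∨
      ∀ᶠ P in cofinite, u.evalEval (xc W P) (yc W P) ≠ 0 := by
  obtain ⟨p, q, hpq⟩ := CoordinateRing.exists_smul_basis_eq (CoordinateRing.mk W u)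
  have key : ∀ P : W.Point, P ≠ .zero →
      u.evalEval (xc W P) (yc W P) = p.eval (xc W P) + q.eval (xc W P) * yc W P := by
    intro P hP
    obtain ⟨h, -⟩ := exists_some hP
    have h1 : (CoordinateRing.mk W u) =
        CoordinateRing.mk W (Polynomial.C p + Polynomial.C q * Polynomial.X) := by
      rw [← hpq, CoordinateRing.smul, CoordinateRing.smul]; simp
    have h2 := congrArg (AdjoinRoot.evalEval (p := W.polynomial) h.1) h1
    erw [AdjoinRoot.evalEval_mk, AdjoinRoot.evalEval_mk] at h2
    simpa only [Polynomial.evalEval_add, Polynomial.evalEval_mul, Polynomial.evalEval_C,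
      Polynomial.evalEval_X] using h2
  set N : k[X] := p ^ 2 - p * q * (Polynomial.C W.a₁ * Polynomial.X + Polynomial.C W.a₃) -
    q ^ 2 * (Polynomial.X ^ 3 + Polynomial.C W.a₂ * Polynomial.X ^ 2 +
      Polynomial.C W.a₄ * Polynomial.X + Polynomial.C W.a₆) with hN
  have hnorm := CoordinateRing.norm_smul_basis (W' := W) p q
  rw [← hN, hpq] at hnorm
  by_cases h0 : N = 0
  · left
    have := Module.Finite.of_basis (CoordinateRing.basis W)
    rw [h0, Algebra.norm_eq_zero_iff] at hnorm
    rw [hnorm] at hpq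
    obtain ⟨rfl, rfl⟩ := CoordinateRing.smul_basis_eq_zero hpq
    filter_upwards [eventually_ne .zero] with P hP
    simp [key P hP]
  · right
    have hfin : {P : W.Point | xc W P ∈ {x | N.IsRoot x}}.Finite :=
      finite_xc (Polynomial.finite_setOfPred_isRoot h0)
    filter_upwards [eventually_ne .zero, hfin.eventually_cofinite_notMem] with P hP hroot hz
    obtain ⟨h, -⟩ := exists_some hP
    rw [key P hP] at hz
    apply hroot
    have heq := (equation_iff (W := W) _ _).mp h.1
    change N.eval (xc W P) = 0
    rw [hN]
    simp only [Polynomial.eval_sub, Polynomial.eval_mul, Polynomial.eval_pow, Polynomial.eval_add,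
      Polynomial.eval_C, Polynomial.eval_X]
    linear_combination (p.eval (xc W P) - q.eval (xc W P) * (yc W P + W.a₁ * xc W P + W.a₃)) * hz
      + q.eval (xc W P) ^ 2 * heq

lemma IsRatFun.dichotomy {f : W.Point → k} (hf : IsRatFun W f) :
    (∀ᶠ P in cofinite, f P = 0) ∨ ∀ᶠ P in cofinite, f P ≠ 0 := by
  obtain ⟨u, w, H⟩ := hf
  refine (evalEval_dichotomy (W := W) u).imp (fun h ↦ ?_) fun h ↦ ?_
  · filter_upwards [H, h] with P h1 h2
    rw [h1.2, h2, zero_div]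
  · filter_upwards [H, h] with P h1 h2
    rw [h1.2]
    exact div_ne_zero h2 h1.1

lemma IsRatFun.inv {f : W.Point → k} (hf : IsRatFun W f) : IsRatFun W (fun P ↦ (f P)⁻¹) := by
  rcases hf.dichotomy with h0 | h0
  · exact (isRatFun_const 0).congr (h0.mono fun P h ↦ by simp [h])
  · obtain ⟨u, w, H⟩ := hf
    refine ⟨w, u, ?_⟩
    filter_upwards [H, h0] with P h1 h2
    rw [h1.2] at h2 ⊢
    exact ⟨fun h ↦ h2 (by simp [h]), inv_div _ _⟩

lemma IsRatFun.div {f g : W.Point → k} (hf : IsRatFun W f) (hg : IsRatFun W g) :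
    IsRatFun W (fun P ↦ f P / g P) :=
  (hf.mul hg.inv).congr (.of_forall fun P ↦ by simp [div_eq_mul_inv])

lemma IsRatFun.eval {f : W.Point → k} (hf : IsRatFun W f) (p : k[X]) :
    IsRatFun W (fun P ↦ p.eval (f P)) := by
  induction p using Polynomial.induction_on' with
  | add p q hp hq => exact (hp.add hq).congr (.of_forall fun P ↦ by simp)
  | monomial n a =>
    have hpow : IsRatFun W (fun P ↦ f P ^ n) := by
      induction n with
      | zero => exact (isRatFun_const 1).congr (.of_forall fun P ↦ by simp)
      | succ n ih => exact (ih.mul hf).congr (.of_forall fun P ↦ by simp [pow_succ])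
    exact ((isRatFun_const a).mul hpow).congr (.of_forall fun P ↦ by simp)

lemma IsRatFun.evalEval {f g : W.Point → k} (hf : IsRatFun W f) (hg : IsRatFun W g) (p : k[X][Y]) :
    IsRatFun W (fun P ↦ p.evalEval (f P) (g P)) := by
  induction p using Polynomial.induction_on' with
  | add p q hp hq => exact (hp.add hq).congr (.of_forall fun P ↦ by simp)
  | monomial n a =>
    have hpow : IsRatFun W (fun P ↦ g P ^ n) := by
      induction n with
      | zero => exact (isRatFun_const 1).congr (.of_forall fun P ↦ by simp)
      | succ n ih => exact (ih.mul hg).congr (.of_forall fun P ↦ by simp [pow_succ])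
    exact ((hf.eval a).mul hpow).congr (.of_forall fun P ↦ by
      simp only [Polynomial.evalEval, Polynomial.eval_monomial, Polynomial.eval_mul,
        Polynomial.eval_pow, Polynomial.eval_C])

lemma IsRatFun.comp {f : W.Point → k} (hf : IsRatFun W f) {φ : W.Point → W.Point}
    (hφ : IsRational W φ) (ht : Tendsto φ cofinite cofinite) : IsRatFun W (fun P ↦ f (φ P)) := by
  obtain ⟨u, w, H⟩ := hf
  obtain ⟨hx, hy, -⟩ := (isRational_iff φ).mp hφ
  exact ((hx.evalEval hy u).div (hx.evalEval hy w)).congr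
    ((ht.eventually H).mono fun P h ↦ h.2.symm)

set_option linter.unusedSectionVars false

variable [DecidableEq k]

lemma tendsto_of_isRational {φ : AddMonoid.End W.Point} (hφ : IsRational W φ) :
    Tendsto φ cofinite cofinite := by
  have h0 := ((isRational_iff φ).mp hφ).2.2
  have hker : {P : W.Point | φ P = 0}.Finite := by
    have h1 := Filter.eventually_cofinite.mp h0
    simp only [not_not] at h1
    exact h1
  refine Filter.Tendsto.cofinite_of_finite_preimage_singleton fun Q ↦ ?_
  by_cases hQ : ∃ R, φ R = Q
  · obtain ⟨R, rfl⟩ := hQ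
    refine (hker.image fun P ↦ P + R).subset fun P hP ↦ ⟨P - R, ?_, by simp⟩
    simpa [sub_eq_zero] using hP
  · refine Set.finite_empty.subset fun P hP ↦ hQ ⟨P, hP⟩

variable [IsAlgClosed k] [W.IsElliptic]

lemma infinite_point : Infinite W.Point := by
  have : Infinite k := IsAlgClosed.instInfinite
  refine Infinite.of_surjective (xc W) fun x ↦ ?_
  obtain ⟨y, hy⟩ := IsAlgClosed.exists_root
    (Polynomial.X ^ 2 + (Polynomial.C (W.a₁ * x + W.a₃) * Polynomial.X -
      Polynomial.C (x ^ 3 + W.a₂ * x ^ 2 + W.a₄ * x + W.a₆)) : k[X]) (by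
      rw [Polynomial.degree_add_eq_left_of_degree_lt] <;> rw [Polynomial.degree_X_pow]
      · norm_num
      · refine lt_of_le_of_lt (b := 1) ?_ (by norm_num)
        compute_degree)
  have he : W.Equation x y := by
    rw [equation_iff]
    simp only [Polynomial.IsRoot, Polynomial.eval_add, Polynomial.eval_sub, Polynomial.eval_mul,
      Polynomial.eval_pow, Polynomial.eval_C, Polynomial.eval_X] at hy
    linear_combination hy
  exact ⟨.some x y (equation_iff_nonsingular.mp he), rfl⟩

/-- A homomorphism that vanishes at all but finitely many points is zero. -/
lemma eq_zero_of_eventually {φ : AddMonoid.End W.Point} (h : ∀ᶠ P in cofinite, φ P = 0) :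
    φ = 0 := by
  have := infinite_point (W := W)
  ext P : 1
  have ht : Tendsto (fun Q : W.Point ↦ P + Q) cofinite cofinite :=
    (add_right_injective P).tendsto_cofinite
  obtain ⟨Q, h1, h2⟩ := (h.and (ht.eventually h)).exists
  rw [map_add, h1, add_zero] at h2
  simpa using h2

lemma isRational_neg {φ : AddMonoid.End W.Point} (h : IsRational W φ) : IsRational W ⇑(-φ) := by
  obtain ⟨hx, hy, h0⟩ := (isRational_iff _).mp h
  have key : ∀ᶠ P in cofinite, ∃ h : W.Nonsingular (xc W (φ P)) (W.negY (xc W (φ P)) (yc W (φ P))),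
      (-φ) P = .some _ _ h := by
    filter_upwards [h0] with P h1
    obtain ⟨hP, eP⟩ := exists_some h1
    refine ⟨(nonsingular_neg ..).mpr hP, ?_⟩
    change -(φ P) = _
    conv_lhs => rw [eP]
    rfl
  refine (isRational_iff _).mpr ⟨hx.congr ?_, (((hy.neg.sub ((isRatFun_const W.a₁).mul hx)).sub
    (isRatFun_const W.a₃))).congr ?_, ?_⟩
  · filter_upwards [key] with P ⟨h1, h2⟩
    rw [h2]; rfl
  · filter_upwards [key] with P ⟨h1, h2⟩
    rw [h2]; rfl
  · filter_upwards [key] with P ⟨h1, h2⟩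
    rw [h2]
    exact fun h ↦ by cases h

/-- If the slope of the line through `φ P` and `ψ P` is rational, then so is `φ + ψ`. -/
lemma isRational_add_aux {φ ψ : AddMonoid.End W.Point} (h : IsRational W φ) (h' : IsRational W ψ)
    (hne : ∀ᶠ P in cofinite,
      ¬(xc W (φ P) = xc W (ψ P) ∧ yc W (φ P) = W.negY (xc W (ψ P)) (yc W (ψ P))))
    (hl : IsRatFun W fun P ↦ W.slope (xc W (φ P)) (xc W (ψ P)) (yc W (φ P)) (yc W (ψ P))) :
    IsRational W ⇑(φ + ψ) := by
  obtain ⟨hx, hy, h0⟩ := (isRational_iff _).mp h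
  obtain ⟨hx', hy', h0'⟩ := (isRational_iff _).mp h'
  set l := fun P ↦ W.slope (xc W (φ P)) (xc W (ψ P)) (yc W (φ P)) (yc W (ψ P)) with hl'
  have key : ∀ᶠ P in cofinite, ∃ h : W.Nonsingular (W.addX (xc W (φ P)) (xc W (ψ P)) (l P))
      (W.addY (xc W (φ P)) (xc W (ψ P)) (yc W (φ P)) (l P)), (φ + ψ) P = .some _ _ h := by
    filter_upwards [h0, h0', hne] with P h1 h2 h3
    obtain ⟨hP, eP⟩ := exists_some h1
    obtain ⟨hP', eP'⟩ := exists_some h2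
    refine ⟨nonsingular_add hP hP' h3, ?_⟩
    change φ P + ψ P = _
    conv_lhs => rw [eP, eP']
    exact Point.add_some h3
  have hX : IsRatFun W fun P ↦ W.addX (xc W (φ P)) (xc W (ψ P)) (l P) :=
    (((((hl.mul hl).add ((isRatFun_const W.a₁).mul hl)).sub (isRatFun_const W.a₂)).sub hx).sub
      hx').congr (.of_forall fun P ↦ by simp only [addX]; ring)
  have hY : IsRatFun W fun P ↦ W.addY (xc W (φ P)) (xc W (ψ P)) (yc W (φ P)) (l P) :=
    ((((hl.mul (hX.sub hx)).add hy).neg.sub ((isRatFun_const W.a₁).mul hX)).sub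
      (isRatFun_const W.a₃)).congr (.of_forall fun P ↦ by simp only [addY, negAddY, negY])
  refine (isRational_iff _).mpr ⟨hX.congr ?_, hY.congr ?_, ?_⟩
  · filter_upwards [key] with P ⟨h1, h2⟩
    rw [h2]; rfl
  · filter_upwards [key] with P ⟨h1, h2⟩
    rw [h2]; rfl
  · filter_upwards [key] with P ⟨h1, h2⟩
    rw [h2]
    exact fun h ↦ by cases h

lemma isRational_add {φ ψ : AddMonoid.End W.Point} (h : IsRational W φ) (h' : IsRational W ψ) :
    φ + ψ = 0 ∨ IsRational W ⇑(φ + ψ) := by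
  obtain ⟨hx, hy, h0⟩ := (isRational_iff _).mp h
  obtain ⟨hx', hy', h0'⟩ := (isRational_iff _).mp h'
  rcases (hx.sub hx').dichotomy with e | e
  · have hn : IsRatFun W fun P ↦ W.negY (xc W (ψ P)) (yc W (ψ P)) :=
      (hy'.neg.sub ((isRatFun_const W.a₁).mul hx')).sub (isRatFun_const W.a₃)
    rcases (hy.sub hn).dichotomy with e' | e'
    · left
      apply eq_zero_of_eventually
      filter_upwards [h0, h0', e, e'] with P h1 h2 h3 h4
      obtain ⟨hP, eP⟩ := exists_some h1
      obtain ⟨hP', eP'⟩ := exists_some h2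
      change φ P + ψ P = _
      rw [eP, eP']
      exact Point.add_of_Y_eq (sub_eq_zero.mp h3) (sub_eq_zero.mp h4)
    · right
      refine isRational_add_aux h h' (e'.mono fun P h1 h2 ↦ h1 (sub_eq_zero.mpr h2.2)) ?_
      have hnum := ((((isRatFun_const 3).mul (hx.mul hx)).add
        (((isRatFun_const 2).mul (isRatFun_const W.a₂)).mul hx)).add (isRatFun_const W.a₄)).sub
          ((isRatFun_const W.a₁).mul hy)
      have hneg : IsRatFun W fun P ↦ W.negY (xc W (φ P)) (yc W (φ P)) :=
        (hy.neg.sub ((isRatFun_const W.a₁).mul hx)).sub (isRatFun_const W.a₃)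
      refine (hnum.div (hy.sub hneg)).congr ?_
      filter_upwards [e, e'] with P h1 h2
      rw [slope_of_Y_ne (sub_eq_zero.mp h1) fun h ↦ h2 (sub_eq_zero.mpr h)]
      ring
  · right
    refine isRational_add_aux h h' (e.mono fun P h1 h2 ↦ h1 (sub_eq_zero.mpr h2.1)) ?_
    refine ((hy.sub hy').div (hx.sub hx')).congr ?_
    filter_upwards [e] with P h1
    rw [slope_of_X_ne fun h ↦ h1 (sub_eq_zero.mpr h)]

variable (W)

/-- The endomorphism ring of an elliptic curve `W` over an algebraically closed field `k`: the ring
of those endomorphisms of the group `W(k)` that are zero or given by rational functions, with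
pointwise addition and with composition as multiplication. -/
def endRing : Subring (AddMonoid.End W.Point) where
  carrier := {φ | φ = 0 ∨ IsRational W φ}
  zero_mem' := Or.inl rfl
  one_mem' := Or.inr <| (isRational_iff _).mpr
    ⟨isRatFun_xc, isRatFun_yc, eventually_ne .zero⟩
  neg_mem' := by
    rintro φ (rfl | h)
    · exact Or.inl neg_zero
    · exact Or.inr (isRational_neg h)
  add_mem' := by
    rintro φ ψ (rfl | h) (rfl | h')
    · exact Or.inl (add_zero 0)
    · rw [zero_add]; exact Or.inr h'
    · rw [add_zero]; exact Or.inr h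
    · exact isRational_add h h'
  mul_mem' := by
    rintro φ ψ (rfl | h) (rfl | h')
    · exact Or.inl (mul_zero 0)
    · exact Or.inl (zero_mul ψ)
    · exact Or.inl (mul_zero φ)
    · right
      obtain ⟨hx, hy, h0⟩ := (isRational_iff _).mp h
      have ht := tendsto_of_isRational h'
      exact (isRational_iff _).mpr ⟨hx.comp h' ht, hy.comp h' ht, ht.eventually h0⟩

end General

/-- An elliptic curve over an algebraically closed field of characteristic `p` is supersingular if
it has no nonzero point of order `p`. -/
def IsSupersingular {k : Type*} [Field k] [IsAlgClosed k] [DecidableEq k] (p : ℕ) [CharP k p]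
    (W : WeierstrassCurve.Affine k) [W.IsElliptic] : Prop :=
  ∀ P : W.Point, p • P = 0 → P = 0

section Family

variable {k : Type*} [Field k]

/-- The Legendre curve `y² = x (x - 1) (x - t)`. -/
def legendre (t : k) : WeierstrassCurve.Affine k :=
  { a₁ := 0, a₂ := -(1 + t), a₃ := 0, a₄ := t, a₆ := 0 }

lemma legendre_equation_iff (t x y : k) :
    (legendre t).Equation x y ↔ y ^ 2 = x * (x - 1) * (x - t) := by
  rw [equation_iff]
  simp only [legendre]
  constructor <;> intro h <;> linear_combination h

/-- The parameter `Λ^ε(l) = (1 - l) (l + ε s)²`, where `s` is a square root of `l² - l + 1`. -/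
def bigLambda (l s : k) (ε : ℤˣ) : k := (1 - l) * (l + (ε : ℤ) * s) ^ 2

/-- The curve `E_{Λ^ε(l)} : y² = x (x - 1) (x - Λ^ε(l))`. -/
abbrev epsCurve (l s : k) (ε : ℤˣ) : WeierstrassCurve.Affine k := legendre (bigLambda l s ε)

/-- The first coordinate `(l + 1 + 2 ε s) / 3` of a point of order three of
`epsCurve l s ε`. -/
def x₀ (l s : k) (ε : ℤˣ) : k := (l + 1 + 2 * (ε : ℤ) * s) / 3

/-- The coefficient `A^ε(l)`. -/
def coeffA (l s : k) (ε : ℤˣ) : k := (l ^ 2 - l + 1) * (2 * l - 1 + 2 * (ε : ℤ) * s)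

/-- The coefficient `B^ε(l)`. -/
def coeffB (l s : k) (ε : ℤˣ) : k :=
  -(2 * (l ^ 2 - l + 1) * (2 * l - 1) + (ε : ℤ) * (5 * l ^ 2 - 5 * l + 2) * s) /
    (9 * (l ^ 2 - l + 1))

/-- The scaling factor `r_ε = (2 l + 2 ε s - 1) / 9`. -/
def scaleR (l s : k) (ε : ℤˣ) : k := (2 * l + 2 * (ε : ℤ) * s - 1) / 9

/-- The first coordinate of the isogeny `ψ^ε` of degree three from `epsCurve l s ε` to
`epsCurve l s (-ε)`, at an affine point `(x, y)` with `x ≠ x₀ l s ε`. -/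
def psiX (l s : k) (ε : ℤˣ) (x y : k) : k :=
  let A := coeffA l s ε
  let B := coeffB l s ε
  let X := x - x₀ l s ε
  scaleR l s (-ε) ^ 2 *
    (3 * (6 * y ^ 2 + 6 * A * B ^ 2 - 3 * X ^ 3 - 2 * A * X ^ 2) / X ^ 2) + x₀ l s (-ε)

/-- The second coordinate of the isogeny `ψ^ε`, at an affine point `(x, y)` with
`x ≠ x₀ l s ε`. -/
def psiY (l s : k) (ε : ℤˣ) (x y : k) : k :=
  let A := coeffA l s ε
  let B := coeffB l s ε
  let X := x - x₀ l s ε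
  scaleR l s (-ε) ^ 3 * (27 * y * (8 * A * B ^ 2 - X ^ 3 - 4 * A * B * X) / X ^ 3)

/-- The map `φ` is the composition of `ψ^ε` with the `p`-th power Frobenius map. The kernel of
`ψ^ε` consists of the point at infinity and of the points with first coordinate `x₀ l s ε`. -/
def IsFrobeniusPsi (p : ℕ) (l s : k) (ε : ℤˣ)
    (φ : (epsCurve l s ε).Point → (epsCurve l s ε).Point) : Prop :=
  φ .zero = .zero ∧
  ∀ (x y : k) (h : (epsCurve l s ε).Nonsingular x y),
    (x = x₀ l s ε → φ (.some x y h) = .zero) ∧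
    (x ≠ x₀ l s ε → ∃ h', φ (.some x y h) = .some (psiX l s ε x y ^ p) (psiY l s ε x y ^ p) h')

end Family

/-- The complex number `√(-3p)`. -/
noncomputable def sqrtNegThreeMul (p : ℕ) : ℂ := (Real.sqrt (3 * p) : ℂ) * Complex.I

/-- The subring `ℤ[(1 + √(-3p)) / 2]` of `ℂ`. -/
noncomputable def quadOrder (p : ℕ) : Subalgebra ℤ ℂ :=
  Algebra.adjoin ℤ {(1 + sqrtNegThreeMul p) / 2}

lemma sqrtNegThreeMul_mem (p : ℕ) : sqrtNegThreeMul p ∈ quadOrder p := by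
  have h : (1 + sqrtNegThreeMul p) / 2 ∈ quadOrder p := Algebra.subset_adjoin rfl
  have h2 := sub_mem (add_mem h h) (one_mem (quadOrder p))
  convert h2 using 1
  ring

end EllipticEnd

/-! The two curves are linked by explicit isogenies of degree three. Around the flex with abscissa
`x₀` the curve reads `y² = X³ + A (X - B)²` (`isThreeForm_epsCurve`). The quotient by the points
with `X = 0` has the same shape, and after scaling by `r` it is the curve with the opposite sign.
Going there and back is multiplication by -3, the sign coming from `27 r r' = -1` (`exists_isPsi`).

Frobenius exchanges the two curves. If `s` were in `𝔽_p`, they would be Legendre curves over `𝔽_p`,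
and `not_isSupersingular_of_mod_four` forbids this: the number of points over the extension of
degree `n` is `1 - H ^ n` modulo `p`, with `H` the Hasse invariant. If `H ≠ 0`, then `n = p - 1`
yields a point of order `p`. If `H = 0`, the count over `𝔽_p` is 1, `p + 1` or `2p + 1`, never
divisible by 4 although all 2-torsion is rational. Hence `s ^ p = -s`, so Frobenius carries `ψ^ε` to
`ψ^{-ε}`, and `φ = F ∘ ψ^ε` satisfies `φ² = -3 F²`.

Next, `F² = p` (`IsSupersingular.smul_eq_frobenius_sq`). Without `p`-torsion, multiplication by `p`
is an injective polynomial on abscissae, so `x ↦ x ^ p ^ m`. A degree bound and the fact that `Λ` is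
not in `𝔽_p` leave only `m = 2`. The sign is read off at a point of order four over `𝔽_{p²}`, which
`p` fixes because `p ≡ 1 (mod 4)`.

Thus `φ² = -3p`. Moreover `φ` fixes the 2-torsion, so `1 + φ` kills it and factors through doubling.
That the factor `β` is again given by rational functions is a descent along doubling
(`exists_two_smul_eq`). Finally `β² = β - c` with `4c = 1 + 3p`, and 1 and `β` are independent over
`ℤ` because the norm form is definite and no nonzero integer kills the curve. -/

namespace EllipticEnd

open WeierstrassCurve WeierstrassCurve.Affine Filter

set_option linter.unusedSectionVars false

/-! ### Group law by slopes, and additivity from generic additivity -/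

section ShortForm

variable {k : Type*} [Field k] {W : WeierstrassCurve.Affine k}

lemma negY_of_short (h₁ : W.a₁ = 0) (h₃ : W.a₃ = 0) (x y : k) : W.negY x y = -y := by
  simp [negY, h₁, h₃]

variable [DecidableEq k]

/-- Addition of two points with distinct first coordinates, given the slope of their chord. -/
lemma add_of_slope (h₁ : W.a₁ = 0) (h₃ : W.a₃ = 0) {x₁ y₁ x₂ y₂ x₃ y₃ m : k}
    (hP : W.Nonsingular x₁ y₁) (hQ : W.Nonsingular x₂ y₂) (hx : x₁ ≠ x₂)
    (hm : y₁ - y₂ = m * (x₁ - x₂)) (e₃ : x₃ = m ^ 2 - W.a₂ - x₁ - x₂)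
    (ey : y₃ = -(y₁ + m * (x₃ - x₁))) :
    ∃ h, Point.some x₁ y₁ hP + Point.some x₂ y₂ hQ = Point.some x₃ y₃ h := by
  have hs : W.slope x₁ x₂ y₁ y₂ = m := by
    rw [slope_of_X_ne hx, hm, mul_div_cancel_right₀ _ (sub_ne_zero.mpr hx)]
  have hX : W.addX x₁ x₂ m = x₃ := by rw [e₃, addX, h₁]; ring
  have hY : W.addY x₁ x₂ y₁ m = y₃ := by
    rw [addY, negY_of_short h₁ h₃, negAddY, hX, ey]; ring
  have h := nonsingular_add hP hQ fun h ↦ hx h.1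
  refine ⟨by rwa [hs, hX, hY] at h, ?_⟩
  rw [Point.add_of_X_ne hx]
  simp only [hs, hX, hY]

/-- Doubling of a point, given the slope of the tangent. -/
lemma double_of_slope (h₁ : W.a₁ = 0) (h₃ : W.a₃ = 0) {x₁ y₁ x₃ y₃ m : k}
    (hP : W.Nonsingular x₁ y₁) (hy : 2 * y₁ ≠ 0)
    (hm : m * (2 * y₁) = 3 * x₁ ^ 2 + 2 * W.a₂ * x₁ + W.a₄) (e₃ : x₃ = m ^ 2 - W.a₂ - 2 * x₁)
    (ey : y₃ = -(y₁ + m * (x₃ - x₁))) :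
    ∃ h, 2 • Point.some x₁ y₁ hP = Point.some x₃ y₃ h := by
  have hy' : y₁ ≠ W.negY x₁ y₁ := by
    rw [negY_of_short h₁ h₃]
    intro h
    apply hy
    linear_combination h
  have hs : W.slope x₁ x₁ y₁ y₁ = m := by
    rw [slope_of_Y_ne rfl hy', negY_of_short h₁ h₃, h₁, sub_neg_eq_add, ← two_mul,
      div_eq_iff hy, hm]
    ring
  have hX : W.addX x₁ x₁ m = x₃ := by rw [e₃, addX, h₁]; ring
  have hY : W.addY x₁ x₁ y₁ m = y₃ := by
    rw [addY, negY_of_short h₁ h₃, negAddY, hX, ey]; ring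
  have h := nonsingular_add hP hP fun h ↦ hy' h.2
  refine ⟨by rwa [hs, hX, hY] at h, ?_⟩
  rw [two_smul, Point.add_self_of_Y_ne hy']
  simp only [hs, hX, hY]

/-- A map between groups of points is additive if it is additive up to finitely many exceptions. -/
lemma map_add_of_eventually {G H : Type*} [AddCommGroup G] [Infinite G] [AddCommGroup H] (f : G → H)
    (hf : ∀ P, ∀ᶠ Q in cofinite, f (P + Q) = f P + f Q) (P Q : G) : f (P + Q) = f P + f Q := by
  have ht : Tendsto (fun R : G ↦ Q + R) cofinite cofinite :=
    (add_right_injective Q).tendsto_cofinite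
  obtain ⟨R, ⟨h1, h2⟩, h3⟩ := ((hf (P + Q)).and (ht.eventually (hf P))|>.and (hf Q)).exists
  have : f (P + Q) + f R = f P + f Q + f R := by
    rw [← h1, add_assoc, h2, h3, add_assoc]
  exact add_right_cancel this

end ShortForm

/-! ### Identities behind the isogeny of degree three -/

section ThreeIsogeny

variable {k : Type*} [Field k]

/-- The curve `W` has the equation `y² = X³ + A (X - B)²` with `X = x - x₀`. -/
structure IsThreeForm (W : WeierstrassCurve.Affine k) (x₀ A B : k) : Prop where
  a₁ : W.a₁ = 0
  a₂ : W.a₂ = A - 3 * x₀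
  a₃ : W.a₃ = 0
  a₄ : W.a₄ = 3 * x₀ ^ 2 - 2 * A * x₀ - 2 * A * B
  a₆ : W.a₆ = -x₀ ^ 3 + A * (x₀ + B) ^ 2

lemma IsThreeForm.equation_iff {W : WeierstrassCurve.Affine k} {x₀ A B : k}
    (hW : IsThreeForm W x₀ A B) (x y : k) :
    W.Equation x y ↔ y ^ 2 = (x - x₀) ^ 3 + A * (x - x₀ - B) ^ 2 := by
  rw [Affine.equation_iff, hW.a₁, hW.a₂, hW.a₃, hW.a₄, hW.a₆]
  constructor <;> intro h <;> linear_combination h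

/-- Otherwise the point `(x₀, 0)` would lie on the curve and both partial derivatives would vanish
there. -/
lemma IsThreeForm.mul_ne_zero {W : WeierstrassCurve.Affine k} [W.IsElliptic] {x₀ A B : k}
    (hW : IsThreeForm W x₀ A B) : A * B ≠ 0 := by
  intro h
  have h1 : W.Nonsingular x₀ 0 := by
    rw [← equation_iff_nonsingular, hW.equation_iff]
    linear_combination -B * h
  rw [nonsingular_iff] at h1
  rcases h1.2 with h2 | h2
  · apply h2
    rw [hW.a₁, hW.a₂, hW.a₄]
    linear_combination 2 * h
  · apply h2
    rw [hW.a₁, hW.a₃]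
    ring

/-- The first coordinate of the isogeny of degree three with kernel `x = x₀`. -/
def threeX (A B r x₀ x₁ x y : k) : k :=
  r ^ 2 * (3 * (6 * y ^ 2 + 6 * A * B ^ 2 - 3 * (x - x₀) ^ 3 - 2 * A * (x - x₀) ^ 2) /
    (x - x₀) ^ 2) + x₁

/-- The second coordinate of the isogeny of degree three with kernel `x = x₀`. -/
def threeY (A B r x₀ x y : k) : k :=
  r ^ 3 * (27 * y * (8 * A * B ^ 2 - (x - x₀) ^ 3 - 4 * A * B * (x - x₀)) / (x - x₀) ^ 3)

/-- Eliminating `y²` makes the abscissa of the image a function of `x` alone, so that later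
identities involve a single variable. -/
lemma threeX_eq {A B r x₀ x₁ x y : k} (hx : x - x₀ ≠ 0)
    (h : y ^ 2 = (x - x₀) ^ 3 + A * (x - x₀ - B) ^ 2) :
    threeX A B r x₀ x₁ x y = r ^ 2 * (3 * (3 * (x - x₀) ^ 3 + 4 * A * (x - x₀) ^ 2 -
      12 * A * B * (x - x₀) + 12 * A * B ^ 2) / (x - x₀) ^ 2) + x₁ := by
  rw [threeX, h]
  field_simp
  ring

/-- The image has the same shape with new constants `A` and `B`, so the isogeny in the other
direction is an instance of the same formulas. -/
lemma equation_three {A B r x₀ x₁ x y : k} (hx : x - x₀ ≠ 0)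
    (h : y ^ 2 = (x - x₀) ^ 3 + A * (x - x₀ - B) ^ 2) :
    threeY A B r x₀ x y ^ 2 = (threeX A B r x₀ x₁ x y - x₁) ^ 3 +
      (-27 * A * r ^ 2) * (threeX A B r x₀ x₁ x y - x₁ - (4 * A + 27 * B) * r ^ 2) ^ 2 := by
  rw [threeX_eq hx h, add_sub_cancel_right, threeY, mul_pow, div_pow, mul_pow, mul_pow, h]
  generalize x - x₀ = X at *
  field_simp
  ring

/-- The isogeny maps the points of the line `y = m X + c` to points of a line. -/
lemma three_line {A B m c X : k} (hX : X ≠ 0) (he : c ^ 2 - A * B ^ 2 ≠ 0)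
    (h : (m * X + c) ^ 2 = X ^ 3 + A * (X - B) ^ 2) :
    27 * (m * X + c) * (8 * A * B ^ 2 - X ^ 3 - 4 * A * B * X) / X ^ 3 =
      (-3 * (m * (c ^ 2 + 3 * A * B ^ 2) + 4 * c * A * B) / (c ^ 2 - A * B ^ 2)) *
        (3 * (3 * X ^ 3 + 4 * A * X ^ 2 - 12 * A * B * X + 12 * A * B ^ 2) / X ^ 2) +
      (27 * (m * (A - m ^ 2) - c + 8 * c * A * B ^ 2 / (c ^ 2 - A * B ^ 2)) -
        (-3 * (m * (c ^ 2 + 3 * A * B ^ 2) + 4 * c * A * B) / (c ^ 2 - A * B ^ 2)) *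
          (9 * m ^ 2 + 3 * A)) := by
  field_simp
  linear_combination (-(108 * A * B * (m * B + c) * X - 216 * c * A * B ^ 2)) * h

/-- The hypotheses are Vieta's relations for the three intersections of `y = m X + c` with the
curve. The conclusion is Vieta's relation for the sum of the abscissae on the image line, whose
slope is the one in `three_line`, the image curve having `-27 A` in place of `A`. The left side is
symmetric, so `key` rewrites it in elementary symmetric functions. -/
lemma three_sum {A B m c X₁ X₂ X₃ : k} (h₁ : X₁ ≠ 0) (h₂ : X₂ ≠ 0) (h₃ : X₃ ≠ 0)
    (e₁ : X₁ + X₂ + X₃ = m ^ 2 - A) (e₂ : X₁ * X₂ + X₁ * X₃ + X₂ * X₃ = -2 * A * B - 2 * m * c)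
    (e₃ : X₁ * X₂ * X₃ = c ^ 2 - A * B ^ 2) :
    3 * (3 * X₁ ^ 3 + 4 * A * X₁ ^ 2 - 12 * A * B * X₁ + 12 * A * B ^ 2) / X₁ ^ 2 +
      3 * (3 * X₂ ^ 3 + 4 * A * X₂ ^ 2 - 12 * A * B * X₂ + 12 * A * B ^ 2) / X₂ ^ 2 +
      3 * (3 * X₃ ^ 3 + 4 * A * X₃ ^ 2 - 12 * A * B * X₃ + 12 * A * B ^ 2) / X₃ ^ 2 =
    (-3 * (m * (c ^ 2 + 3 * A * B ^ 2) + 4 * c * A * B) / (c ^ 2 - A * B ^ 2)) ^ 2 + 27 * A := by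
  have he : c ^ 2 - A * B ^ 2 ≠ 0 := by
    rw [← e₃]; exact mul_ne_zero (mul_ne_zero h₁ h₂) h₃
  have key : 3 * (3 * X₁ ^ 3 + 4 * A * X₁ ^ 2 - 12 * A * B * X₁ + 12 * A * B ^ 2) / X₁ ^ 2 +
      3 * (3 * X₂ ^ 3 + 4 * A * X₂ ^ 2 - 12 * A * B * X₂ + 12 * A * B ^ 2) / X₂ ^ 2 +
      3 * (3 * X₃ ^ 3 + 4 * A * X₃ ^ 2 - 12 * A * B * X₃ + 12 * A * B ^ 2) / X₃ ^ 2 =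
      9 * (X₁ + X₂ + X₃) + 36 * A - 36 * A * B * ((X₁ * X₂ + X₁ * X₃ + X₂ * X₃) / (X₁ * X₂ * X₃)) +
      36 * A * B ^ 2 * (((X₁ * X₂ + X₁ * X₃ + X₂ * X₃) ^ 2 -
        2 * (X₁ + X₂ + X₃) * (X₁ * X₂ * X₃)) / (X₁ * X₂ * X₃) ^ 2) := by
    field_simp
    ring
  rw [key, e₁, e₂, e₃]
  field_simp
  ring

end ThreeIsogeny

/-! ### The isogeny of degree three as a homomorphism, and its dual -/

section Isogeny

variable {k : Type*} [Field k]

lemma eventually_eval_xc_ne {W : WeierstrassCurve.Affine k} {N : k[X]} (hN : N ≠ 0) :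
    ∀ᶠ P : W.Point in cofinite, N.eval (xc W P) ≠ 0 :=
  (finite_xc (Polynomial.finite_setOfPred_isRoot hN)).eventually_cofinite_notMem

lemma eventually_xc_ne {W : WeierstrassCurve.Affine k} (c : k) :
    ∀ᶠ P : W.Point in cofinite, xc W P ≠ c :=
  (finite_xc (Set.finite_singleton c)).eventually_cofinite_notMem

variable {W W' : WeierstrassCurve.Affine k} [W'.IsElliptic]
  {x₀ x₁ A B r : k}

lemma three_nonsingular (hW : IsThreeForm W x₀ A B)
    (hW' : IsThreeForm W' x₁ (-27 * A * r ^ 2) ((4 * A + 27 * B) * r ^ 2)) {x y : k}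
    (h : W.Nonsingular x y) (hx : x ≠ x₀) :
    W'.Nonsingular (threeX A B r x₀ x₁ x y) (threeY A B r x₀ x y) := by
  rw [← equation_iff_nonsingular, hW'.equation_iff]
  exact equation_three (sub_ne_zero.mpr hx) ((hW.equation_iff x y).mp h.1)

/-- The isogeny of degree three with kernel `x = x₀`, as a function. -/
def threeFun [DecidableEq k] (hW : IsThreeForm W x₀ A B)
    (hW' : IsThreeForm W' x₁ (-27 * A * r ^ 2) ((4 * A + 27 * B) * r ^ 2)) : W.Point → W'.Point
  | .zero => .zero
  | .some x y h => if hx : x = x₀ then .zero else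
      .some (threeX A B r x₀ x₁ x y) (threeY A B r x₀ x y) (three_nonsingular hW hW' h hx)

variable [DecidableEq k] [W.IsElliptic] (hW : IsThreeForm W x₀ A B)
    (hW' : IsThreeForm W' x₁ (-27 * A * r ^ 2) ((4 * A + 27 * B) * r ^ 2))

omit [W.IsElliptic] in
lemma threeFun_zero : threeFun hW hW' 0 = 0 := rfl

omit [W.IsElliptic] in
lemma threeFun_kernel {x y : k} (h : W.Nonsingular x y) (hx : x = x₀) :
    threeFun hW hW' (.some x y h) = 0 := by
  simp [threeFun, hx]; rfl

omit [W.IsElliptic] in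
lemma threeFun_some {x y : k} (h : W.Nonsingular x y) (hx : x ≠ x₀) :
    threeFun hW hW' (.some x y h) =
      .some (threeX A B r x₀ x₁ x y) (threeY A B r x₀ x y) (three_nonsingular hW hW' h hx) := by
  simp [threeFun, hx]

omit [W.IsElliptic] in
-- Three collinear points go to three collinear points by `three_line`, and `three_sum` shows that
-- these account for all intersections with the image line. The inequalities keep both chords away
-- from tangents and from the kernel.
lemma threeFun_add_of_ne {x y x' y' : k} (h : W.Nonsingular x y)
    (h' : W.Nonsingular x' y') (hx : x ≠ x₀) (hx' : x' ≠ x₀) (hxx : x ≠ x')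
    (hu : threeX A B r x₀ x₁ x y ≠ threeX A B r x₀ x₁ x' y')
    (hs : xc W (.some x y h + .some x' y' h') ≠ x₀) :
    threeFun hW hW' (.some x y h + .some x' y' h') =
      threeFun hW hW' (.some x y h) + threeFun hW hW' (.some x' y' h') := by
  have hd : x - x' ≠ 0 := sub_ne_zero.mpr hxx
  obtain ⟨m, hm⟩ : ∃ m, y - y' = m * (x - x') := ⟨(y - y') / (x - x'), by field_simp⟩
  obtain ⟨x₃, e₃⟩ : ∃ x₃, x₃ = m ^ 2 - W.a₂ - x - x' := ⟨_, rfl⟩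
  obtain ⟨y₃, ey⟩ : ∃ y₃, y₃ = -(y + m * (x₃ - x)) := ⟨_, rfl⟩
  obtain ⟨h₃, hadd⟩ := add_of_slope hW.a₁ hW.a₃ h h' hxx hm e₃ ey
  rw [hadd] at hs ⊢
  change x₃ ≠ x₀ at hs
  rw [threeFun_some hW hW' h hx, threeFun_some hW hW' h' hx', threeFun_some hW hW' h₃ hs]
  have q := (hW.equation_iff x y).mp h.1
  have q' := (hW.equation_iff x' y').mp h'.1
  have q₃ := (hW.equation_iff x₃ y₃).mp h₃.1
  -- The chord in the coordinate `X = x - x₀`. Its third point is the negative of the sum, which is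
  -- why `-y₃` occurs below.
  obtain ⟨c, hc⟩ : ∃ c, y = m * (x - x₀) + c := ⟨y - m * (x - x₀), by ring⟩
  have hc' : y' = m * (x' - x₀) + c := by linear_combination hc - hm
  have hc₃ : -y₃ = m * (x₃ - x₀) + c := by rw [ey]; linear_combination hc
  rw [hW.a₂] at e₃
  have X0 := sub_ne_zero.mpr hx
  have X0' := sub_ne_zero.mpr hx'
  have X0₃ := sub_ne_zero.mpr hs
  have E₁ : (x - x₀) + (x' - x₀) + (x₃ - x₀) = m ^ 2 - A := by rw [e₃]; ring
  have E₂ : (x - x₀) * (x' - x₀) + (x - x₀) * (x₃ - x₀) + (x' - x₀) * (x₃ - x₀) =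
      -2 * A * B - 2 * m * c := by
    -- The difference of the cubic equations at the two points is divisible by `x - x'`.
    apply mul_left_cancel₀ hd
    rw [e₃]
    rw [hc] at q
    rw [hc'] at q'
    linear_combination q - q'
  have E₃ : (x - x₀) * (x' - x₀) * (x₃ - x₀) = c ^ 2 - A * B ^ 2 := by
    rw [hc] at q
    linear_combination (x - x₀) * E₂ - (x - x₀) ^ 2 * E₁ - q
  have he : c ^ 2 - A * B ^ 2 ≠ 0 := by
    rw [← E₃]; exact mul_ne_zero (mul_ne_zero X0 X0') X0₃
  have L := three_line X0 he (by rw [← hc, q])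
  have L' := three_line X0' he (by rw [← hc', q'])
  have L₃ := three_line X0₃ he (by rw [← hc₃, neg_sq, q₃])
  have S := three_sum X0 X0' X0₃ E₁ E₂ E₃
  rw [← hc] at L
  rw [← hc'] at L'
  rw [← hc₃] at L₃
  have T := threeX_eq (r := r) (x₁ := x₁) X0 q
  have T' := threeX_eq (r := r) (x₁ := x₁) X0' q'
  have T₃ := threeX_eq (r := r) (x₁ := x₁) X0₃ q₃
  set M := (-3 * (m * (c ^ 2 + 3 * A * B ^ 2) + 4 * c * A * B) / (c ^ 2 - A * B ^ 2)) with hM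
  clear_value M
  generalize 27 * (m * (A - m ^ 2) - c + 8 * c * A * B ^ 2 / (c ^ 2 - A * B ^ 2)) -
        M * (9 * m ^ 2 + 3 * A) = C at L L' L₃
  have V : threeY A B r x₀ x y = r ^ 3 * (27 * y * (8 * A * B ^ 2 - (x - x₀) ^ 3 -
    4 * A * B * (x - x₀)) / (x - x₀) ^ 3) := rfl
  have V' : threeY A B r x₀ x' y' = r ^ 3 * (27 * y' * (8 * A * B ^ 2 - (x' - x₀) ^ 3 -
    4 * A * B * (x' - x₀)) / (x' - x₀) ^ 3) := rfl
  have V₃ : threeY A B r x₀ x₃ y₃ = -(r ^ 3 * (27 * (-y₃) * (8 * A * B ^ 2 - (x₃ - x₀) ^ 3 -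
    4 * A * B * (x₃ - x₀)) / (x₃ - x₀) ^ 3)) := by rw [threeY]; ring
  rw [L] at V
  rw [L'] at V'
  rw [L₃] at V₃
  generalize 3 * (3 * (x - x₀) ^ 3 + 4 * A * (x - x₀) ^ 2 - 12 * A * B * (x - x₀) +
    12 * A * B ^ 2) / (x - x₀) ^ 2 = u at *
  generalize 3 * (3 * (x' - x₀) ^ 3 + 4 * A * (x' - x₀) ^ 2 - 12 * A * B * (x' - x₀) +
    12 * A * B ^ 2) / (x' - x₀) ^ 2 = u' at *
  generalize 3 * (3 * (x₃ - x₀) ^ 3 + 4 * A * (x₃ - x₀) ^ 2 - 12 * A * B * (x₃ - x₀) +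
    12 * A * B ^ 2) / (x₃ - x₀) ^ 2 = u₃ at *
  obtain ⟨h4, e4⟩ := add_of_slope hW'.a₁ hW'.a₃ (three_nonsingular hW hW' h hx)
    (three_nonsingular hW hW' h' hx') hu (m := r * M) (x₃ := threeX A B r x₀ x₁ x₃ y₃)
    (y₃ := threeY A B r x₀ x₃ y₃) (by rw [V, V', T, T']; ring)
    (by rw [T, T', T₃, hW'.a₂]; linear_combination r ^ 2 * S) (by rw [V, V₃, T, T₃]; ring)
  rw [e4]

/-- Translation by a point of the kernel. -/
lemma threeFun_kernel_add (h2 : (2 : k) ≠ 0) {y x' y' : k} (h : W.Nonsingular x₀ y)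
    (h' : W.Nonsingular x' y') (hx' : x' ≠ x₀) :
    threeFun hW hW' (.some x₀ y h + .some x' y' h') = threeFun hW hW' (.some x' y' h') := by
  have X0' := sub_ne_zero.mpr hx'
  obtain ⟨m, hm⟩ : ∃ m, y' = y + m * (x' - x₀) := ⟨(y' - y) / (x' - x₀), by field_simp; ring⟩
  obtain ⟨x₃, e₃⟩ : ∃ x₃, x₃ = m ^ 2 - W.a₂ - x₀ - x' := ⟨_, rfl⟩
  obtain ⟨y₃, ey⟩ : ∃ y₃, y₃ = -(y + m * (x₃ - x₀)) := ⟨_, rfl⟩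
  obtain ⟨h₃, hadd⟩ := add_of_slope hW.a₁ hW.a₃ h h' hx'.symm (by linear_combination -hm) e₃ ey
  have hAB := hW.mul_ne_zero
  have q := (hW.equation_iff x₀ y).mp h.1
  have q' := (hW.equation_iff x' y').mp h'.1
  have q₃ := (hW.equation_iff x₃ y₃).mp h₃.1
  rw [hW.a₂] at e₃
  rw [hadd]
  have hy : y ^ 2 = A * B ^ 2 := by linear_combination q
  have E₁ : (x' - x₀) + (x₃ - x₀) = m ^ 2 - A := by rw [e₃]; ring
  have E₂ : (x' - x₀) * (x₃ - x₀) = -2 * A * B - 2 * m * y := by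
    apply mul_left_cancel₀ X0'
    rw [hm] at q'
    linear_combination q' - hy + (x' - x₀) ^ 2 * E₁
  -- If the sum were in the kernel, then `m y = -A B`, hence `m² = A`, and `E₁` would put `x'` at
  -- `x₀`.
  have hs : x₃ ≠ x₀ := by
    rintro rfl
    have e1 : m * y = -(A * B) := by
      apply mul_left_cancel₀ h2
      linear_combination E₂
    have hB : B ≠ 0 := right_ne_zero_of_mul hAB
    have hA : A ≠ 0 := left_ne_zero_of_mul hAB
    have e2 : m ^ 2 = A := by
      apply mul_right_cancel₀ (mul_ne_zero hA (pow_ne_zero 2 hB))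
      linear_combination (m * y - A * B) * e1 - m ^ 2 * hy
    exact X0' (by linear_combination E₁ + e2)
  have X0₃ := sub_ne_zero.mpr hs
  rw [threeFun_some hW hW' h' hx', threeFun_some hW hW' h₃ hs]
  have hy0 : y ≠ 0 := by
    rintro rfl
    have : A * B * B = 0 := by linear_combination -hy
    exact mul_ne_zero hAB (right_ne_zero_of_mul hAB) this
  -- Eliminating `m` and `y` from `E₁` and `E₂` leaves a relation symmetric in the two abscissae. It
  -- is the factor of the difference of their images that remains after `x' - x₃`.
  have key : ((x' - x₀) * (x₃ - x₀)) ^ 2 + 4 * A * B * ((x' - x₀) * (x₃ - x₀)) =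
      4 * A * B ^ 2 * ((x' - x₀) + (x₃ - x₀)) := by
    rw [E₁, E₂]
    linear_combination 4 * m ^ 2 * hy
  have hX : threeX A B r x₀ x₁ x₃ y₃ = threeX A B r x₀ x₁ x' y' := by
    rw [threeX_eq X0₃ q₃, threeX_eq X0' q']
    congr 2
    rw [div_eq_div_iff (pow_ne_zero 2 X0₃) (pow_ne_zero 2 X0')]
    linear_combination (-9 * (x' - x₃)) * key
  have hY : threeY A B r x₀ x₃ y₃ = threeY A B r x₀ x' y' := by
    rw [threeY, threeY]
    congr 1
    rw [div_eq_div_iff (pow_ne_zero 3 X0₃) (pow_ne_zero 3 X0')]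
    -- After multiplication by `2 y` the slope enters through `2 m y`, which `E₂` expresses in the
    -- abscissae.
    apply mul_left_cancel₀ (mul_ne_zero h2 hy0)
    rw [ey, hm]
    generalize x' - x₀ = X at *
    generalize x₃ - x₀ = Z at *
    linear_combination -27 * (2 * (8 * A * B ^ 2 * (X ^ 3 + Z ^ 3) - 2 * (X * Z) ^ 3 -
        4 * A * B * (X * Z) * (X ^ 2 + Z ^ 2)) * hy +
      (X * Z * (8 * A * B ^ 2 * (X ^ 2 + Z ^ 2) - (X * Z) ^ 2 * (X + Z) -
        4 * A * B * (X * Z) * (X + Z))) * E₂ + (12 * A * B ^ 2 * (X * Z) + (X + Z) * ((X * Z) ^ 2 +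
        4 * A * B * (X * Z) - 4 * A * B ^ 2 * (X + Z)) - 2 * A * B * (X * Z) * (X + Z)) * key)
  simp only [hX, hY]

/-- For fixed `P`, each failure of the genericity conditions in `threeFun_add_of_ne` occurs for only
finitely many `Q`; `map_add_of_eventually` then removes these exceptions. -/
lemma threeFun_add_eventually [IsAlgClosed k] (h2 : (2 : k) ≠ 0) (h3 : (3 : k) ≠ 0) (hr : r ≠ 0)
    (P : W.Point) :
    ∀ᶠ Q in cofinite, threeFun hW hW' (P + Q) = threeFun hW hW' P + threeFun hW hW' Q := by
  rcases P with _ | ⟨x, y, h⟩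
  · refine .of_forall fun Q ↦ ?_
    rw [← Point.zero_def, zero_add, threeFun_zero, zero_add]
  by_cases hx : x = x₀
  · subst hx
    filter_upwards [eventually_ne .zero, eventually_xc_ne x] with Q hQ hQx
    rcases Q with _ | ⟨x', y', h'⟩
    · exact absurd rfl hQ
    · rw [threeFun_kernel hW hW' h rfl, zero_add, threeFun_kernel_add hW hW' h2 h h' hQx]
  · have hT : ∀ᶠ Q in cofinite, xc W (.some x y h + Q) ≠ x₀ :=
      (add_right_injective (.some x y h)).tendsto_cofinite.eventually (eventually_xc_ne x₀)
    set u := threeX A B r x₀ x₁ x y with hu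
    -- Its roots other than `x₀` are the abscissae with the same image `u`. Its value `36 A B² r²`
    -- at `x₀` shows that it is not zero.
    set N : k[X] := Polynomial.C (9 * r ^ 2) * (Polynomial.X - Polynomial.C x₀) ^ 3 +
      Polynomial.C (12 * A * r ^ 2 - (u - x₁)) * (Polynomial.X - Polynomial.C x₀) ^ 2 -
      Polynomial.C (36 * A * B * r ^ 2) * (Polynomial.X - Polynomial.C x₀) +
      Polynomial.C (36 * A * B ^ 2 * r ^ 2) with hN
    have hN0 : N ≠ 0 := by
      intro h0
      have h1 : N.eval x₀ = (2 * 3 * r) ^ 2 * (A * B) * B := by simp [hN]; ring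
      rw [h0, Polynomial.eval_zero] at h1
      exact mul_ne_zero (mul_ne_zero (pow_ne_zero 2 (mul_ne_zero (mul_ne_zero h2 h3) hr))
        hW.mul_ne_zero) (right_ne_zero_of_mul hW.mul_ne_zero) h1.symm
    filter_upwards [eventually_ne .zero, eventually_xc_ne x₀, eventually_xc_ne x, hT,
      eventually_eval_xc_ne hN0] with Q hQ hQx hQx' hPQ hu'
    rcases Q with _ | ⟨x', y', h'⟩
    · exact absurd rfl hQ
    · refine threeFun_add_of_ne hW hW' h h' hx hQx (Ne.symm hQx') (fun e ↦ hu' ?_) hPQ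
      have X0' : x' - x₀ ≠ 0 := sub_ne_zero.mpr hQx
      have q' := (hW.equation_iff x' y').mp h'.1
      rw [← hu, threeX_eq X0' q'] at e
      have e' : (u - x₁) * (x' - x₀) ^ 2 = r ^ 2 * (3 * (3 * (x' - x₀) ^ 3 + 4 * A * (x' - x₀) ^ 2 -
        12 * A * B * (x' - x₀) + 12 * A * B ^ 2)) := by
        rw [e]; field_simp; ring
      change N.eval x' = 0
      simp only [hN, Polynomial.eval_add, Polynomial.eval_sub, Polynomial.eval_mul,
        Polynomial.eval_pow, Polynomial.eval_C, Polynomial.eval_X]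
      linear_combination -e'

/-- The isogeny of degree three with kernel `x = x₀`. -/
def threeHom [IsAlgClosed k] (h2 : (2 : k) ≠ 0) (h3 : (3 : k) ≠ 0) (hr : r ≠ 0) :
    W.Point →+ W'.Point where
  toFun := threeFun hW hW'
  map_zero' := threeFun_zero hW hW'
  map_add' :=
    have := infinite_point (W := W)
    map_add_of_eventually _ (threeFun_add_eventually hW hW' h2 h3 hr)

/-- Tripling is computed as `2P + P` and compared with the composite. The abscissae agree, and the
ordinates differ by the sign of `27 r r'`. -/
lemma threeFun_threeFun {r' : k} (h2 : (2 : k) ≠ 0) (h3 : (3 : k) ≠ 0) (hr : 27 * r * r' = -1)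
    (hW'' : IsThreeForm W x₀ (-27 * (-27 * A * r ^ 2) * r' ^ 2)
      ((4 * (-27 * A * r ^ 2) + 27 * ((4 * A + 27 * B) * r ^ 2)) * r' ^ 2))
    {x y : k} (h : W.Nonsingular x y) (hx : x - x₀ ≠ 0) (hy : y ≠ 0)
    (hκ : 3 * (x - x₀) ^ 3 + 4 * A * (x - x₀) ^ 2 - 12 * A * B * (x - x₀) + 12 * A * B ^ 2 ≠ 0) :
    threeFun hW' hW'' (threeFun hW hW' (.some x y h)) = -(3 • .some x y h) := by
  have q := (hW.equation_iff x y).mp h.1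
  have h27 : 27 * r * r' ≠ 0 := by rw [hr]; exact neg_ne_zero.mpr one_ne_zero
  have hr0 : r ≠ 0 := fun h ↦ h27 (by rw [h]; ring)
  have hr0' : r' ≠ 0 := fun h ↦ h27 (by rw [h]; ring)
  have hy2 : 2 * y ≠ 0 := mul_ne_zero h2 hy
  obtain ⟨X, hX⟩ : ∃ X, X = x - x₀ := ⟨_, rfl⟩
  have hxx₀ : x ≠ x₀ := sub_ne_zero.mp hx
  rw [← hX] at hx hκ q
  obtain ⟨f, hf⟩ : ∃ f, f = X ^ 3 + A * (X - B) ^ 2 := ⟨_, rfl⟩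
  obtain ⟨g, hg⟩ : ∃ g, g = 3 * X ^ 2 + 2 * A * (X - B) := ⟨_, rfl⟩
  obtain ⟨κ, hκ'⟩ : ∃ κ, κ = 3 * X ^ 3 + 4 * A * X ^ 2 - 12 * A * B * X + 12 * A * B ^ 2 := ⟨_, rfl⟩
  rw [← hκ'] at hκ
  rw [← hf] at q
  have hf0 : f ≠ 0 := by rw [← q]; exact pow_ne_zero 2 hy
  obtain ⟨m, hm⟩ : ∃ m, m = g / (2 * y) := ⟨_, rfl⟩
  have hm' : m * (2 * y) = g := by rw [hm]; field_simp
  obtain ⟨x₂, e₂⟩ : ∃ x₂, x₂ = m ^ 2 - W.a₂ - 2 * x := ⟨_, rfl⟩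
  obtain ⟨y₂, ey₂⟩ : ∃ y₂, y₂ = -(y + m * (x₂ - x)) := ⟨_, rfl⟩
  obtain ⟨h₂, hdbl⟩ := double_of_slope hW.a₁ hW.a₃ h hy2 (m := m) (by
    rw [hm', hg, hW.a₂, hW.a₄, hX]; ring) e₂ ey₂
  rw [hW.a₂] at e₂
  have hmf : m ^ 2 * (4 * f) = g ^ 2 := by rw [← hm', ← q]; ring
  -- Thus `X κ` is the 3-division polynomial, and its nonvanishing says that `2P` and `P` have
  -- different abscissae.
  have hD : (x - x₂) * (4 * f) = X * κ := by
    rw [e₂, hκ']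
    have : x = X + x₀ := by rw [hX]; ring
    rw [this]
    linear_combination -hmf - (g + 3 * X ^ 2 + 2 * A * (X - B)) * hg +
      4 * (3 * X + A) * hf
  have hD0 : x₂ ≠ x := by
    rintro rfl
    rw [sub_self, zero_mul] at hD
    exact mul_ne_zero hx hκ hD.symm
  -- The slope of the chord through `P` and `2P`, namely `-m - 2 y / (x₂ - x)` with `m = g / (2 y)`,
  -- `y² = f` and `hD` inserted.
  obtain ⟨n, hn⟩ : ∃ n, n = y * (16 * f ^ 2 - g * (X * κ)) / (2 * f * (X * κ)) := ⟨_, rfl⟩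
  have hxx : x - x₂ = X * κ / (4 * f) := by
    have h4 : (4 : k) * f ≠ 0 := by
      rw [show (4 : k) = 2 * 2 by norm_num]; exact mul_ne_zero (mul_ne_zero h2 h2) hf0
    rw [eq_div_iff h4, hD]
  have hn' : y₂ - y = n * (x₂ - x) := by
    rw [ey₂, hn, hm, ← neg_sub x x₂, hxx]
    have h4 : (4 : k) ≠ 0 := by
      rw [show (4 : k) = 2 * 2 by norm_num]; exact mul_ne_zero h2 h2
    field_simp
    rw [q]
    ring
  obtain ⟨x₃, e₃⟩ : ∃ x₃, x₃ = n ^ 2 - W.a₂ - x₂ - x := ⟨_, rfl⟩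
  obtain ⟨y₃, ey₃⟩ : ∃ y₃, y₃ = -(y₂ + n * (x₃ - x₂)) := ⟨_, rfl⟩
  obtain ⟨h₃, htr⟩ := add_of_slope hW.a₁ hW.a₃ h₂ h hD0 hn' e₃ ey₃
  have h4 : (4 : k) ≠ 0 := by
    rw [show (4 : k) = 2 * 2 by norm_num]; exact mul_ne_zero h2 h2
  have hx₃ : x₃ - x₀ = X + (64 * f ^ 3 - 8 * f * g * (X * κ)) / (X * κ) ^ 2 := by
    rw [hW.a₂] at e₃
    have e : x₃ - x₀ = n ^ 2 - A - 2 * X + (x - x₂) := by rw [e₃, hX]; ring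
    rw [e, hxx, hn, div_pow, mul_pow, q]
    field_simp
    have hκ2 : X * κ = 4 * f * (3 * X + A) - g ^ 2 := by rw [hκ', hf, hg]; ring
    linear_combination 4 * X ^ 2 * κ ^ 2 * hκ2
  rw [succ_nsmul, hdbl, htr]
  have hu : threeX A B r x₀ x₁ x y - x₁ = r ^ 2 * (3 * κ / X ^ 2) := by
    rw [threeX_eq (hX ▸ hx) (by rw [← hX, q, hf]), ← hX, hκ']; ring
  have hv : threeY A B r x₀ x y =
      r ^ 3 * (27 * y * (8 * A * B ^ 2 - X ^ 3 - 4 * A * B * X) / X ^ 3) := by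
    rw [threeY, hX]
  have hu0 : threeX A B r x₀ x₁ x y - x₁ ≠ 0 := by
    rw [hu]
    exact mul_ne_zero (pow_ne_zero 2 hr0) (div_ne_zero (mul_ne_zero h3 hκ) (pow_ne_zero 2 hx))
  have hns := three_nonsingular hW hW' h hxx₀
  have hq' := (hW'.equation_iff _ _).mp hns.1
  rw [threeFun_some hW hW' h hxx₀, threeFun_some hW' hW'' _ (sub_ne_zero.mp hu0), Point.neg_some]
  have hrr : r' = -1 / (27 * r) := by
    rw [eq_div_iff (left_ne_zero_of_mul h27)]
    linear_combination hr
  have h27' : (27 : k) ≠ 0 := left_ne_zero_of_mul (left_ne_zero_of_mul h27)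
  have hU : threeX (-27 * A * r ^ 2) ((4 * A + 27 * B) * r ^ 2) r' x₁ x₀
      (threeX A B r x₀ x₁ x y) (threeY A B r x₀ x y) = x₃ := by
    rw [threeX_eq hu0 hq', hu, ← sub_eq_zero, add_sub_assoc, ← neg_sub x₃, hx₃, hrr]
    field_simp
    rw [hκ', hf, hg]
    ring
  have hV : threeY (-27 * A * r ^ 2) ((4 * A + 27 * B) * r ^ 2) r' x₁
      (threeX A B r x₀ x₁ x y) (threeY A B r x₀ x y) = -y₃ := by
    have : -y₃ = y + n * ((x₃ - x₀) - X) := by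
      rw [ey₃, hX]
      linear_combination hn'
    rw [this, hx₃, threeY, hu, hv, hn, hrr]
    field_simp
    rw [hκ', hf, hg]
    ring
  simp only [hU, hV, negY_of_short hW.a₁ hW.a₃]

/-- Both sides are homomorphisms, so `threeFun_threeFun` at generic points suffices. The excluded
points are zero, the kernel, the 2-torsion (roots of `N`) and the roots of `N'`. -/
lemma threeHom_threeHom [IsAlgClosed k] {r' : k} (h2 : (2 : k) ≠ 0) (h3 : (3 : k) ≠ 0)
    (hr0 : r ≠ 0) (hr0' : r' ≠ 0) (hr : 27 * r * r' = -1)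
    (hW'' : IsThreeForm W x₀ (-27 * (-27 * A * r ^ 2) * r' ^ 2)
      ((4 * (-27 * A * r ^ 2) + 27 * ((4 * A + 27 * B) * r ^ 2)) * r' ^ 2)) (P : W.Point) :
    threeHom hW' hW'' h2 h3 hr0' (threeHom hW hW' h2 h3 hr0 P) = -(3 • P) := by
  set φ : AddMonoid.End W.Point :=
    ((threeHom hW' hW'' h2 h3 hr0').comp (threeHom hW hW' h2 h3 hr0) : AddMonoid.End W.Point) +
      3 • (1 : AddMonoid.End W.Point) with hφ
  have hφP (P : W.Point) : φ P =
      threeFun hW' hW'' (threeFun hW hW' P) + 3 • P := rfl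
  suffices φ = 0 by
    have h1 := hφP P
    rw [this] at h1
    exact eq_neg_of_add_eq_zero_left h1.symm
  apply eq_zero_of_eventually
  set N : k[X] := (Polynomial.X - Polynomial.C x₀) ^ 3 +
    Polynomial.C A * (Polynomial.X - Polynomial.C x₀ - Polynomial.C B) ^ 2 with hN
  set N' : k[X] := Polynomial.C 3 * (Polynomial.X - Polynomial.C x₀) ^ 3 +
    Polynomial.C (4 * A) * (Polynomial.X - Polynomial.C x₀) ^ 2 -
    Polynomial.C (12 * A * B) * (Polynomial.X - Polynomial.C x₀) +
    Polynomial.C (12 * A * B ^ 2) with hN'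
  have hN0 : N ≠ 0 := by
    intro h0
    have h1 : N.eval x₀ = (A * B) * B := by simp [hN]; ring
    rw [h0, Polynomial.eval_zero] at h1
    exact mul_ne_zero hW.mul_ne_zero (right_ne_zero_of_mul hW.mul_ne_zero) h1.symm
  have hN0' : N' ≠ 0 := by
    intro h0
    have h1 : N'.eval x₀ = 2 * 2 * 3 * ((A * B) * B) := by simp [hN']; ring
    rw [h0, Polynomial.eval_zero] at h1
    exact mul_ne_zero (mul_ne_zero (mul_ne_zero h2 h2) h3)
      (mul_ne_zero hW.mul_ne_zero (right_ne_zero_of_mul hW.mul_ne_zero)) h1.symm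
  filter_upwards [eventually_ne .zero, eventually_xc_ne x₀, eventually_eval_xc_ne hN0,
    eventually_eval_xc_ne hN0'] with P hP hx hy hκ
  rcases P with _ | ⟨x, y, h⟩
  · exact absurd rfl hP
  change x ≠ x₀ at hx
  change N.eval x ≠ 0 at hy
  change N'.eval x ≠ 0 at hκ
  simp only [hN, hN', Polynomial.eval_add, Polynomial.eval_sub, Polynomial.eval_mul,
    Polynomial.eval_pow, Polynomial.eval_C, Polynomial.eval_X] at hy hκ
  rw [hφP, threeFun_threeFun hW hW' h2 h3 hr hW'' h (sub_ne_zero.mpr hx) ?_ hκ, neg_add_cancel]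
  rintro rfl
  exact hy ((hW.equation_iff x 0).mp h.1 ▸ by ring)

end Isogeny

/-! ### Halving points on a Legendre curve, and translation by points of order two -/

section Halving

variable {k : Type*} [Field k] {t : k}

lemma legendre_nonsingular_iff [(legendre t).IsElliptic] {x y : k} :
    (legendre t).Nonsingular x y ↔ y ^ 2 = x * (x - 1) * (x - t) := by
  rw [← equation_iff_nonsingular, legendre_equation_iff]

lemma legendre_ne [(legendre t).IsElliptic] : t ≠ 0 ∧ t ≠ 1 := by
  constructor
  · rintro rfl
    have h : (legendre (0 : k)).Nonsingular 0 0 := legendre_nonsingular_iff.mpr (by ring)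
    rw [nonsingular_iff] at h
    simp [legendre] at h
  · rintro rfl
    have h : (legendre (1 : k)).Nonsingular 1 0 := legendre_nonsingular_iff.mpr (by ring)
    rw [nonsingular_iff] at h
    rcases h.2 with h | h <;> exact h (by simp [legendre]; try ring)

variable [(legendre t).IsElliptic] [DecidableEq k]

variable (t) in
/-- The point `(0, 0)` of order two. -/
def pt₀ : (legendre t).Point := .some 0 0 (legendre_nonsingular_iff.mpr (by ring))

variable (t) in
/-- The point `(1, 0)` of order two. -/
def pt₁ : (legendre t).Point := .some 1 0 (legendre_nonsingular_iff.mpr (by ring))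

lemma legendre_neg {x y : k} (h : (legendre t).Nonsingular x y) :
    ∃ h', -(Point.some x y h) = Point.some x (-y) h' := by
  have e : (legendre t).negY x y = -y := negY_of_short rfl rfl x y
  rw [Point.neg_some]
  simp only [e]
  exact ⟨e ▸ (nonsingular_neg ..).mpr h, trivial⟩

lemma two_smul_eq_zero_iff (h2 : (2 : k) ≠ 0) {x y : k} (h : (legendre t).Nonsingular x y) :
    2 • Point.some x y h = 0 ↔ y = 0 := by
  obtain ⟨h', e⟩ := legendre_neg h
  rw [two_smul, ← eq_neg_iff_add_eq_zero, e, Point.some.injEq]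
  constructor
  · rintro ⟨-, h⟩
    apply (mul_eq_zero_iff_left h2).mp
    linear_combination h
  · rintro rfl
    simp

lemma two_smul_pt₀ (h2 : (2 : k) ≠ 0) : 2 • pt₀ t = 0 := (two_smul_eq_zero_iff h2 _).mpr rfl

lemma two_smul_pt₁ (h2 : (2 : k) ≠ 0) : 2 • pt₁ t = 0 := (two_smul_eq_zero_iff h2 _).mpr rfl

/-- A parametrization of the doubling map by square roots of `x`, `x - 1` and `x - t`. -/
lemma two_smul_half (h2 : (2 : k) ≠ 0) {a b c : k} (hb : a ^ 2 - b ^ 2 = 1) (hc : a ^ 2 - c ^ 2 = t)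
    {x y : k} (hx : x = (a + b) * (a + c)) (hy : y = (a + b) * (b + c) * (c + a))
    (h : (legendre t).Nonsingular x y) :
    ∃ h', 2 • Point.some x y h = Point.some (a ^ 2) (a * b * c) h' := by
  have ht := legendre_ne (t := t)
  have hy0 : y ≠ 0 := by
    rw [hy]
    refine mul_ne_zero (mul_ne_zero (fun e ↦ ?_) fun e ↦ ?_) fun e ↦ ?_
    · exact one_ne_zero (α := k) (by linear_combination (a - b) * e - hb)
    · exact ht.2 (by linear_combination (b - c) * e - hc + hb)
    · exact ht.1 (by linear_combination (a - c) * e - hc)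
  refine double_of_slope (m := a + b + c) rfl rfl h (mul_ne_zero h2 hy0) ?_ ?_ ?_
  · simp only [legendre, hx, hy, ← hc]
    linear_combination (-(2 * (a + b) * (a + c)) + a ^ 2 - c ^ 2) * hb
  · simp only [legendre, hx]
    linear_combination hb + hc
  · rw [hx, hy]
    ring

lemma exists_half_of_sq (h2 : (2 : k) ≠ 0) {a b c : k} (hb : a ^ 2 - b ^ 2 = 1)
    (hc : a ^ 2 - c ^ 2 = t) : ∃ (h : (legendre t).Nonsingular
      ((a + b) * (a + c)) ((a + b) * (b + c) * (c + a))) (h' : _),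
      2 • Point.some _ _ h = Point.some (a ^ 2) (a * b * c) h' := by
  refine ⟨legendre_nonsingular_iff.mpr ?_, two_smul_half h2 hb hc rfl rfl _⟩
  have e1 : (a + b) * (a + c) - 1 = (a + b) * (b + c) := by linear_combination hb
  have e2 : (a + b) * (a + c) - t = (a + c) * (b + c) := by linear_combination hc
  rw [e1, e2]
  ring

lemma exists_half [IsAlgClosed k] (h2 : (2 : k) ≠ 0) (Q : (legendre t).Point) :
    ∃ P : (legendre t).Point, 2 • P = Q := by
  rcases Q with _ | ⟨x, y, h⟩
  · exact ⟨0, smul_zero 2⟩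
  obtain ⟨a, ha⟩ := IsAlgClosed.exists_pow_nat_eq x two_pos
  obtain ⟨b, hb⟩ := IsAlgClosed.exists_pow_nat_eq (x - 1) two_pos
  obtain ⟨c, hc⟩ := IsAlgClosed.exists_pow_nat_eq (x - t) two_pos
  have hxy := legendre_nonsingular_iff.mp h
  -- The product of the three square roots is `y` up to sign, and the sign is absorbed in `c`.
  obtain ⟨c, hc, hy⟩ : ∃ c, c ^ 2 = x - t ∧ a * b * c = y := by
    have : (a * b * c - y) * (a * b * c + y) = 0 := by
      linear_combination b ^ 2 * c ^ 2 * ha + x * c ^ 2 * hb + x * (x - 1) * hc - hxy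
    rcases mul_eq_zero.mp this with e | e
    · exact ⟨c, hc, sub_eq_zero.mp e⟩
    · exact ⟨-c, by rw [neg_sq, hc], by linear_combination -e⟩
  obtain ⟨h1, h3, e⟩ := exists_half_of_sq h2 (a := a) (b := b) (c := c) (t := t)
    (by linear_combination ha - hb) (by linear_combination ha - hc)
  refine ⟨_, e.trans ?_⟩
  simp only [ha, hy]

/-- An odd multiple of `(0, 0)` is `(0, 0)`; an even `n` is reduced to `n / 2` by halving a point.
-/
lemma exists_zsmul_ne_zero [IsAlgClosed k] (h2 : (2 : k) ≠ 0) (n : ℕ) (hn : n ≠ 0) :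
    ∃ P : (legendre t).Point, n • P ≠ 0 := by
  induction n using Nat.strong_induction_on with
  | _ n ih =>
    rcases Nat.even_or_odd' n with ⟨m, rfl | rfl⟩
    · obtain ⟨P, hP⟩ := ih m (by omega) (by omega)
      obtain ⟨Q, rfl⟩ := exists_half h2 P
      exact ⟨Q, by rwa [mul_comm, mul_smul]⟩
    · refine ⟨pt₀ t, ?_⟩
      rw [add_smul, mul_comm, mul_smul, two_smul_pt₀ h2, smul_zero, zero_add, one_smul]
      exact Point.some_ne_zero _

/-- The square root of `x(2P)` which is a rational function of `P`. -/
def da (P : (legendre t).Point) : k :=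
  (yc _ P / (xc _ P - t) + yc _ P / (xc _ P - 1) - yc _ P / xc _ P) / 2

/-- The square root of `x(2P) - 1` which is a rational function of `P`. -/
def db (P : (legendre t).Point) : k :=
  (yc _ P / xc _ P + yc _ P / (xc _ P - t) - yc _ P / (xc _ P - 1)) / 2

/-- The square root of `x(2P) - t` which is a rational function of `P`. -/
def dc (P : (legendre t).Point) : k :=
  (yc _ P / xc _ P + yc _ P / (xc _ P - 1) - yc _ P / (xc _ P - t)) / 2

omit [DecidableEq k] in
lemma xc_ne_of_yc_ne {P : (legendre t).Point} (hP : yc _ P ≠ 0) :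
    xc _ P ≠ 0 ∧ xc _ P - 1 ≠ 0 ∧ xc _ P - t ≠ 0 := by
  rcases P with _ | ⟨x, y, h⟩
  · exact absurd rfl hP
  have hxy := legendre_nonsingular_iff.mp h
  have h1 : x * (x - 1) * (x - t) ≠ 0 := hxy ▸ pow_ne_zero 2 hP
  exact ⟨left_ne_zero_of_mul (left_ne_zero_of_mul h1), right_ne_zero_of_mul (left_ne_zero_of_mul h1),
    right_ne_zero_of_mul h1⟩

/-- The pairwise sums are `y / (x - t)`, `y / (x - 1)` and `y / x`. Their products factor `x`, `x -
1` and `x - t`, which inverts the parametrization in `two_smul_half`. -/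
lemma dabc (h2 : (2 : k) ≠ 0) {P : (legendre t).Point} (hP : yc _ P ≠ 0) :
    da P ^ 2 - db P ^ 2 = 1 ∧ da P ^ 2 - dc P ^ 2 = t ∧ xc _ P = (da P + db P) * (da P + dc P) ∧
      yc _ P = (da P + db P) * (db P + dc P) * (dc P + da P) ∧ xc _ (2 • P) = da P ^ 2 ∧
      yc _ (2 • P) = da P * db P * dc P ∧ 2 • P ≠ 0 := by
  obtain ⟨h0, h1, ht⟩ := xc_ne_of_yc_ne hP
  have e1 : da P + db P = yc _ P / (xc _ P - t) := by rw [da, db]; field_simp; ring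
  have e2 : da P + dc P = yc _ P / (xc _ P - 1) := by rw [da, dc]; field_simp; ring
  have e3 : db P + dc P = yc _ P / xc _ P := by rw [db, dc]; field_simp; ring
  have hxy : yc _ P ^ 2 = xc _ P * (xc _ P - 1) * (xc _ P - t) := by
    rcases P with _ | ⟨x, y, h⟩
    · exact absurd rfl hP
    · exact legendre_nonsingular_iff.mp h
  have f1 : xc _ P = (da P + db P) * (da P + dc P) := by
    rw [e1, e2, div_mul_div_comm, ← sq, hxy]
    field_simp
  have f2 : xc _ P - 1 = (da P + db P) * (db P + dc P) := by
    rw [e1, e3, div_mul_div_comm, ← sq, hxy]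
    field_simp
  have f3 : xc _ P - t = (da P + dc P) * (db P + dc P) := by
    rw [e2, e3, div_mul_div_comm, ← sq, hxy]
    field_simp
  have f4 : yc _ P = (da P + db P) * (db P + dc P) * (dc P + da P) := by
    rw [add_comm (dc P), e1, e2, e3]
    field_simp
    exact (by linear_combination -hxy)
  have g1 : da P ^ 2 - db P ^ 2 = 1 := by linear_combination f2 - f1
  have g2 : da P ^ 2 - dc P ^ 2 = t := by linear_combination f3 - f1
  refine ⟨g1, g2, f1, f4, ?_⟩
  rcases P with _ | ⟨x, y, h⟩
  · exact absurd rfl hP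
  obtain ⟨h', e⟩ := two_smul_half h2 g1 g2 f1 f4 h
  change 2 • Point.some x y h = _ at e
  rw [e]
  exact ⟨rfl, rfl, Point.some_ne_zero _⟩

lemma add_pt₀ {P : (legendre t).Point} (hP : yc _ P ≠ 0) :
    xc _ (P + pt₀ t) = t / xc _ P ∧ yc _ (P + pt₀ t) = -t * yc _ P / xc _ P ^ 2 := by
  obtain ⟨h0, h1, ht⟩ := xc_ne_of_yc_ne hP
  rcases P with _ | ⟨x, y, h⟩
  · exact absurd rfl hP
  have hxy := legendre_nonsingular_iff.mp h
  change x ≠ 0 at h0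
  obtain ⟨h', e⟩ := add_of_slope (W := legendre t) rfl rfl h
    (legendre_nonsingular_iff.mpr (by ring) : (legendre t).Nonsingular 0 0) h0 (m := y / x)
    (x₃ := t / x) (y₃ := -t * y / x ^ 2) (by field_simp; ring)
    (by simp only [legendre]; field_simp; linear_combination -hxy) (by field_simp; ring)
  rw [pt₀, e]
  exact ⟨rfl, rfl⟩

lemma add_pt₁ {P : (legendre t).Point} (hP : yc _ P ≠ 0) :
    xc _ (P + pt₁ t) = (xc _ P - t) / (xc _ P - 1) ∧
      yc _ (P + pt₁ t) = (t - 1) * yc _ P / (xc _ P - 1) ^ 2 := by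
  obtain ⟨h0, h1, ht⟩ := xc_ne_of_yc_ne hP
  rcases P with _ | ⟨x, y, h⟩
  · exact absurd rfl hP
  have hxy := legendre_nonsingular_iff.mp h
  change x - 1 ≠ 0 at h1
  obtain ⟨h', e⟩ := add_of_slope (W := legendre t) rfl rfl h
    (legendre_nonsingular_iff.mpr (by ring) : (legendre t).Nonsingular 1 0) (sub_ne_zero.mp h1)
    (m := y / (x - 1)) (x₃ := (x - t) / (x - 1)) (y₃ := (t - 1) * y / (x - 1) ^ 2)
    (by field_simp; ring)
    (by simp only [legendre]; field_simp; linear_combination -hxy) (by field_simp; ring)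
  rw [pt₁, e]
  exact ⟨rfl, rfl⟩

/-- Translation by a 2-torsion point does not move `2P`, so only the signs of the square roots can
change. Here and in `dabc_add_pt₁` they change by different characters of the 2-torsion, which is
what separates the terms in `IsSpan.descent`. -/
lemma dabc_add_pt₀ {P : (legendre t).Point} (hP : yc _ P ≠ 0) :
    da (P + pt₀ t) = da P ∧ db (P + pt₀ t) = -db P ∧ dc (P + pt₀ t) = -dc P := by
  obtain ⟨h0, h1, ht⟩ := xc_ne_of_yc_ne hP
  obtain ⟨ex, ey⟩ := add_pt₀ hP
  have ht0 := (legendre_ne (t := t)).1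
  have i1 : -t * yc _ P / xc _ P ^ 2 / (t / xc _ P) = -(yc _ P / xc _ P) := by field_simp
  have i2 : -t * yc _ P / xc _ P ^ 2 / (t / xc _ P - t) =
      yc _ P / (xc _ P - 1) - yc _ P / xc _ P := by
    have : t / xc _ P - t ≠ 0 := by
      rw [show t / xc _ P - t = -(t * (xc _ P - 1)) / xc _ P by field_simp; ring]
      exact div_ne_zero (neg_ne_zero.mpr (mul_ne_zero ht0 h1)) h0
    rw [div_eq_iff this]
    field_simp
    ring
  have i3 : -t * yc _ P / xc _ P ^ 2 / (t / xc _ P - 1) =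
      yc _ P / (xc _ P - t) - yc _ P / xc _ P := by
    have : t / xc _ P - 1 ≠ 0 := by
      rw [show t / xc _ P - 1 = -(xc _ P - t) / xc _ P by field_simp; ring]
      exact div_ne_zero (neg_ne_zero.mpr ht) h0
    rw [div_eq_iff this]
    field_simp
    ring
  refine ⟨?_, ?_, ?_⟩ <;> simp only [da, db, dc, ex, ey, i1, i2, i3] <;> ring

lemma dabc_add_pt₁ {P : (legendre t).Point} (hP : yc _ P ≠ 0) :
    da (P + pt₁ t) = -da P ∧ db (P + pt₁ t) = db P ∧ dc (P + pt₁ t) = -dc P := by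
  obtain ⟨h0, h1, ht⟩ := xc_ne_of_yc_ne hP
  obtain ⟨ex, ey⟩ := add_pt₁ hP
  have ht0 := sub_ne_zero.mpr (legendre_ne (t := t)).2
  have i1 : (t - 1) * yc _ P / (xc _ P - 1) ^ 2 / ((xc _ P - t) / (xc _ P - 1)) =
      yc _ P / (xc _ P - t) - yc _ P / (xc _ P - 1) := by field_simp; ring
  have i2 : (t - 1) * yc _ P / (xc _ P - 1) ^ 2 / ((xc _ P - t) / (xc _ P - 1) - t) =
      yc _ P / xc _ P - yc _ P / (xc _ P - 1) := by
    have e : (xc _ P - t) / (xc _ P - 1) - t = -((t - 1) * xc _ P) / (xc _ P - 1) := by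
      field_simp; ring
    rw [e, div_eq_iff (div_ne_zero (neg_ne_zero.mpr (mul_ne_zero ht0 h0)) h1)]
    field_simp
    ring
  have i3 : (t - 1) * yc _ P / (xc _ P - 1) ^ 2 / ((xc _ P - t) / (xc _ P - 1) - 1) =
      -(yc _ P / (xc _ P - 1)) := by
    have e : (xc _ P - t) / (xc _ P - 1) - 1 = -(t - 1) / (xc _ P - 1) := by
      field_simp; ring
    rw [e, div_eq_iff (div_ne_zero (neg_ne_zero.mpr ht0) h1)]
    field_simp
  refine ⟨?_, ?_, ?_⟩ <;> simp only [da, db, dc, ex, ey, i1, i2, i3] <;> ring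

end Halving

/-! ### Descent of rational functions along doubling -/

section Descent

variable {k : Type*} [Field k] {t : k} [(legendre t).IsElliptic]

lemma eventually_yc_ne : ∀ᶠ P : (legendre t).Point in cofinite, yc _ P ≠ 0 := by
  filter_upwards [eventually_ne .zero, eventually_xc_ne 0, eventually_xc_ne 1,
    eventually_xc_ne t] with P hP h0 h1 ht
  rcases P with _ | ⟨x, y, h⟩
  · exact absurd rfl hP
  intro hy
  have hxy := legendre_nonsingular_iff.mp h
  change y = 0 at hy
  rw [hy] at hxy
  exact mul_ne_zero (mul_ne_zero h0 (sub_ne_zero.mpr h1)) (sub_ne_zero.mpr ht)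
    (hxy.symm.trans (by ring))

variable [DecidableEq k] [IsAlgClosed k]

lemma tendsto_two_smul (h2 : (2 : k) ≠ 0) :
    Tendsto (fun P : (legendre t).Point ↦ 2 • P) cofinite cofinite := by
  have hmem : (1 + 1 : AddMonoid.End (legendre t).Point) ∈ endRing (legendre t) :=
    add_mem (one_mem _) (one_mem _)
  have hP (P : (legendre t).Point) : (1 + 1 : AddMonoid.End (legendre t).Point) P = 2 • P :=
    (two_smul ℕ P).symm
  rcases hmem with h | h
  · obtain ⟨P, hP'⟩ := exists_zsmul_ne_zero (t := t) h2 2 two_ne_zero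
    rw [← hP, h] at hP'
    exact absurd rfl hP'
  · have := tendsto_of_isRational h
    exact this.congr hP

lemma tendsto_add_right (T : (legendre t).Point) :
    Tendsto (fun P : (legendre t).Point ↦ P + T) cofinite cofinite :=
  (add_left_injective T).tendsto_cofinite

/-- Functions on the curve in the span of `1`, `da`, `db`, `dc` over the rational functions
of `2P`. -/
def IsSpan (g : (legendre t).Point → k) : Prop :=
  ∃ c₀ c₁ c₂ c₃ : (legendre t).Point → k, IsRatFun _ c₀ ∧ IsRatFun _ c₁ ∧ IsRatFun _ c₂ ∧
    IsRatFun _ c₃ ∧ ∀ᶠ P in cofinite, g P = c₀ (2 • P) + c₁ (2 • P) * da P + c₂ (2 • P) * db P +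
      c₃ (2 • P) * dc P

omit [IsAlgClosed k] in
lemma IsSpan.congr {f g : (legendre t).Point → k} (hf : IsSpan f)
    (h : ∀ᶠ P in cofinite, f P = g P) : IsSpan g := by
  obtain ⟨c₀, c₁, c₂, c₃, h0, h1, h2, h3, e⟩ := hf
  exact ⟨c₀, c₁, c₂, c₃, h0, h1, h2, h3, by filter_upwards [e, h] with P e h; rw [← h, e]⟩

omit [IsAlgClosed k] in
lemma isSpan_comp {c : (legendre t).Point → k} (hc : IsRatFun _ c) :
    IsSpan (t := t) fun P ↦ c (2 • P) :=
  ⟨c, fun _ ↦ 0, fun _ ↦ 0, fun _ ↦ 0, hc, isRatFun_const 0, isRatFun_const 0, isRatFun_const 0,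
    .of_forall fun P ↦ by ring⟩

omit [IsAlgClosed k] in
lemma isSpan_da : IsSpan (t := t) da :=
  ⟨fun _ ↦ 0, fun _ ↦ 1, fun _ ↦ 0, fun _ ↦ 0, isRatFun_const 0, isRatFun_const 1,
    isRatFun_const 0, isRatFun_const 0, .of_forall fun P ↦ by ring⟩

omit [IsAlgClosed k] in
lemma isSpan_db : IsSpan (t := t) db :=
  ⟨fun _ ↦ 0, fun _ ↦ 0, fun _ ↦ 1, fun _ ↦ 0, isRatFun_const 0, isRatFun_const 0,
    isRatFun_const 1, isRatFun_const 0, .of_forall fun P ↦ by ring⟩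

omit [IsAlgClosed k] in
lemma isSpan_dc : IsSpan (t := t) dc :=
  ⟨fun _ ↦ 0, fun _ ↦ 0, fun _ ↦ 0, fun _ ↦ 1, isRatFun_const 0, isRatFun_const 0,
    isRatFun_const 0, isRatFun_const 1, .of_forall fun P ↦ by ring⟩

omit [IsAlgClosed k] in
lemma IsSpan.add {f g : (legendre t).Point → k} (hf : IsSpan f) (hg : IsSpan g) :
    IsSpan fun P ↦ f P + g P := by
  obtain ⟨c₀, c₁, c₂, c₃, h0, h1, h2, h3, e⟩ := hf
  obtain ⟨d₀, d₁, d₂, d₃, i0, i1, i2, i3, e'⟩ := hg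
  exact ⟨_, _, _, _, h0.add i0, h1.add i1, h2.add i2, h3.add i3, by
    filter_upwards [e, e'] with P e e'
    rw [e, e']
    ring⟩

/-- The squares of `da`, `db`, `dc` are functions of `2P`, and so is their product. Hence a product
of two of them is the third one times a function of `2P`, for instance `da db = dc · y(2P) / (x(2P)
- t)`. -/
lemma IsSpan.mul (h2 : (2 : k) ≠ 0) {f g : (legendre t).Point → k} (hf : IsSpan f)
    (hg : IsSpan g) : IsSpan fun P ↦ f P * g P := by
  obtain ⟨c₀, c₁, c₂, c₃, h0, h1, h2', h3, e⟩ := hf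
  obtain ⟨d₀, d₁, d₂, d₃, i0, i1, i2, i3, e'⟩ := hg
  have hX := isRatFun_xc (W := legendre t)
  have hY := isRatFun_yc (W := legendre t)
  have hX1 := hX.sub (isRatFun_const 1)
  have hXt := hX.sub (isRatFun_const t)
  refine ⟨_, _, _, _,
    (((h0.mul i0).add ((h1.mul i1).mul hX)).add ((h2'.mul i2).mul hX1)).add ((h3.mul i3).mul hXt),
    ((h0.mul i1).add (h1.mul i0)).add (((h2'.mul i3).add (h3.mul i2)).mul (hY.div hX)),
    ((h0.mul i2).add (h2'.mul i0)).add (((h1.mul i3).add (h3.mul i1)).mul (hY.div hX1)),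
    ((h0.mul i3).add (h3.mul i0)).add (((h1.mul i2).add (h2'.mul i1)).mul (hY.div hXt)), ?_⟩
  filter_upwards [e, e', eventually_yc_ne, (tendsto_two_smul h2).eventually eventually_yc_ne]
    with P e e' hP hP2
  obtain ⟨hb, hc, -, -, hx, hy, -⟩ := dabc h2 hP
  have hne : da P * db P * dc P ≠ 0 := hy ▸ hP2
  have ha0 : da P ≠ 0 := left_ne_zero_of_mul (left_ne_zero_of_mul hne)
  have hb0 : db P ≠ 0 := right_ne_zero_of_mul (left_ne_zero_of_mul hne)
  have hc0 : dc P ≠ 0 := right_ne_zero_of_mul hne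
  have e1 : da P ^ 2 - 1 = db P ^ 2 := by linear_combination hb
  have e2 : da P ^ 2 - t = dc P ^ 2 := by linear_combination hc
  simp only [e, e', hx, hy, e1, e2]
  field_simp
  ring

omit [IsAlgClosed k] in
lemma isSpan_const (c : k) : IsSpan (t := t) fun _ ↦ c := isSpan_comp (isRatFun_const c)

lemma isSpan_xc (h2 : (2 : k) ≠ 0) : IsSpan (t := t) (xc _) :=
  ((isSpan_da.add isSpan_db).mul h2 (isSpan_da.add isSpan_dc)).congr
    (eventually_yc_ne.mono fun _ h ↦ (dabc h2 h).2.2.1.symm)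

lemma isSpan_yc (h2 : (2 : k) ≠ 0) : IsSpan (t := t) (yc _) :=
  (((isSpan_da.add isSpan_db).mul h2 (isSpan_db.add isSpan_dc)).mul h2
    (isSpan_dc.add isSpan_da)).congr
    (eventually_yc_ne.mono fun _ h ↦ (dabc h2 h).2.2.2.1.symm)

lemma IsSpan.pow (h2 : (2 : k) ≠ 0) {f : (legendre t).Point → k} (hf : IsSpan f) (n : ℕ) :
    IsSpan fun P ↦ f P ^ n := by
  induction n with
  | zero => exact (isSpan_const 1).congr (.of_forall fun P ↦ by simp)
  | succ n ih => exact (ih.mul h2 hf).congr (.of_forall fun P ↦ by simp [pow_succ])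

lemma IsSpan.eval (h2 : (2 : k) ≠ 0) {f : (legendre t).Point → k} (hf : IsSpan f) (p : k[X]) :
    IsSpan fun P ↦ p.eval (f P) := by
  induction p using Polynomial.induction_on' with
  | add p q hp hq => exact (hp.add hq).congr (.of_forall fun P ↦ by simp)
  | monomial n a =>
    exact ((isSpan_const a).mul h2 (hf.pow h2 n)).congr (.of_forall fun P ↦ by simp)

lemma isSpan_evalEval (h2 : (2 : k) ≠ 0) (p : k[X][Y]) :
    IsSpan fun P : (legendre t).Point ↦ p.evalEval (xc _ P) (yc _ P) := by
  induction p using Polynomial.induction_on' with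
  | add p q hp hq => exact (hp.add hq).congr (.of_forall fun P ↦ by simp)
  | monomial n a =>
    exact (((isSpan_xc h2).eval h2 a).mul h2 ((isSpan_yc h2).pow h2 n)).congr
      (.of_forall fun P ↦ by
        simp only [Polynomial.evalEval, Polynomial.eval_monomial, Polynomial.eval_mul,
          Polynomial.eval_pow, Polynomial.eval_C])

lemma IsSpan.add_pt₀ (h2 : (2 : k) ≠ 0) {f : (legendre t).Point → k} (hf : IsSpan f) :
    IsSpan fun P ↦ f (P + pt₀ t) := by
  obtain ⟨c₀, c₁, c₂, c₃, h0, h1, h2', h3, e⟩ := hf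
  refine ⟨_, _, _, _, h0, h1, h2'.neg, h3.neg, ?_⟩
  filter_upwards [(tendsto_add_right (pt₀ t)).eventually e, eventually_yc_ne] with P e hP
  obtain ⟨ea, eb, ec⟩ := dabc_add_pt₀ hP
  rw [e, ea, eb, ec, smul_add, two_smul_pt₀ h2, add_zero]
  ring

lemma IsSpan.add_pt₁ (h2 : (2 : k) ≠ 0) {f : (legendre t).Point → k} (hf : IsSpan f) :
    IsSpan fun P ↦ f (P + pt₁ t) := by
  obtain ⟨c₀, c₁, c₂, c₃, h0, h1, h2', h3, e⟩ := hf
  refine ⟨_, _, _, _, h0, h1.neg, h2', h3.neg, ?_⟩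
  filter_upwards [(tendsto_add_right (pt₁ t)).eventually e, eventually_yc_ne] with P e hP
  obtain ⟨ea, eb, ec⟩ := dabc_add_pt₁ hP
  rw [e, ea, eb, ec, smul_add, two_smul_pt₁ h2, add_zero]
  ring

/-- A function in the span that is invariant under translation by the points of order two
is a rational function of `2P`. -/
lemma IsSpan.descent (h2 : (2 : k) ≠ 0) {f : (legendre t).Point → k} (hf : IsSpan f)
    (hf₀ : ∀ᶠ P in cofinite, f (P + pt₀ t) = f P) (hf₁ : ∀ᶠ P in cofinite, f (P + pt₁ t) = f P) :
    ∃ c, IsRatFun _ c ∧ ∀ᶠ P in cofinite, f P = c (2 • P) := by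
  obtain ⟨c₀, c₁, c₂, c₃, h0, h1, h2', h3, e⟩ := hf
  refine ⟨c₀, h0, ?_⟩
  have t0 := tendsto_add_right (pt₀ t)
  have t1 := tendsto_add_right (pt₁ t)
  filter_upwards [e, t0.eventually e, t1.eventually e, t0.eventually (t1.eventually e), hf₀, hf₁,
    t0.eventually hf₁, eventually_yc_ne, t0.eventually eventually_yc_ne]
    with P e e0 e1 e01 f0 f1 f01 hP hP0
  obtain ⟨ea, eb, ec⟩ := dabc_add_pt₀ hP
  obtain ⟨ea', eb', ec'⟩ := dabc_add_pt₁ hP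
  obtain ⟨ea'', eb'', ec''⟩ := dabc_add_pt₁ hP0
  have s0 : 2 • (P + pt₀ t) = 2 • P := by rw [smul_add, two_smul_pt₀ h2, add_zero]
  have s1 (Q : (legendre t).Point) : 2 • (Q + pt₁ t) = 2 • Q := by
    rw [smul_add, two_smul_pt₁ h2, add_zero]
  rw [f0, ea, eb, ec, s0] at e0
  rw [f1, ea', eb', ec', s1] at e1
  rw [f01, f0, ea'', eb'', ec'', ea, eb, ec, s1, s0] at e01
  -- Summing over the four translates cancels the three nontrivial characters and leaves four times
  -- the first term.
  apply mul_left_cancel₀ (mul_ne_zero h2 h2)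
  linear_combination e + e0 + e1 + e01

/-- Polynomials in the coordinates are in the span. To divide by `w`, multiply by its three
translates under the 2-torsion: the product of all four is invariant, hence a function of `2P`,
which may be inverted. -/
lemma isSpan_of_isRatFun (h2 : (2 : k) ≠ 0) {f : (legendre t).Point → k} (hf : IsRatFun _ f) :
    IsSpan f := by
  obtain ⟨u, w, e⟩ := hf
  have hu := isSpan_evalEval (t := t) h2 u
  have hw := isSpan_evalEval (t := t) h2 w
  set W : (legendre t).Point → k := fun P ↦ w.evalEval (xc _ P) (yc _ P) with hW
  have hW0 := hw.add_pt₀ h2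
  have hW1 := hw.add_pt₁ h2
  have hW01 := hW0.add_pt₁ h2
  have hc : ∃ c, IsRatFun _ c ∧ ∀ᶠ P in cofinite,
      W P * W (P + pt₀ t) * (W (P + pt₁ t) * W (P + pt₁ t + pt₀ t)) = c (2 • P) := by
    have s0 (P : (legendre t).Point) : P + pt₀ t + pt₀ t = P := by
      rw [add_assoc, ← two_smul ℕ, two_smul_pt₀ h2, add_zero]
    have s1 (P : (legendre t).Point) : P + pt₁ t + pt₁ t = P := by
      rw [add_assoc, ← two_smul ℕ, two_smul_pt₁ h2, add_zero]
    refine ((hw.mul h2 hW0).mul h2 (hW1.mul h2 hW01)).descent h2 (.of_forall fun P ↦ ?_)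
      (.of_forall fun P ↦ ?_)
    · simp only [s0]
      rw [add_right_comm P (pt₀ t) (pt₁ t), s0]
      ring
    · simp only [s1]
      ring
  obtain ⟨c, hcr, hc⟩ := hc
  refine ((hu.mul h2 (hW0.mul h2 (hW1.mul h2 hW01))).mul h2 (isSpan_comp hcr.inv)).congr ?_
  have e1 : ∀ᶠ P in cofinite, W P ≠ 0 := e.mono fun P h ↦ h.1
  have t0 := tendsto_add_right (pt₀ t)
  have t1 := tendsto_add_right (pt₁ t)
  filter_upwards [e, hc, t0.eventually e1, t1.eventually e1, t1.eventually (t0.eventually e1)]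
    with P e hc w0 w1 w01
  have w := e.1
  rw [e.2, ← hc]
  simp only [hW] at *
  field_simp

/-- A rational endomorphism that kills the points of order two is twice an endomorphism. -/
lemma exists_two_smul_eq (h2 : (2 : k) ≠ 0) {φ : AddMonoid.End (legendre t).Point}
    (hφ : φ ∈ endRing (legendre t)) (hker : ∀ T, 2 • T = 0 → φ T = 0) :
    ∃ β ∈ endRing (legendre t), β + β = φ := by
  rcases hφ with rfl | hφ
  · exact ⟨0, zero_mem _, add_zero 0⟩
  choose hf hhf using exists_half (t := t) h2
  -- Two halves of a point differ by 2-torsion, so `φ` of a half does not depend on the choice.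
  have hwell {P Q : (legendre t).Point} (h : 2 • P = 2 • Q) : φ P = φ Q := by
    rw [← sub_eq_zero, ← map_sub]
    exact hker _ (by rw [smul_sub, h, sub_self])
  let β : AddMonoid.End (legendre t).Point :=
    { toFun := fun Q ↦ φ (hf Q)
      map_zero' := hker _ (hhf 0)
      map_add' := fun P Q ↦ by
        rw [← map_add]
        exact hwell (by rw [hhf, smul_add, hhf, hhf]) }
  have hβ (P : (legendre t).Point) : β (2 • P) = φ P := hwell (hhf _)
  obtain ⟨hx, hy, h0⟩ := (isRational_iff _).mp hφ
  have hs0 := hker _ (two_smul_pt₀ (t := t) h2)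
  have hs1 := hker _ (two_smul_pt₁ (t := t) h2)
  have inv0 (P : (legendre t).Point) : φ (P + pt₀ t) = φ P := by rw [map_add, hs0, add_zero]
  have inv1 (P : (legendre t).Point) : φ (P + pt₁ t) = φ P := by rw [map_add, hs1, add_zero]
  obtain ⟨c, hc, ec⟩ := (isSpan_of_isRatFun h2 hx).descent h2
    (.of_forall fun P ↦ by rw [inv0]) (.of_forall fun P ↦ by rw [inv1])
  obtain ⟨d, hd, ed⟩ := (isSpan_of_isRatFun h2 hy).descent h2
    (.of_forall fun P ↦ by rw [inv0]) (.of_forall fun P ↦ by rw [inv1])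
  -- Doubling is onto, so the exceptional `Q` are among the doubles of finitely many exceptional
  -- `P`.
  have push {p : (legendre t).Point → Prop} (h : ∀ᶠ P in cofinite, p (2 • P)) :
      ∀ᶠ Q in cofinite, p Q := by
    rw [Filter.eventually_cofinite] at h ⊢
    refine (h.image fun P ↦ 2 • P).subset fun Q hQ ↦ ⟨hf Q, ?_, hhf Q⟩
    simpa [hhf] using hQ
  refine ⟨β, Or.inr ((isRational_iff _).mpr ⟨hc.congr (push ?_), hd.congr (push ?_), push ?_⟩), ?_⟩
  · filter_upwards [ec] with P h
    rw [hβ, h]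
  · filter_upwards [ed] with P h
    rw [hβ, h]
  · filter_upwards [h0] with P h
    rwa [hβ]
  · ext P : 1
    change β P + β P = φ P
    rw [← map_add, ← two_smul ℕ, hβ]

end Descent

/-! ### Multiplication by `n` on abscissae -/

section Ladder

variable {k : Type*} [Field k] {t : k}

/-- `X / Z` is the first coordinate of the point `P`, in homogeneous coordinates. -/
def IsXRep : (legendre t).Point → k → k → Prop
  | .zero, X, Z => Z = 0 ∧ X ≠ 0
  | .some x _ _, X, Z => Z ≠ 0 ∧ X = x * Z

lemma isXRep_zero_iff {X Z : k} : IsXRep (0 : (legendre t).Point) X Z ↔ Z = 0 ∧ X ≠ 0 := Iff.rfl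

lemma isXRep_some_iff {x y X Z : k} {h : (legendre t).Nonsingular x y} :
    IsXRep (.some x y h) X Z ↔ Z ≠ 0 ∧ X = x * Z := Iff.rfl

lemma IsXRep.of_mul {P : (legendre t).Point} {c X Z : k} (hc : c ≠ 0)
    (h : IsXRep P (c * X) (c * Z)) : IsXRep P X Z := by
  rcases P with _ | ⟨x, y, hxy⟩
  · exact ⟨(mul_eq_zero_iff_left hc).mp h.1, right_ne_zero_of_mul h.2⟩
  · refine ⟨right_ne_zero_of_mul h.1, mul_left_cancel₀ hc ?_⟩
    rw [h.2]
    ring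

variable [(legendre t).IsElliptic] [DecidableEq k]

lemma two_smul_some (h2 : (2 : k) ≠ 0) {x y : k} (h : (legendre t).Nonsingular x y) (hy : y ≠ 0) :
    ∃ x₂ y₂ h₂, 2 • Point.some x y h = Point.some x₂ y₂ h₂ ∧ x₂ * (4 * y ^ 2) = (x ^ 2 - t) ^ 2 := by
  have hxy := legendre_nonsingular_iff.mp h
  obtain ⟨m, hm⟩ : ∃ m, m * (2 * y) = 3 * x ^ 2 + 2 * (legendre t).a₂ * x + (legendre t).a₄ :=
    ⟨(3 * x ^ 2 + 2 * (legendre t).a₂ * x + (legendre t).a₄) / (2 * y), by field_simp⟩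
  obtain ⟨h', e⟩ := double_of_slope rfl rfl h (mul_ne_zero h2 hy) hm rfl rfl
  refine ⟨_, _, h', e, ?_⟩
  simp only [legendre] at hm ⊢
  linear_combination (m * (2 * y) + (3 * x ^ 2 + 2 * (-(1 + t)) * x + t)) * hm +
    4 * (1 + t - 2 * x) * hxy

/-- The denominator vanishes at the 2-torsion; there `x² - t` is nonzero because `t` is neither 0
nor 1, so the formula remains valid with value infinity. -/
lemma IsXRep.two_smul (h2 : (2 : k) ≠ 0) {P : (legendre t).Point} {X Z : k} (h : IsXRep P X Z) :
    IsXRep (2 • P) ((X ^ 2 - t * Z ^ 2) ^ 2) (4 * X * Z * (X - Z) * (X - t * Z)) := by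
  have ht := legendre_ne (t := t)
  rcases P with _ | ⟨x, y, hxy⟩
  · obtain ⟨rfl, hX⟩ := h
    rw [← Point.zero_def, smul_zero, isXRep_zero_iff]
    exact ⟨by ring, by simpa using hX⟩
  · obtain ⟨hZ, rfl⟩ := h
    have e := legendre_nonsingular_iff.mp hxy
    have e1 : (x * Z) ^ 2 - t * Z ^ 2 = (x ^ 2 - t) * Z ^ 2 := by ring
    have e2 : 4 * (x * Z) * Z * (x * Z - Z) * (x * Z - t * Z) = 4 * y ^ 2 * Z ^ 4 := by
      rw [e]; ring
    rw [e1, e2]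
    by_cases hy : y = 0
    · rw [(two_smul_eq_zero_iff h2 hxy).mpr hy, isXRep_zero_iff]
      refine ⟨by rw [hy]; ring, pow_ne_zero 2 (mul_ne_zero ?_ (pow_ne_zero 2 hZ))⟩
      rw [hy, zero_pow two_ne_zero, eq_comm, mul_eq_zero, mul_eq_zero] at e
      intro e'
      rcases e with (rfl | e) | e
      · exact ht.1 (by linear_combination -e')
      · exact ht.2 (by linear_combination (x + 1) * e - e')
      · have : t * (t - 1) = 0 := by linear_combination e' - (x + t) * e
        exact mul_ne_zero ht.1 (sub_ne_zero.mpr ht.2) this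
    · obtain ⟨x₂, y₂, h₂, e3, e4⟩ := two_smul_some h2 hxy hy
      rw [e3, isXRep_some_iff]
      refine ⟨mul_ne_zero (mul_ne_zero ?_ (pow_ne_zero 2 hy)) (pow_ne_zero 4 hZ), ?_⟩
      · rw [show (4 : k) = 2 * 2 by norm_num]; exact mul_ne_zero h2 h2
      · linear_combination -Z ^ 4 * e4

/-- Differential addition. -/
lemma IsXRep.add (h2 : (2 : k) ≠ 0) {A B : (legendre t).Point} {x y X₁ Z₁ X₂ Z₂ : k}
    {h : (legendre t).Nonsingular x y} (hx : x ≠ 0) (hD : A - B = .some x y h)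
    (hA : IsXRep A X₁ Z₁) (hB : IsXRep B X₂ Z₂) :
    IsXRep (A + B) ((X₁ * X₂ - t * (Z₁ * Z₂)) ^ 2) (x * (X₁ * Z₂ - X₂ * Z₁) ^ 2) := by
  rcases A with _ | ⟨x₁, y₁, h₁⟩
  · rw [← Point.zero_def] at hD hA ⊢
    obtain ⟨h', e⟩ := legendre_neg h
    have hB' : B = .some x (-y) h' := by rw [← e, ← hD]; simp
    rw [hB', isXRep_some_iff] at hB
    obtain ⟨rfl, hX₁⟩ := hA
    rw [zero_add, hB', isXRep_some_iff, hB.2]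
    refine ⟨mul_ne_zero hx (pow_ne_zero 2 ?_), by ring⟩
    rw [mul_zero, sub_zero]
    exact mul_ne_zero hX₁ hB.1
  rcases B with _ | ⟨x₂, y₂, h₂⟩
  · rw [← Point.zero_def, sub_zero] at hD
    rw [← Point.zero_def, add_zero, hD, isXRep_some_iff]
    rw [hD, isXRep_some_iff] at hA
    obtain ⟨rfl, hX₂⟩ := hB
    rw [hA.2]
    refine ⟨mul_ne_zero hx (pow_ne_zero 2 ?_), by ring⟩
    rw [mul_zero, zero_sub]
    exact neg_ne_zero.mpr (mul_ne_zero hX₂ hA.1)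
  obtain ⟨hZ₁, rfl⟩ := hA
  obtain ⟨hZ₂, rfl⟩ := hB
  have q₁ := legendre_nonsingular_iff.mp h₁
  have q₂ := legendre_nonsingular_iff.mp h₂
  obtain ⟨h₂', hneg⟩ := legendre_neg h₂
  by_cases hxx : x₁ = x₂
  -- `A = B` is excluded since `A - B` is not zero. If `A = -B`, then `A - B = 2A` has nonzero
  -- abscissa, which gives `x₁² ≠ t`.
  · rcases Point.X_eq_iff (h₁ := h₁) (h₂ := h₂) |>.mp hxx with e | e
    · rw [e, sub_self] at hD
      exact absurd hD.symm (Point.some_ne_zero _)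
    · have hB : Point.some x₂ y₂ h₂ = -Point.some x₁ y₁ h₁ := by rw [e, neg_neg]
      rw [hB, add_neg_cancel, isXRep_zero_iff]
      subst hxx
      refine ⟨by ring, pow_ne_zero 2 ?_⟩
      rw [hB, sub_neg_eq_add, ← _root_.two_smul ℕ] at hD
      have hy : y₁ ≠ 0 := by
        intro hy
        rw [(two_smul_eq_zero_iff h2 h₁).mpr hy] at hD
        exact Point.some_ne_zero _ hD.symm
      obtain ⟨x₃, y₃, h₃, e3, e4⟩ := two_smul_some h2 h₁ hy
      rw [hD, Point.some.injEq] at e3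
      rw [← e3.1] at e4
      have : x₁ * Z₁ * (x₁ * Z₂) - t * (Z₁ * Z₂) = (x₁ ^ 2 - t) * (Z₁ * Z₂) := by ring
      rw [this]
      refine mul_ne_zero (fun e5 ↦ ?_) (mul_ne_zero hZ₁ hZ₂)
      rw [e5, zero_pow two_ne_zero] at e4
      refine mul_ne_zero hx (mul_ne_zero ?_ (pow_ne_zero 2 hy)) e4
      rw [show (4 : k) = 2 * 2 by norm_num]; exact mul_ne_zero h2 h2
  · have hd := sub_ne_zero.mpr hxx
    obtain ⟨m, hm⟩ : ∃ m, y₁ - y₂ = m * (x₁ - x₂) := ⟨(y₁ - y₂) / (x₁ - x₂), by field_simp⟩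
    obtain ⟨m', hm'⟩ : ∃ m', y₁ - -y₂ = m' * (x₁ - x₂) :=
      ⟨(y₁ - -y₂) / (x₁ - x₂), by field_simp⟩
    obtain ⟨h₃, e₃⟩ := add_of_slope rfl rfl h₁ h₂ hxx hm rfl rfl
    obtain ⟨h₄, e₄⟩ := add_of_slope rfl rfl h₁ h₂' hxx hm' rfl rfl
    rw [sub_eq_add_neg, hneg, e₄, Point.some.injEq] at hD
    rw [e₃, isXRep_some_iff]
    have hx' := hD.1
    -- The product of the abscissae of `A + B` and `A - B` is `(x₁ x₂ - t)² / (x₁ - x₂)²`.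
    have key : (m ^ 2 - (legendre t).a₂ - x₁ - x₂) * x * (x₁ - x₂) ^ 2 = (x₁ * x₂ - t) ^ 2 := by
      apply mul_right_cancel₀ (pow_ne_zero 2 hd)
      rw [← hx']
      have e : (m ^ 2 - (legendre t).a₂ - x₁ - x₂) * (m' ^ 2 - (legendre t).a₂ - x₁ - x₂) *
          (x₁ - x₂) ^ 2 * (x₁ - x₂) ^ 2 = (y₁ ^ 2 + y₂ ^ 2 + (1 + t - x₁ - x₂) * (x₁ - x₂) ^ 2) ^ 2 -
            4 * y₁ ^ 2 * y₂ ^ 2 := by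
        have e1 : (m ^ 2 - (legendre t).a₂ - x₁ - x₂) * (x₁ - x₂) ^ 2 =
            (y₁ - y₂) ^ 2 + (1 + t - x₁ - x₂) * (x₁ - x₂) ^ 2 := by
          rw [hm, legendre]; ring
        have e2 : (m' ^ 2 - (legendre t).a₂ - x₁ - x₂) * (x₁ - x₂) ^ 2 =
            (y₁ - -y₂) ^ 2 + (1 + t - x₁ - x₂) * (x₁ - x₂) ^ 2 := by
          rw [hm', legendre]; ring
        have e3 : ∀ a b c : k, a * b * c * c = (a * c) * (b * c) := by intros; ring
        rw [e3, e1, e2]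
        ring
      rw [e, q₁, q₂]
      ring
    refine ⟨mul_ne_zero hx (pow_ne_zero 2 ?_), ?_⟩
    · rw [show x₁ * Z₁ * Z₂ - x₂ * Z₂ * Z₁ = (x₁ - x₂) * (Z₁ * Z₂) by ring]
      exact mul_ne_zero hd (mul_ne_zero hZ₁ hZ₂)
    · linear_combination -Z₁ ^ 2 * Z₂ ^ 2 * key

open Polynomial in
/-- The first coordinate of `n P` as a quotient of polynomials without common zeros. -/
lemma exists_isXRep_smul (h2 : (2 : k) ≠ 0) (n : ℕ) (hn : n ≠ 0) :
    ∃ X Z : k[X], X.natDegree ≤ 2 * n ^ 2 - 1 ∧ Z.natDegree ≤ 2 * n ^ 2 - 1 ∧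
      ∀ (x y : k) (h : (legendre t).Nonsingular x y),
        IsXRep (n • Point.some x y h) (X.eval x) (Z.eval x) := by
  induction n using Nat.strong_induction_on with
  | _ n ih =>
    by_cases hn1 : n = 1
    · subst hn1
      refine ⟨Polynomial.X, 1, by simp, by simp, fun x y h ↦ ?_⟩
      rw [one_smul, isXRep_some_iff]
      simp
    rcases Nat.even_or_odd' n with ⟨m, rfl | rfl⟩
    · obtain ⟨X, Z, hX, hZ, hXZ⟩ := ih m (by omega) (by omega)
      have hm : 1 ≤ m ^ 2 := Nat.one_le_pow _ _ (by omega)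
      have hb : 2 * (2 * m) ^ 2 = 8 * m ^ 2 := by ring
      rw [hb]
      generalize m ^ 2 = M at *
      refine ⟨(X ^ 2 - C t * Z ^ 2) ^ 2, C 4 * X * Z * (X - Z) * (X - C t * Z), ?_, ?_,
        fun x y h ↦ ?_⟩
      · have : (X ^ 2 - C t * Z ^ 2).natDegree ≤ 2 * (2 * M - 1) := by
          exact (natDegree_sub_le_of_le (natDegree_pow_le_of_le 2 hX)
            ((natDegree_C_mul_le _ _).trans (natDegree_pow_le_of_le 2 hZ))).trans_eq (max_self _)
        refine (natDegree_pow_le_of_le 2 this).trans (by omega)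
      · have i1 : (C 4 * X * Z).natDegree ≤ (2 * M - 1) + (2 * M - 1) :=
          natDegree_mul_le_of_le ((natDegree_C_mul_le _ _).trans hX) hZ
        have i2 : (X - Z).natDegree ≤ 2 * M - 1 :=
          (natDegree_sub_le_of_le hX hZ).trans_eq (max_self _)
        have i3 : (X - C t * Z).natDegree ≤ 2 * M - 1 :=
          (natDegree_sub_le_of_le hX ((natDegree_C_mul_le _ _).trans hZ)).trans_eq (max_self _)
        exact (natDegree_mul_le_of_le (natDegree_mul_le_of_le i1 i2) i3).trans (by omega)
      · rw [mul_smul]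
        simpa using (hXZ x y h).two_smul h2
    · obtain ⟨X₁, Z₁, hX₁, hZ₁, hXZ₁⟩ := ih (m + 1) (by omega) (by omega)
      obtain ⟨X₂, Z₂, hX₂, hZ₂, hXZ₂⟩ := ih m (by omega) (by omega)
      have hdeg₁ : 2 * (m + 1) ^ 2 - 1 = 2 * m ^ 2 + 4 * m + 1 := by
        rw [show 2 * (m + 1) ^ 2 = 2 * m ^ 2 + 4 * m + 1 + 1 by ring]; omega
      have hdeg : 2 * (2 * m + 1) ^ 2 - 1 = 8 * m ^ 2 + 8 * m + 1 := by
        rw [show 2 * (2 * m + 1) ^ 2 = 8 * m ^ 2 + 8 * m + 1 + 1 by ring]; omega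
      have hm : 1 ≤ m ^ 2 := Nat.one_le_pow _ _ (by omega)
      rw [hdeg]
      rw [hdeg₁] at hX₁ hZ₁
      -- One of `m`, `m + 1` is even, so at `(0, 0)` one multiple is zero and the other is `(0, 0)`
      -- itself.
      have hpt : X₁.eval 0 * X₂.eval 0 = 0 ∧ Z₁.eval 0 * Z₂.eval 0 = 0 ∧
          X₁.eval 0 * Z₂.eval 0 - X₂.eval 0 * Z₁.eval 0 ≠ 0 ∧ (2 * m + 1) • pt₀ t = pt₀ t := by
        have a1 := hXZ₁ 0 0 (legendre_nonsingular_iff.mpr (by ring))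
        have a2 := hXZ₂ 0 0 (legendre_nonsingular_iff.mpr (by ring))
        change IsXRep (_ • pt₀ t) _ _ at a1 a2
        have hodd (j : ℕ) : (2 * j + 1) • pt₀ t = pt₀ t := by
          rw [add_smul, mul_comm, mul_smul, two_smul_pt₀ h2, smul_zero, zero_add, one_smul]
        have heven (j : ℕ) : (2 * j) • pt₀ t = 0 := by
          rw [mul_comm, mul_smul, two_smul_pt₀ h2, smul_zero]
        suffices h : X₁.eval 0 * X₂.eval 0 = 0 ∧ Z₁.eval 0 * Z₂.eval 0 = 0 ∧
          X₁.eval 0 * Z₂.eval 0 - X₂.eval 0 * Z₁.eval 0 ≠ 0 from ⟨h.1, h.2.1, h.2.2, hodd m⟩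
        rcases Nat.even_or_odd' m with ⟨j, rfl | rfl⟩
        · rw [hodd, pt₀, isXRep_some_iff, zero_mul] at a1
          rw [heven, isXRep_zero_iff] at a2
          rw [a1.2, a2.1]
          refine ⟨zero_mul _, mul_zero _, ?_⟩
          rw [mul_zero, zero_sub]
          exact neg_ne_zero.mpr (mul_ne_zero a2.2 a1.1)
        · rw [show 2 * j + 1 + 1 = 2 * (j + 1) by ring, heven, isXRep_zero_iff] at a1
          rw [hodd, pt₀, isXRep_some_iff, zero_mul] at a2
          rw [a1.1, a2.2]
          refine ⟨mul_zero _, zero_mul _, ?_⟩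
          rw [zero_mul, sub_zero]
          exact mul_ne_zero a1.2 a2.1
      obtain ⟨p1, p2, p3, p4⟩ := hpt
      set N := X₁ * X₂ - C t * (Z₁ * Z₂) with hN
      have hNX : N = Polynomial.X * N.divX := by
        conv_lhs => rw [← X_mul_divX_add N]
        have : N.coeff 0 = 0 := by
          rw [coeff_zero_eq_eval_zero, hN]
          simp [p1, p2]
        rw [this, C_0, add_zero]
      -- Differential addition with `A - B = P` gives the pair `(N², x D²)`. Since `x` divides `N`,
      -- one factor `x` cancels, which keeps the pair free of common zeros at `x = 0`.
      refine ⟨Polynomial.X * N.divX ^ 2, (X₁ * Z₂ - X₂ * Z₁) ^ 2, ?_, ?_, fun x y h ↦ ?_⟩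
      · have i1 : N.natDegree ≤ (2 * m ^ 2 + 4 * m + 1) + (2 * m ^ 2 - 1) :=
          (natDegree_sub_le_of_le (natDegree_mul_le_of_le hX₁ hX₂)
            ((natDegree_C_mul_le _ _).trans (natDegree_mul_le_of_le hZ₁ hZ₂))).trans_eq (max_self _)
        have i2 : N.divX.natDegree ≤ (2 * m ^ 2 + 4 * m + 1) + (2 * m ^ 2 - 1) := by
          rw [natDegree_divX_eq_natDegree_tsub_one]; omega
        refine (natDegree_mul_le_of_le natDegree_X_le (natDegree_pow_le_of_le 2 i2)).trans ?_
        omega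
      · have i1 : (X₁ * Z₂ - X₂ * Z₁).natDegree ≤ (2 * m ^ 2 + 4 * m + 1) + (2 * m ^ 2 - 1) :=
          (natDegree_sub_le_of_le (natDegree_mul_le_of_le hX₁ hZ₂)
            ((natDegree_mul_le_of_le hX₂ hZ₁).trans_eq (add_comm _ _))).trans_eq (max_self _)
        exact (natDegree_pow_le_of_le 2 i1).trans (by omega)
      · by_cases hx : x = 0
        · subst hx
          have hy : y = 0 := by
            have := legendre_nonsingular_iff.mp h
            simpa using this
          subst hy
          change IsXRep ((2 * m + 1) • pt₀ t) _ _
          rw [p4, pt₀, isXRep_some_iff]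
          simpa using p3
        · have hsub : (m + 1) • Point.some x y h - m • Point.some x y h = Point.some x y h := by
            rw [add_smul, one_smul, add_sub_cancel_left]
          have hadd : (2 * m + 1) • Point.some x y h =
              (m + 1) • Point.some x y h + m • Point.some x y h := by
            rw [← add_smul]; congr 1; ring
          have := IsXRep.add h2 hx hsub (hXZ₁ x y h) (hXZ₂ x y h)
          rw [hadd]
          refine IsXRep.of_mul hx ?_
          have e : X₁.eval x * X₂.eval x - t * (Z₁.eval x * Z₂.eval x) =
              x * N.divX.eval x := by
            have : N.eval x = X₁.eval x * X₂.eval x - t * (Z₁.eval x * Z₂.eval x) := by simp [hN]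
            rw [← this]
            conv_lhs => rw [hNX]
            simp
          rw [e] at this
          convert this using 1
          · simp; ring
          · simp

end Ladder

/-! ### Injective polynomials in characteristic `p` -/

section InjectivePolynomial

open Polynomial

variable {k : Type*} [Field k] [IsAlgClosed k] (p : ℕ) [Fact p.Prime] [CharP k p]

/-- A polynomial that is injective as a function, over an algebraically closed field
of characteristic `p`. -/
lemma exists_eq_of_injective (g : k[X]) (hg : Function.Injective fun x ↦ g.eval x) :
    ∃ (a b : k) (m : ℕ), a ≠ 0 ∧ g = C a * X ^ p ^ m + C b := by
  have hinf : Infinite k := IsAlgClosed.instInfinite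
  induction hd : g.natDegree using Nat.strong_induction_on generalizing g with
  | _ d ih =>
    -- If the derivative vanishes, `g` is a polynomial in `X ^ p`, and the contracted polynomial is
    -- injective of smaller degree.
    by_cases hder : derivative g = 0
    · have hgc := expand_contract p hder (Fact.out : p.Prime).ne_zero
      have hpos : g.natDegree ≠ 0 := by
        intro h0
        rw [eq_C_of_natDegree_eq_zero h0] at hg
        exact zero_ne_one (hg (a₁ := (0 : k)) (a₂ := 1) (by simp))
      have hdeg : g.natDegree = (contract p g).natDegree * p := by
        conv_lhs => rw [← hgc, natDegree_expand]
      have h1p := (Fact.out : p.Prime).one_lt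
      have hlt : (contract p g).natDegree < d := by
        rw [← hd, hdeg]
        exact lt_mul_of_one_lt_right (Nat.pos_of_ne_zero (by rintro h; rw [h] at hdeg; omega)) h1p
      obtain ⟨a, b, m, ha, e⟩ := ih _ hlt (contract p g) (fun x y hxy ↦ by
        obtain ⟨x', rfl⟩ := IsAlgClosed.exists_pow_nat_eq x (Fact.out : p.Prime).pos
        obtain ⟨y', rfl⟩ := IsAlgClosed.exists_pow_nat_eq y (Fact.out : p.Prime).pos
        simp only [← expand_eval, hgc] at hxy
        rw [hg hxy]) rfl
      refine ⟨a, b, m + 1, ha, ?_⟩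
      rw [← hgc, e]
      simp only [map_add, map_mul, expand_C, map_pow, expand_X]
      rw [← pow_mul, pow_succ']
    -- By injectivity `r` is the only root of `g - g(r)`, which is therefore a multiple of a power
    -- of `X - r`. As `r` is a simple root, the exponent is one.
    · obtain ⟨r, hr⟩ : ∃ r, (derivative g).eval r ≠ 0 := by
        by_contra! h
        exact hder (Polynomial.funext fun x ↦ by simp [h x])
      set q := g - C (g.eval r) with hq
      have hq0 : q ≠ 0 := by
        intro h
        apply hder
        rw [sub_eq_zero.mp h, derivative_C]
      have hroots : q.roots = Multiset.replicate q.natDegree r := by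
        rw [Multiset.eq_replicate]
        refine ⟨(IsAlgClosed.splits q).natDegree_eq_card_roots.symm, fun x hx ↦ ?_⟩
        rw [mem_roots hq0, IsRoot, hq, eval_sub, eval_C, sub_eq_zero] at hx
        exact hg hx
      have hprod := (IsAlgClosed.splits q).eq_prod_roots
      rw [hroots, Multiset.map_replicate, Multiset.prod_replicate] at hprod
      have hder' : derivative g = derivative q := by rw [hq, derivative_sub, derivative_C, sub_zero]
      have h1 : q.natDegree = 1 := by
        have hz : q.natDegree ≠ 0 := by
          intro h
          rw [hder', eq_C_of_natDegree_eq_zero h, derivative_C, eval_zero] at hr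
          exact hr rfl
        by_contra h1
        apply hr
        rw [hder', hprod, derivative_C_mul, derivative_X_sub_C_pow, eval_mul, eval_mul, eval_pow,
          eval_sub, eval_X, eval_C, eval_C, eval_C, sub_self, zero_pow (by omega), mul_zero, mul_zero]
      rw [h1, pow_one] at hprod
      refine ⟨q.leadingCoeff, g.eval r - q.leadingCoeff * r, 0, leadingCoeff_ne_zero.mpr hq0, ?_⟩
      rw [pow_zero, pow_one, eq_add_of_sub_eq (hq.symm.trans hprod)]
      simp only [C_sub, C_mul, eval_add, eval_mul, eval_sub, eval_X, eval_C]
      ring_nf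

end InjectivePolynomial

/-! ### Multiplication by `p` on a supersingular curve -/

section Supersingular

open Polynomial

variable {k : Type*} [Field k] [IsAlgClosed k] [DecidableEq k] {t : k} [(legendre t).IsElliptic]

lemma exists_point (x : k) : ∃ y, (legendre t).Nonsingular x y := by
  obtain ⟨y, hy⟩ := IsAlgClosed.exists_pow_nat_eq (x * (x - 1) * (x - t)) two_pos
  exact ⟨y, legendre_nonsingular_iff.mpr hy⟩

/-- On a supersingular curve, the multiplication by `p` is given on the first coordinates
by a power of Frobenius. -/
lemma IsSupersingular.exists_smul_eq {p : ℕ} [Fact p.Prime] [CharP k p] (hp2 : Odd p)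
    (h2 : (2 : k) ≠ 0) (hss : IsSupersingular p (legendre t)) :
    ∃ m, m ≠ 0 ∧ m ≤ 2 ∧ t ^ p ^ m = t ∧ ∀ x y (h : (legendre t).Nonsingular x y),
      ∃ y' h', p • Point.some x y h = Point.some (x ^ p ^ m) y' h' := by
  have hpp : p.Prime := Fact.out
  obtain ⟨X, Z, hX, -, hXZ⟩ := exists_isXRep_smul (t := t) h2 p hpp.ne_zero
  have hZ (x : k) : Z.eval x ≠ 0 := by
    intro hx
    obtain ⟨y, h⟩ := exists_point (t := t) x
    have := hXZ x y h
    rcases hP : p • Point.some x y h with _ | ⟨x', y', h'⟩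
    · exact Point.some_ne_zero _ (hss _ hP)
    · rw [hP, isXRep_some_iff] at this
      exact this.1 hx
  have hZ0 : Z.degree = 0 := by
    by_contra h0
    obtain ⟨x, hx⟩ := IsAlgClosed.exists_root Z h0
    exact hZ x hx
  obtain ⟨c, hc⟩ : ∃ c, Z = C c := ⟨_, eq_C_of_degree_eq_zero hZ0⟩
  have hc0 : c ≠ 0 := by
    have := hZ 0
    rwa [hc, eval_C] at this
  set g := C c⁻¹ * X with hg
  have hgP (x y : k) (h : (legendre t).Nonsingular x y) :
      ∃ y' h', p • Point.some x y h = Point.some (g.eval x) y' h' := by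
    have := hXZ x y h
    rcases hP : p • Point.some x y h with _ | ⟨x', y', h'⟩
    · exact absurd (hss _ hP) (Point.some_ne_zero _)
    · rw [hP, isXRep_some_iff, hc, eval_C] at this
      have e : g.eval x = x' := by
        rw [hg, eval_mul, eval_C, this.2]
        field_simp
      rw [e]
      exact ⟨y', h', rfl⟩
  -- Abscissae determine points up to sign, and multiplication by `p` is injective.
  have hinj : Function.Injective fun x ↦ g.eval x := by
    intro x₁ x₂ hx
    obtain ⟨y₁, h₁⟩ := exists_point (t := t) x₁
    obtain ⟨y₂, h₂⟩ := exists_point (t := t) x₂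
    obtain ⟨z₁, i₁, e₁⟩ := hgP _ _ h₁
    obtain ⟨z₂, i₂, e₂⟩ := hgP _ _ h₂
    apply (Point.X_eq_iff (h₁ := h₁) (h₂ := h₂)).mpr
    rcases (Point.X_eq_iff (h₁ := i₁) (h₂ := i₂)).mp hx with e | e
    · left
      rw [← sub_eq_zero]
      apply hss
      rw [smul_sub, e₁, e₂, e, sub_self]
    · right
      rw [← sub_eq_zero]
      apply hss
      rw [smul_sub, smul_neg, e₁, e₂, e, sub_self]
  obtain ⟨a, b, m, ha, hgm⟩ := exists_eq_of_injective p g hinj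
  -- As `p` is odd it fixes the 2-torsion, so `g` fixes 0, 1 and `t`. The first two values normalize
  -- `g`, the third gives `t ^ p ^ m = t`.
  have htor (x : k) (h : (legendre t).Nonsingular x 0) : g.eval x = x := by
    obtain ⟨y', h', e⟩ := hgP _ _ h
    obtain ⟨j, hj⟩ := hp2
    have : p • Point.some x 0 h = Point.some x 0 h := by
      rw [hj, add_smul, mul_comm, mul_smul, (two_smul_eq_zero_iff h2 h).mpr rfl, smul_zero,
        zero_add, one_smul]
    rw [this, Point.some.injEq] at e
    exact e.1.symm
  have hpm : p ^ m ≠ 0 := pow_ne_zero _ hpp.ne_zero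
  have g0 := htor 0 (legendre_nonsingular_iff.mpr (by ring))
  have g1 := htor 1 (legendre_nonsingular_iff.mpr (by ring))
  have gt := htor t (legendre_nonsingular_iff.mpr (by ring))
  have hge (x : k) : g.eval x = a * x ^ p ^ m + b := by rw [hgm]; simp
  rw [hge, zero_pow hpm, mul_zero, zero_add] at g0
  rw [hge, one_pow, mul_one, g0, add_zero] at g1
  have hge' (x : k) : g.eval x = x ^ p ^ m := by rw [hge, g0, g1, one_mul, add_zero]
  refine ⟨m, ?_, ?_, by rw [← hge', gt], fun x y h ↦ by rw [← hge']; exact hgP x y h⟩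
  -- For `m = 0` one has `pP = ±P` for every `P`, so `(p - 1)(p + 1)` would kill the curve.
  · rintro rfl
    have hn : (p - 1) * (p + 1) ≠ 0 := mul_ne_zero (by have := hpp.one_lt; omega) (by omega)
    obtain ⟨P, hP⟩ := exists_zsmul_ne_zero (t := t) h2 _ hn
    apply hP
    rcases P with _ | ⟨x, y, h⟩
    · exact smul_zero _
    · obtain ⟨y', h', e⟩ := hgP x y h
      have hx : g.eval x = x := by rw [hge', pow_zero, pow_one]
      rcases (Point.X_eq_iff (h₁ := h') (h₂ := h)).mp hx with e' | e'
      · have : (p - 1) • Point.some x y h + Point.some x y h = Point.some x y h := by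
          rw [← succ_nsmul, Nat.sub_add_cancel hpp.one_lt.le, e, e']
        rw [mul_comm, mul_smul, add_eq_right.mp this, smul_zero]
      · rw [mul_smul, add_smul, e, e', one_smul, neg_add_cancel, smul_zero]
  -- The bound `2 p² - 1` is not sharp, but it is below `p³`.
  · have hd : g.natDegree = p ^ m := by
      rw [hgm, natDegree_add_C, natDegree_C_mul_X_pow _ _ ha]
    have hd' : g.natDegree ≤ 2 * p ^ 2 - 1 := (natDegree_C_mul_le _ _).trans hX
    have h3 : p ^ m < p ^ 3 := by
      rw [← hd]
      refine hd'.trans_lt ?_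
      have h2p := hpp.two_le
      have : 2 * p ^ 2 ≤ p ^ 3 := by rw [pow_succ' p 2]; exact Nat.mul_le_mul_right _ h2p
      have := Nat.pos_of_ne_zero (pow_ne_zero 2 hpp.ne_zero)
      omega
    have := (Nat.pow_lt_pow_iff_right hpp.one_lt).mp h3
    omega

end Supersingular

/-! ### Frobenius on points, and its square -/

section Frobenius

variable {F K : Type*} [Field F] [Field K] [DecidableEq F] [DecidableEq K]

/-- The homomorphism on points induced by a homomorphism of fields. -/
def mapPoint (W : WeierstrassCurve.Affine F) (σ : F →+* K) : W.Point →+ (W.map σ).toAffine.Point where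
  toFun
    | .zero => .zero
    | .some _ _ h => .some _ _ ((W.map_nonsingular σ.injective ..).mpr h)
  map_zero' := rfl
  map_add' := by
    rintro (_ | ⟨x₁, y₁, h₁⟩) (_ | ⟨x₂, y₂, h₂⟩)
    any_goals rfl
    by_cases hxy : x₁ = x₂ ∧ y₁ = W.negY x₂ y₂
    · rw [Point.add_of_Y_eq hxy.left hxy.right]
      exact (Point.add_of_Y_eq (congr_arg _ hxy.left) (by rw [hxy.right, map_negY])).symm
    · rw [Point.add_some hxy]
      have := Point.add_some (W := (W.map σ).toAffine)
        (fun h ↦ hxy ⟨σ.injective h.1, σ.injective (by rw [h.2, map_negY])⟩)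
        (h₁ := (W.map_nonsingular σ.injective ..).mpr h₁)
        (h₂ := (W.map_nonsingular σ.injective ..).mpr h₂)
      simp only [map_slope, map_addX, map_addY] at this
      exact this.symm

lemma legendre_map (σ : F →+* K) (t : F) : (legendre t).map σ = legendre (σ t) := by
  simp [legendre, WeierstrassCurve.map]

/-- The homomorphism on points of Legendre curves induced by a homomorphism of fields. -/
def mapLegendre (σ : F →+* K) {t : F} {t' : K} (ht : σ t = t') :
    (legendre t).Point →+ (legendre t').Point :=
  (show (legendre t).map σ = legendre t' by rw [legendre_map, ht]) ▸ mapPoint (legendre t) σ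

lemma mapLegendre_some (σ : F →+* K) {t : F} {t' : K} (ht : σ t = t') {x y : F}
    (h : (legendre t).Nonsingular x y) :
    ∃ h', mapLegendre σ ht (.some x y h) = .some (σ x) (σ y) h' := by
  have key : ∀ (W : WeierstrassCurve.Affine K) (hW : (legendre t).map σ = W), ∃ h',
      (hW ▸ mapPoint (legendre t) σ : (legendre t).Point →+ W.Point) (.some x y h) =
        .some (σ x) (σ y) h' := by
    rintro W rfl
    exact ⟨_, rfl⟩
  exact key _ _

lemma mapLegendre_injective (σ : F →+* K) {t : F} {t' : K} (ht : σ t = t') :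
    Function.Injective (mapLegendre σ ht) := by
  rw [injective_iff_map_eq_zero]
  rintro (_ | ⟨x, y, h⟩) hP
  · rfl
  · obtain ⟨h', e⟩ := mapLegendre_some σ ht h
    exact absurd (e.symm.trans hP) (Point.some_ne_zero _)

/-- Two homomorphisms that agree up to sign at each point agree up to a global sign. -/
lemma eq_or_eq_neg_of_forall {G H : Type*} [AddCommGroup G] [AddCommGroup H] (f g : G →+ H)
    (h : ∀ P, f P = g P ∨ f P = -g P) : (∀ P, f P = g P) ∨ ∀ P, f P = -g P := by
  by_contra! hcon
  obtain ⟨⟨P, hP⟩, Q, hQ⟩ := hcon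
  have hP' := (h P).resolve_left hP
  have hQ' := (h Q).resolve_right hQ
  rcases h (P + Q) with e | e
  · rw [map_add, map_add, hQ'] at e
    exact hP (add_right_cancel e)
  · rw [map_add, map_add, hP', neg_add] at e
    exact hQ (add_left_cancel e)

/-- On a supersingular Legendre curve that is not defined over `𝔽_p` and has a point of
order four over `𝔽_{p²}`, the square of Frobenius is multiplication by `p`. -/
lemma IsSupersingular.smul_eq_frobenius_sq {k : Type*} [Field k] [IsAlgClosed k] [DecidableEq k]
    {t : k} [(legendre t).IsElliptic] {p : ℕ} [Fact p.Prime] [CharP k p] (hp : p % 4 = 1)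
    (h2 : (2 : k) ≠ 0) (hss : IsSupersingular p (legendre t)) (ht : t ^ p ≠ t) {v : k}
    (hv : v ^ 2 = 1 - t) (hvp : v ^ p ^ 2 = v) :
    t ^ p ^ 2 = t ∧ ∀ x y (h : (legendre t).Nonsingular x y), ∃ h',
      p • Point.some x y h = Point.some (x ^ p ^ 2) (y ^ p ^ 2) h' := by
  obtain ⟨m, hm0, hm2, htm, hm⟩ := hss.exists_smul_eq (by rw [Nat.odd_iff]; omega) h2
  obtain rfl : m = 2 := by
    interval_cases m
    · exact absurd rfl hm0
    · exact absurd (by simpa using htm) ht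
    · rfl
  refine ⟨htm, ?_⟩
  have hσ (x : k) : iterateFrobenius k p 2 x = x ^ p ^ 2 := iterateFrobenius_def p 2 x
  have hst : iterateFrobenius k p 2 t = t := by rw [hσ, htm]
  set Φ := mapLegendre (iterateFrobenius k p 2) hst with hΦ
  have hΦs {x y : k} (h : (legendre t).Nonsingular x y) :
      ∃ h', Φ (.some x y h) = .some (x ^ p ^ 2) (y ^ p ^ 2) h' := by
    obtain ⟨h', e⟩ := mapLegendre_some (iterateFrobenius k p 2) hst h
    simp only [hσ] at e
    exact ⟨_, e⟩
  have hpm : ∀ P, (p • AddMonoidHom.id (legendre t).Point) P = Φ P ∨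
      (p • AddMonoidHom.id (legendre t).Point) P = -Φ P := by
    rintro (_ | ⟨x, y, h⟩)
    · left
      rw [← Point.zero_def, map_zero, map_zero]
    · obtain ⟨h', e⟩ := hΦs h
      obtain ⟨y'', h'', e'⟩ := hm x y h
      rw [AddMonoidHom.nsmul_apply, AddMonoidHom.id_apply, e', e]
      exact Point.X_eq_iff.mp rfl
  rcases eq_or_eq_neg_of_forall _ _ hpm with H | H
  · intro x y h
    obtain ⟨h', e⟩ := hΦs h
    exact ⟨h', (H _).trans e⟩
  · exfalso
    -- The half `(1 + v, v (1 + v))` of `(1, 0)` has order four. It is fixed by `p ≡ 1 (mod 4)` and,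
    -- as `v ∈ 𝔽_{p²}`, by `Φ`; the minus sign would make it 2-torsion.
    obtain ⟨h1, h3, e⟩ := exists_half_of_sq h2 (a := 1) (b := 0) (c := v) (t := t)
      (by ring) (by rw [hv]; ring)
    set P := Point.some _ _ h1 with hP
    have e0 : 2 • P ≠ 0 := by rw [e]; exact Point.some_ne_zero _
    have e4 : 4 • P = 0 := by
      rw [show 4 = 2 * 2 from rfl, mul_smul, e]
      exact (two_smul_eq_zero_iff h2 _).mpr (by ring)
    have ep : p • P = P := by
      rw [← Nat.div_add_mod p 4, hp, add_smul, mul_comm, mul_smul, e4, smul_zero, zero_add,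
        one_smul]
    have eΦ : Φ P = P := by
      obtain ⟨h', e'⟩ := hΦs h1
      rw [hP, e', Point.some.injEq]
      have hp0 : p ^ 2 ≠ 0 := pow_ne_zero 2 (Fact.out : p.Prime).ne_zero
      have a1 : (1 + v) ^ p ^ 2 = 1 + v := by rw [add_pow_char_pow, one_pow, hvp]
      constructor
      · rw [add_zero, one_mul, a1]
      · rw [add_zero, one_mul, zero_add, mul_pow, hvp, add_comm v, a1]
    have := H P
    rw [AddMonoidHom.nsmul_apply, AddMonoidHom.id_apply, ep, eΦ, eq_neg_iff_add_eq_zero,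
      ← two_smul ℕ] at this
    exact e0 this

end Frobenius

/-! ### Point counts, the Hasse invariant, and curves over `𝔽_p` -/

section Counting

open Polynomial

lemma legendre_isElliptic {k : Type*} [Field k] {t : k} (h2 : (2 : k) ≠ 0) (h0 : t ≠ 0)
    (h1 : t ≠ 1) : (legendre t).IsElliptic := by
  rw [isElliptic_iff]
  have : (legendre t).Δ = 2 ^ 4 * (t ^ 2 * (t - 1) ^ 2) := by
    simp only [Δ, b₂, b₄, b₆, b₈, legendre]; ring
  rw [this, isUnit_iff_ne_zero]
  exact mul_ne_zero (pow_ne_zero 4 h2)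
    (mul_ne_zero (pow_ne_zero 2 h0) (pow_ne_zero 2 (sub_ne_zero.mpr h1)))

/-- The class of `T` still has order two in the quotient by the subgroup generated by `S`. -/
lemma four_dvd_card {G : Type*} [AddCommGroup G] {S T : G} (hS : S ≠ 0) (hT : T ≠ 0)
    (hST : T ≠ S) (hS2 : 2 • S = 0) (hT2 : 2 • T = 0) : 4 ∣ Nat.card G := by
  have hcard : Nat.card (AddSubgroup.zmultiples S) = 2 := by
    rw [Nat.card_zmultiples]
    exact addOrderOf_eq_prime hS2 hS
  have hmem : T ∉ AddSubgroup.zmultiples S := by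
    rintro ⟨n, hn⟩
    simp only at hn
    rcases Int.even_or_odd' n with ⟨m, rfl | rfl⟩
    · rw [mul_comm, mul_smul, ofNat_zsmul, hS2, smul_zero] at hn
      exact hT hn.symm
    · rw [add_smul, mul_comm, mul_smul, ofNat_zsmul, hS2, smul_zero, zero_add, one_smul] at hn
      exact hST hn.symm
  have horder : addOrderOf (QuotientAddGroup.mk T : G ⧸ AddSubgroup.zmultiples S) = 2 := by
    refine addOrderOf_eq_prime ?_ (by rwa [Ne, QuotientAddGroup.eq_zero_iff])
    rw [← QuotientAddGroup.mk_nsmul, hT2, QuotientAddGroup.mk_zero]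
  rw [AddSubgroup.card_eq_card_quotient_mul_card_addSubgroup (AddSubgroup.zmultiples S), hcard]
  have : 2 ∣ Nat.card (G ⧸ AddSubgroup.zmultiples S) := horder ▸ addOrderOf_dvd_natCard _
  obtain ⟨c, hc⟩ := this
  exact ⟨c, by rw [hc]; ring⟩

section FiniteField

variable {K : Type*} [Field K] [Fintype K]

lemma sum_pow_eq_zero_of_lt {i : ℕ} (hi : i < 2 * (Fintype.card K - 1))
    (hne : i ≠ Fintype.card K - 1) : ∑ x : K, x ^ i = 0 := by
  classical
  by_cases hlt : i < Fintype.card K - 1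
  · exact FiniteField.sum_pow_lt_card_sub_one K i hlt
  · have h0 : i ≠ 0 := by
      rintro rfl
      have := Fintype.one_lt_card (α := K)
      omega
    rw [← FiniteField.sum_pow_lt_card_sub_one K (i - (Fintype.card K - 1)) (by omega)]
    refine Finset.sum_congr rfl fun x _ ↦ ?_
    by_cases hx : x = 0
    · rw [hx, zero_pow h0, zero_pow (by omega)]
    · conv_lhs => rw [← Nat.sub_add_cancel (not_lt.mp hlt), pow_add,
        FiniteField.pow_card_sub_one_eq_one x hx, mul_one]

lemma sum_pow_card_sub_one : ∑ x : K, x ^ (Fintype.card K - 1) = -1 := by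
  classical
  have h1 := Fintype.one_lt_card (α := K)
  have : ∀ x : K, x ^ (Fintype.card K - 1) = 1 - if x = 0 then 1 else 0 := by
    intro x
    split_ifs with hx
    · rw [hx, zero_pow (by omega), sub_self]
    · rw [FiniteField.pow_card_sub_one_eq_one x hx, sub_zero]
  simp [this]

/-- A power sum over the field vanishes unless the exponent is a positive multiple of `q - 1`, and
the degree bound leaves only `q - 1` itself. -/
lemma sum_eval_eq_neg_coeff (g : K[X]) (hg : g.natDegree < 2 * (Fintype.card K - 1)) :
    ∑ x : K, g.eval x = -g.coeff (Fintype.card K - 1) := by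
  simp_rw [eval_eq_sum_range' hg]
  rw [Finset.sum_comm]
  simp_rw [← Finset.mul_sum]
  have h1 := Fintype.one_lt_card (α := K)
  rw [Finset.sum_eq_single (Fintype.card K - 1)]
  · rw [sum_pow_card_sub_one, mul_neg_one]
  · intro i hi hne
    rw [sum_pow_eq_zero_of_lt (Finset.mem_range.mp hi) hne, mul_zero]
  · intro h
    exact absurd (Finset.mem_range.mpr (by omega)) h

variable [DecidableEq K]

/-- The number of points of a Legendre curve over a finite field. -/
lemma card_legendre (hK : ringChar K ≠ 2) (t : K) [(legendre t).IsElliptic] :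
    (Nat.card (legendre t).Point : ℤ) =
      1 + ∑ x : K, (quadraticChar K (x * (x - 1) * (x - t)) + 1) := by
  have e1 : (legendre t).Point ≃ Option ((x : K) × {y : K // y ^ 2 = x * (x - 1) * (x - t)}) := by
    refine ((legendre t).pointEquiv.trans (Equiv.optionCongr ?_))
    refine (Equiv.subtypeEquivRight
      (q := fun xy : K × K ↦ xy.2 ^ 2 = xy.1 * (xy.1 - 1) * (xy.1 - t))
      fun xy ↦ legendre_equation_iff t xy.1 xy.2).trans ?_
    exact (Equiv.subtypeProdEquivSigmaSubtype fun x y : K ↦ y ^ 2 = x * (x - 1) * (x - t))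
  rw [Nat.card_congr e1, Nat.card_eq_fintype_card, Fintype.card_option, Fintype.card_sigma]
  push_cast
  rw [add_comm]
  congr 1
  refine Finset.sum_congr rfl fun x _ ↦ ?_
  rw [← quadraticChar_card_sqrts hK, Fintype.card_subtype]
  congr 2
  ext y
  simp

end FiniteField

variable {p : ℕ} [Fact p.Prime]

/-- The right hand side of the Legendre equation. -/
noncomputable def legendreCubic {R : Type*} [CommRing R] (t : R) : R[X] := X * (X - 1) * (X - C t)

lemma natDegree_legendreCubic_pow_le {R : Type*} [CommRing R] (t : R) (n : ℕ) :
    (legendreCubic t ^ n).natDegree ≤ 3 * n := by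
  have h : (legendreCubic t).natDegree ≤ 3 := by
    rw [legendreCubic]
    compute_degree
  calc _ ≤ n * 3 := natDegree_pow_le_of_le n h
    _ = 3 * n := mul_comm _ _

/-- The coefficient which defines the Hasse invariant, for all powers of `p`. -/
lemma coeff_legendreCubic_pow (hp : Odd p) (t : ZMod p) (n : ℕ) :
    (legendreCubic t ^ (p ^ n / 2)).coeff (p ^ n - 1) =
      ((legendreCubic t ^ (p / 2)).coeff (p - 1)) ^ n := by
  induction n with
  | zero => simp
  | succ n ih =>
    -- With this split the power becomes `f ^ (p / 2)` times `f ^ (p ^ n / 2)` evaluated at `X ^ p`,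
    -- because the coefficients lie in `𝔽_p`.
    have h1 : p ^ (n + 1) / 2 = p / 2 + p ^ n / 2 * p := by
      have hn : Odd (p ^ n) := hp.pow
      obtain ⟨a, ha⟩ := hp
      obtain ⟨b, hb⟩ := hn
      rw [pow_succ, hb, ha, show (2 * b + 1) * (2 * a + 1) = 2 * (b * (2 * a + 1) + a) + 1 by ring]
      have : (2 * a + 1) / 2 = a := by omega
      have h' : (2 * b + 1) / 2 = b := by omega
      rw [this, h']
      omega
    have hpos : 0 < p := (Fact.out : p.Prime).pos
    have hposn : 0 < p ^ n := pow_pos hpos n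
    have h2 : p ^ (n + 1) - 1 = (p - 1) + p * (p ^ n - 1) := by
      rw [pow_succ', Nat.mul_sub]
      have : p * 1 ≤ p * p ^ n := Nat.mul_le_mul_left p hposn
      omega
    rw [h1, pow_add, pow_mul, ← ZMod.expand_card, coeff_mul,
      Finset.sum_eq_single (p - 1, p * (p ^ n - 1)), coeff_expand_mul' hpos, ih, pow_succ']
    -- Only `j = p c` matters. Any such `c` other than `p ^ n - 1` is smaller, so `i ≥ 2p - 1`,
    -- beyond the degree `3 (p - 1) / 2` of the first factor.
    · rintro ⟨i, j⟩ hij hne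
      rw [Finset.HasAntidiagonal.mem_antidiagonal] at hij
      simp only at hij ⊢
      rw [coeff_expand hpos]
      split_ifs with hj
      · obtain ⟨c, rfl⟩ := hj
        rw [coeff_eq_zero_of_natDegree_lt, zero_mul]
        refine (natDegree_legendreCubic_pow_le t _).trans_lt ?_
        have hc : c < p ^ n - 1 := by
          by_contra! hc
          have h3 : p * (p ^ n - 1) ≤ p * c := Nat.mul_le_mul_left p hc
          have h4 : c = p ^ n - 1 := by
            by_contra hc'
            have h5 : p * (p ^ n - 1 + 1) ≤ p * c := Nat.mul_le_mul_left p (by omega)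
            rw [mul_add] at h5
            omega
          apply hne
          rw [h4] at hij ⊢
          rw [Prod.mk.injEq]
          omega
        have h5 : p * (c + 1) ≤ p * (p ^ n - 1) := Nat.mul_le_mul_left p hc
        rw [mul_add] at h5
        obtain ⟨a, ha⟩ := hp
        omega
      · rw [mul_zero]
    · intro h
      exact absurd (Finset.HasAntidiagonal.mem_antidiagonal.mpr h2.symm) h

lemma ringChar_ne_two {K : Type*} [Field K] [CharP K p] (hp : Odd p) : ringChar K ≠ 2 := by
  rw [ringChar.eq K p]
  rintro rfl
  exact absurd hp (by decide)

/-- The number of points modulo `p`. -/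
lemma card_legendre_cast {K : Type*} [Field K] [Fintype K] [DecidableEq K] [Algebra (ZMod p) K]
    (hp : Odd p) {n : ℕ} (hn : n ≠ 0) (hK : Fintype.card K = p ^ n) (t : ZMod p)
    [(legendre (algebraMap (ZMod p) K t)).IsElliptic] :
    (Nat.card (legendre (algebraMap (ZMod p) K t)).Point : K) =
      1 - algebraMap (ZMod p) K ((legendreCubic t ^ (p / 2)).coeff (p - 1)) ^ n := by
  have hchar : CharP K p := charP_of_injective_algebraMap (algebraMap (ZMod p) K).injective p
  have h2 := ringChar_ne_two (K := K) hp
  have h := congrArg (Int.cast (R := K)) (card_legendre h2 (algebraMap (ZMod p) K t))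
  push_cast at h
  rw [h]
  have hq : p ^ n % 2 = 1 := Nat.odd_iff.mp hp.pow
  have h1 : 1 < p ^ n := Nat.one_lt_pow hn (Fact.out : p.Prime).one_lt
  have he (x : K) : (x * (x - 1) * (x - algebraMap (ZMod p) K t)) ^ (p ^ n / 2) =
      ((legendreCubic t ^ (p ^ n / 2)).map (algebraMap (ZMod p) K)).eval x := by
    simp [legendreCubic]
  simp_rw [quadraticChar_eq_pow_of_char_ne_two' h2, hK, he]
  -- By Euler's criterion the character sum is the sum of the values of `f ^ ((q - 1) / 2)`, of
  -- degree at most `3 (q - 1) / 2 < 2 (q - 1)`.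
  rw [Finset.sum_add_distrib, sum_eval_eq_neg_coeff, hK, coeff_map, coeff_legendreCubic_pow hp]
  · simp [hK, hn]
    ring
  · rw [natDegree_map]
    refine (natDegree_legendreCubic_pow_le t _).trans_lt ?_
    rw [hK]
    omega

/-- A Legendre curve over `𝔽_p` with `p ≡ 1 (mod 4)` is not supersingular. -/
lemma not_isSupersingular_of_mod_four {k : Type*} [Field k] [IsAlgClosed k] [DecidableEq k]
    [Algebra (ZMod p) k] [CharP k p] (hp : p % 4 = 1) (t : ZMod p)
    [(legendre (algebraMap (ZMod p) k t)).IsElliptic] :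
    ¬ IsSupersingular p (legendre (algebraMap (ZMod p) k t)) := by
  classical
  intro hss
  have hpp : p.Prime := Fact.out
  have hodd : Odd p := by rw [Nat.odd_iff]; omega
  have hell (K : Type) [Field K] [Algebra (ZMod p) K] :
      (legendre (algebraMap (ZMod p) K t)).IsElliptic := by
    have hchar : CharP K p := charP_of_injective_algebraMap (algebraMap (ZMod p) K).injective p
    have ht := legendre_ne (t := algebraMap (ZMod p) k t)
    refine legendre_isElliptic (Ring.two_ne_zero (ringChar_ne_two (K := K) hodd)) ?_ ?_
    · rw [Ne, map_eq_zero]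
      rintro rfl
      exact ht.1 (map_zero _)
    · rw [Ne, map_eq_one_iff _ (algebraMap (ZMod p) K).injective]
      rintro rfl
      exact ht.2 (map_one _)
  set H := (legendreCubic t ^ (p / 2)).coeff (p - 1) with hH
  by_cases hH0 : H = 0
  · have := hell (ZMod p)
    have hcard := card_legendre_cast (K := ZMod p) hodd one_ne_zero
      (by rw [ZMod.card, pow_one]) t
    rw [← hH, hH0, map_zero, zero_pow one_ne_zero, sub_zero] at hcard
    have h2 : (2 : ZMod p) ≠ 0 := Ring.two_ne_zero (ringChar_ne_two (K := ZMod p) hodd)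
    have h4 : 4 ∣ Nat.card (legendre (algebraMap (ZMod p) (ZMod p) t)).Point :=
      four_dvd_card (S := pt₀ _) (T := pt₁ _) (Point.some_ne_zero _) (Point.some_ne_zero _)
        (fun h ↦ one_ne_zero (Point.some.inj h).1) (two_smul_pt₀ h2) (two_smul_pt₁ h2)
    have hZ := card_legendre (ringChar_ne_two (K := ZMod p) hodd) (algebraMap (ZMod p) (ZMod p) t)
    have hle : (Nat.card (legendre (algebraMap (ZMod p) (ZMod p) t)).Point : ℤ) ≤ 1 + p * 2 := by
      rw [hZ]
      gcongr
      calc _ ≤ ∑ _x : ZMod p, (2 : ℤ) := Finset.sum_le_sum fun x _ ↦ by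
            rcases quadraticChar_isQuadratic (ZMod p)
              (x * (x - 1) * (x - algebraMap (ZMod p) (ZMod p) t)) with h | h | h <;>
            rw [h] <;> norm_num
        _ = p * 2 := by simp [ZMod.card]
    have hmod : (Nat.card (legendre (algebraMap (ZMod p) (ZMod p) t)).Point : ZMod p) =
      ((1 : ℕ) : ZMod p) := by rw [hcard, Nat.cast_one]
    rw [ZMod.natCast_eq_natCast_iff] at hmod
    generalize Nat.card (legendre (algebraMap (ZMod p) (ZMod p) t)).Point = N at *
    have hN1 : 1 ≤ N := by
      rcases Nat.eq_zero_or_pos N with rfl | h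
      · exact absurd ((Nat.modEq_iff_dvd' zero_le_one).mp hmod) (by simpa using hpp.one_lt.ne')
      · exact h
    obtain ⟨c, hc⟩ := (Nat.modEq_iff_dvd' hN1).mp hmod.symm
    have hc2 : c ≤ 2 := by
      by_contra! h3
      have : p * 3 ≤ p * c := Nat.mul_le_mul_left p h3
      have := hpp.pos
      omega
    -- The count is `1 + p c` with `c ≤ 2`, that is 1, 2 or 3 modulo 4. The trivial bound of two
    -- points for each abscissa suffices.
    interval_cases c <;> omega
  -- By Fermat `H ^ (p - 1) = 1`, so over the extension of degree `p - 1` the prime `p` divides the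
  -- count, and Cauchy's theorem gives a point of order `p`.
  · have hp1 : p - 1 ≠ 0 := by have := hpp.one_lt; omega
    let K := GaloisField p (p - 1)
    have : Fintype K := Fintype.ofFinite K
    have hKc : Fintype.card K = p ^ (p - 1) := by
      rw [← Nat.card_eq_fintype_card, GaloisField.card p (p - 1) hp1]
    have := hell K
    have hcard := card_legendre_cast (K := K) hodd hp1 hKc t
    rw [← hH, ← map_pow, ZMod.pow_card_sub_one_eq_one hH0, map_one, sub_self] at hcard
    have hdvd : p ∣ Nat.card (legendre (algebraMap (ZMod p) K t)).Point :=
      (CharP.cast_eq_zero_iff K p _).mp hcard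
    have hfin : Finite (legendre (algebraMap (ZMod p) K t)).Point :=
      have : Finite (Option {xy : K × K //
        (legendre (algebraMap (ZMod p) K t)).Equation xy.1 xy.2}) := inferInstance
      @Finite.of_equiv _ (Option _) this (legendre (algebraMap (ZMod p) K t)).pointEquiv.symm
    obtain ⟨P, hP⟩ := exists_prime_addOrderOf_dvd_card' p hdvd
    let σ : K →ₐ[ZMod p] k := IsAlgClosed.lift
    have hσ : (σ : K →+* k) (algebraMap (ZMod p) K t) = algebraMap (ZMod p) k t := σ.commutes t
    have h0 := hss (mapLegendre _ hσ P) (by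
      rw [← map_nsmul, addOrderOf_dvd_iff_nsmul_eq_zero.mp hP.dvd, map_zero])
    have hP0 : P = 0 := mapLegendre_injective _ hσ (by rw [h0, map_zero])
    rw [hP0, addOrderOf_zero] at hP
    exact hpp.one_lt.ne hP

end Counting

/-! ### The two curves of the theorem in normal form -/

section EpsCurve

variable {k : Type*} [Field k] {l s : k}

/-- A rational parametrization of the conic `s² = l² - l + 1`. -/
lemma exists_conic_param (h3 : (3 : k) ≠ 0) (h : s ^ 2 = l ^ 2 - l + 1) :
    ∃ u d q, d ≠ 0 ∧ d = 2 * u + 1 ∧ q = 1 + u + u ^ 2 ∧ l = (1 - u ^ 2) / d ∧ s = q / d := by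
  -- Here `(2 s + 2 l - 1)(2 s - 2 l + 1) = 3` on the conic, so neither factor vanishes.
  have hu : 2 * (s - l) + 1 ≠ 0 := by
    intro h0
    apply h3
    linear_combination (2 * s - 1 + 2 * l) * h0 - 4 * h
  refine ⟨s - l, _, _, hu, rfl, rfl, ?_, ?_⟩
  · rw [eq_div_iff hu]
    linear_combination h
  · rw [eq_div_iff hu]
    linear_combination h

lemma intUnits_cast_mul_sq (ε : ℤˣ) : (((ε : ℤ) : k) * s) ^ 2 = s ^ 2 := by
  rcases Int.units_eq_one_or ε with rfl | rfl <;> simp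

lemma intUnits_cast_neg_mul (ε : ℤˣ) : (((-ε : ℤˣ) : ℤ) : k) * s = -(((ε : ℤ) : k) * s) := by
  simp

lemma bigLambda_eq (ε : ℤˣ) : bigLambda l s ε = (1 - l) * (l + ((ε : ℤ) : k) * s) ^ 2 := rfl

lemma x₀_eq (ε : ℤˣ) : x₀ l s ε = (l + 1 + 2 * (((ε : ℤ) : k) * s)) / 3 := by
  rw [x₀]; ring

lemma coeffA_eq (h : s ^ 2 = l ^ 2 - l + 1) (ε : ℤˣ) : coeffA l s ε =
    (((ε : ℤ) : k) * s) ^ 2 * (2 * l - 1 + 2 * (((ε : ℤ) : k) * s)) := by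
  rw [coeffA, intUnits_cast_mul_sq, h]; ring

lemma coeffB_eq (h : s ^ 2 = l ^ 2 - l + 1) (ε : ℤˣ) : coeffB l s ε =
    -(2 * (((ε : ℤ) : k) * s) ^ 2 * (2 * l - 1) + (5 * (((ε : ℤ) : k) * s) ^ 2 - 3) *
      (((ε : ℤ) : k) * s)) / (9 * (((ε : ℤ) : k) * s) ^ 2) := by
  rw [coeffB, intUnits_cast_mul_sq, h]; ring

lemma scaleR_eq (ε : ℤˣ) : scaleR l s ε = (2 * l - 1 + 2 * (((ε : ℤ) : k) * s)) / 9 := by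
  rw [scaleR]; ring

/-- This is `(2 l - 1)² - 4 s² = -3` after scaling; it fixes the sign in `φ² = -3p`. -/
lemma scaleR_mul (h3 : (3 : k) ≠ 0) (h : s ^ 2 = l ^ 2 - l + 1) (ε : ℤˣ) :
    27 * scaleR l s (-ε) * scaleR l s ε = -1 := by
  have h9 : (9 : k) ≠ 0 := by rw [show (9 : k) = 3 * 3 by norm_num]; exact mul_ne_zero h3 h3
  rw [scaleR_eq, scaleR_eq, intUnits_cast_neg_mul]
  have := intUnits_cast_mul_sq (s := s) ε
  field_simp
  linear_combination (-108) * this - 108 * h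

lemma nine_ne_zero (h3 : (3 : k) ≠ 0) : (9 : k) ≠ 0 := by
  rw [show (9 : k) = 3 * 3 by norm_num]; exact mul_ne_zero h3 h3

/-- With `l` and `s` parametrized by the conic, the comparison of coefficients becomes an identity
of rational functions in `u`. -/
lemma isThreeForm_epsCurve (h3 : (3 : k) ≠ 0) (h : s ^ 2 = l ^ 2 - l + 1)
    (hs : s ≠ 0) (ε : ℤˣ) :
    IsThreeForm (epsCurve l s ε) (x₀ l s ε) (coeffA l s ε) (coeffB l s ε) := by
  have h9 := nine_ne_zero h3
  have hσ2 := (intUnits_cast_mul_sq (s := s) ε).trans h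
  have hσ0 : ((ε : ℤ) : k) * s ≠ 0 := by
    rw [← pow_ne_zero_iff two_ne_zero, intUnits_cast_mul_sq]; exact pow_ne_zero 2 hs
  rw [x₀_eq, coeffA_eq h, coeffB_eq h]
  simp only [epsCurve, bigLambda_eq]
  generalize ((ε : ℤ) : k) * s = σ at *
  obtain ⟨u, d, q, hd, hdu, hq, rfl, rfl⟩ := exists_conic_param h3 hσ2
  have hq0 : q ≠ 0 := fun h ↦ hσ0 (by rw [h, zero_div])
  refine ⟨rfl, ?_, rfl, ?_, ?_⟩ <;> simp only [legendre] <;> field_simp <;> rw [hdu, hq] <;> ring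

lemma coeffA_neg (h3 : (3 : k) ≠ 0) (h : s ^ 2 = l ^ 2 - l + 1) (ε : ℤˣ) :
    coeffA l s (-ε) = -27 * coeffA l s ε * scaleR l s (-ε) ^ 2 := by
  have h9 := nine_ne_zero h3
  have e := scaleR_mul h3 h ε
  have e1 : coeffA l s ε = (((ε : ℤ) : k) * s) ^ 2 * (9 * scaleR l s ε) := by
    rw [coeffA_eq h, scaleR_eq]; field_simp
  have e2 : coeffA l s (-ε) = (((ε : ℤ) : k) * s) ^ 2 * (9 * scaleR l s (-ε)) := by
    rw [coeffA_eq h, scaleR_eq, intUnits_cast_neg_mul]; field_simp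
  rw [e1, e2]
  linear_combination (((ε : ℤ) : k) * s) ^ 2 * 9 * scaleR l s (-ε) * e

/-- Together with `coeffA_neg` this identifies the quotient curve, scaled by `r`, with the curve of
opposite sign. -/
lemma coeffB_neg (h3 : (3 : k) ≠ 0) (h : s ^ 2 = l ^ 2 - l + 1)
    (hs : s ≠ 0) (ε : ℤˣ) :
    coeffB l s (-ε) = (4 * coeffA l s ε + 27 * coeffB l s ε) * scaleR l s (-ε) ^ 2 := by
  have h9 := nine_ne_zero h3
  have hσ2 := (intUnits_cast_mul_sq (s := s) ε).trans h
  have hσ0 : ((ε : ℤ) : k) * s ≠ 0 := by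
    rw [← pow_ne_zero_iff two_ne_zero, intUnits_cast_mul_sq]; exact pow_ne_zero 2 hs
  rw [coeffA_eq h, coeffB_eq h, coeffB_eq h, scaleR_eq, intUnits_cast_neg_mul]
  generalize ((ε : ℤ) : k) * s = σ at *
  obtain ⟨u, d, q, hd, hdu, hq, rfl, rfl⟩ := exists_conic_param h3 hσ2
  have hq0 : q ≠ 0 := fun h ↦ hσ0 (by rw [h, zero_div])
  field_simp
  rw [hdu, hq]
  ring

/-- This and `psiX_one` are what make the composite with Frobenius fix the 2-torsion pointwise. -/
lemma psiX_zero (h3 : (3 : k) ≠ 0) (h : s ^ 2 = l ^ 2 - l + 1)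
    (hs : s ≠ 0) (ε : ℤˣ) (hx : x₀ l s ε ≠ 0) : psiX l s ε 0 0 = 0 := by
  have h9 := nine_ne_zero h3
  have hσ2 := (intUnits_cast_mul_sq (s := s) ε).trans h
  have hσ0 : ((ε : ℤ) : k) * s ≠ 0 := by
    rw [← pow_ne_zero_iff two_ne_zero, intUnits_cast_mul_sq]; exact pow_ne_zero 2 hs
  simp only [psiX, x₀_eq, coeffA_eq h, coeffB_eq h, scaleR_eq, intUnits_cast_neg_mul] at hx ⊢
  generalize ((ε : ℤ) : k) * s = σ at *
  obtain ⟨u, d, q, hd, hdu, hq, rfl, rfl⟩ := exists_conic_param h3 hσ2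
  have hq0 : q ≠ 0 := fun h ↦ hσ0 (by rw [h, zero_div])
  have e : ((1 - u ^ 2) / d + 1 + 2 * (q / d)) / 3 =
      (u + 2) ^ 2 / (3 * d) := by field_simp; rw [hdu, hq]; ring
  rw [e] at hx ⊢
  have hu2 : u + 2 ≠ 0 := fun h ↦ hx (by rw [h]; simp)
  rw [zero_sub]
  field_simp
  rw [hdu, hq]
  ring

lemma psiX_one (h3 : (3 : k) ≠ 0) (h : s ^ 2 = l ^ 2 - l + 1)
    (hs : s ≠ 0) (ε : ℤˣ) (hx : 1 ≠ x₀ l s ε) : psiX l s ε 1 0 = 1 := by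
  have h9 := nine_ne_zero h3
  have hσ2 := (intUnits_cast_mul_sq (s := s) ε).trans h
  have hσ0 : ((ε : ℤ) : k) * s ≠ 0 := by
    rw [← pow_ne_zero_iff two_ne_zero, intUnits_cast_mul_sq]; exact pow_ne_zero 2 hs
  have hx := sub_ne_zero.mpr hx
  simp only [psiX, x₀_eq, coeffA_eq h, coeffB_eq h, scaleR_eq, intUnits_cast_neg_mul] at hx ⊢
  generalize ((ε : ℤ) : k) * s = σ at *
  obtain ⟨u, d, q, hd, hdu, hq, rfl, rfl⟩ := exists_conic_param h3 hσ2
  have hq0 : q ≠ 0 := fun h ↦ hσ0 (by rw [h, zero_div])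
  have e : 1 - ((1 - u ^ 2) / d + 1 + 2 * (q / d)) / 3 =
      -(u - 1) ^ 2 / (3 * d) := by field_simp; rw [hdu, hq]; ring
  rw [e] at hx ⊢
  have hu2 : u - 1 ≠ 0 := fun h ↦ hx (by rw [h]; simp)
  field_simp
  rw [hdu, hq]
  ring

end EpsCurve

/-! ### The composite of Frobenius with the isogeny -/

section FrobeniusPsi

variable {k : Type*} [Field k] {l s : k}

lemma map_x₀ (σ : k →+* k) (ε : ℤˣ) : σ (x₀ l s ε) = x₀ (σ l) (σ s) ε := by simp [x₀, map_ofNat]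

lemma map_psiX (σ : k →+* k) (ε : ℤˣ) (x y : k) :
    σ (psiX l s ε x y) = psiX (σ l) (σ s) ε (σ x) (σ y) := by
  simp [psiX, x₀, coeffA, coeffB, scaleR, map_ofNat]

lemma map_psiY (σ : k →+* k) (ε : ℤˣ) (x y : k) :
    σ (psiY l s ε x y) = psiY (σ l) (σ s) ε (σ x) (σ y) := by
  simp [psiY, x₀, coeffA, coeffB, scaleR, map_ofNat]

lemma map_bigLambda (σ : k →+* k) (ε : ℤˣ) :
    σ (bigLambda l s ε) = bigLambda (σ l) (σ s) ε := by simp [bigLambda]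

/-- The formulas depend on `s` and `ε` only through `ε s`. Hence Frobenius, which negates `s`,
exchanges the data of the two curves. -/
lemma x₀_neg (ε : ℤˣ) : x₀ l (-s) ε = x₀ l s (-ε) := by simp [x₀]

lemma psiX_neg (ε : ℤˣ) (x y : k) : psiX l (-s) ε x y = psiX l s (-ε) x y := by
  simp [psiX, x₀, coeffA, coeffB, scaleR]

lemma psiY_neg (ε : ℤˣ) (x y : k) : psiY l (-s) ε x y = psiY l s (-ε) x y := by
  simp [psiY, x₀, coeffA, coeffB, scaleR]

lemma bigLambda_neg (ε : ℤˣ) : bigLambda l (-s) ε = bigLambda l s (-ε) := by simp [bigLambda]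

variable (l s) in
/-- The map `ψ` is the isogeny `ψ^ε`. -/
def IsPsi (ε δ : ℤˣ) (ψ : (epsCurve l s ε).Point → (epsCurve l s δ).Point) : Prop :=
  ∀ (x y : k) (h : (epsCurve l s ε).Nonsingular x y),
    (x = x₀ l s ε → ψ (.some x y h) = 0) ∧
    (x ≠ x₀ l s ε → ∃ h', ψ (.some x y h) = .some (psiX l s ε x y) (psiY l s ε x y) h')

lemma isRatFun_psiX (W : WeierstrassCurve.Affine k) (ε : ℤˣ) :
    IsRatFun W fun P ↦ psiX l s ε (xc W P) (yc W P) := by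
  have hX := (isRatFun_xc (W := W)).sub (isRatFun_const (x₀ l s ε))
  have hY := isRatFun_yc (W := W)
  exact (((isRatFun_const (scaleR l s (-ε) ^ 2)).mul (((isRatFun_const 3).mul
    (((((isRatFun_const 6).mul (hY.mul hY)).add
      (isRatFun_const (6 * coeffA l s ε * coeffB l s ε ^ 2))).sub
      ((isRatFun_const 3).mul (hX.mul (hX.mul hX)))).sub
      ((isRatFun_const (2 * coeffA l s ε)).mul (hX.mul hX)))).div (hX.mul hX))).add
      (isRatFun_const (x₀ l s (-ε)))).congr (.of_forall fun P ↦ by simp only [psiX]; ring)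

lemma isRatFun_psiY (W : WeierstrassCurve.Affine k) (ε : ℤˣ) :
    IsRatFun W fun P ↦ psiY l s ε (xc W P) (yc W P) := by
  have hX := (isRatFun_xc (W := W)).sub (isRatFun_const (x₀ l s ε))
  have hY := isRatFun_yc (W := W)
  exact ((isRatFun_const (scaleR l s (-ε) ^ 3)).mul (((hY.mul (isRatFun_const 27)).mul
    (((isRatFun_const (8 * coeffA l s ε * coeffB l s ε ^ 2)).sub (hX.mul (hX.mul hX))).sub
      ((isRatFun_const (4 * coeffA l s ε * coeffB l s ε)).mul hX))).div
      (hX.mul (hX.mul hX)))).congr (.of_forall fun P ↦ by simp only [psiY]; ring)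

lemma IsRatFun.pow {W : WeierstrassCurve.Affine k} {f : W.Point → k} (hf : IsRatFun W f) (n : ℕ) :
    IsRatFun W fun P ↦ f P ^ n :=
  (hf.eval (Polynomial.X ^ n)).congr (.of_forall fun P ↦ by simp)

lemma IsFrobeniusPsi.isRational {p : ℕ} {ε : ℤˣ}
    {φ : (epsCurve l s ε).Point → (epsCurve l s ε).Point} (hφ : IsFrobeniusPsi p l s ε φ) :
    IsRational _ φ := by
  have key : ∀ᶠ P in cofinite, ∃ h', φ P = .some (psiX l s ε (xc _ P) (yc _ P) ^ p)
      (psiY l s ε (xc _ P) (yc _ P) ^ p) h' := by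
    filter_upwards [eventually_ne .zero, eventually_xc_ne (x₀ l s ε)] with P h0 hx
    rcases P with _ | ⟨x, y, h⟩
    · exact absurd rfl h0
    · exact (hφ.2 x y h).2 hx
  refine (isRational_iff _).mpr ⟨((isRatFun_psiX (l := l) (s := s) _ ε).pow p).congr ?_,
    ((isRatFun_psiY (l := l) (s := s) _ ε).pow p).congr ?_, ?_⟩
  · filter_upwards [key] with P ⟨h, e⟩
    rw [e]; rfl
  · filter_upwards [key] with P ⟨h, e⟩
    rw [e]; rfl
  · filter_upwards [key] with P ⟨h, e⟩
    rw [e]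
    exact Point.some_ne_zero _

variable [DecidableEq k] [∀ ε, (epsCurve l s ε).IsElliptic]

/-- The sign `δ` is a variable equal to `-ε`, so that both directions can be stated without the type
of the curve with sign `-(-ε)`. -/
lemma exists_isPsi [IsAlgClosed k] (h2 : (2 : k) ≠ 0) (h3 : (3 : k) ≠ 0)
    (h : s ^ 2 = l ^ 2 - l + 1) (hs : s ≠ 0) {ε δ : ℤˣ} (hδ : δ = -ε) :
    ∃ (ψ : (epsCurve l s ε).Point →+ (epsCurve l s δ).Point)
      (ψ' : (epsCurve l s δ).Point →+ (epsCurve l s ε).Point), IsPsi l s ε δ ψ ∧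
      IsPsi l s δ ε ψ' ∧ ∀ P, ψ' (ψ P) = -(3 • P) := by
  have hε : ε = -δ := by rw [hδ, neg_neg]
  have eA : coeffA l s δ = -27 * coeffA l s ε * scaleR l s (-ε) ^ 2 := hδ ▸ coeffA_neg h3 h ε
  have eB : coeffB l s δ = (4 * coeffA l s ε + 27 * coeffB l s ε) * scaleR l s (-ε) ^ 2 :=
    hδ ▸ coeffB_neg h3 h hs ε
  have eA' : coeffA l s ε = -27 * coeffA l s δ * scaleR l s (-δ) ^ 2 := by
    conv_lhs => rw [hε]
    exact coeffA_neg h3 h δ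
  have eB' : coeffB l s ε = (4 * coeffA l s δ + 27 * coeffB l s δ) * scaleR l s (-δ) ^ 2 := by
    conv_lhs => rw [hε]
    exact coeffB_neg h3 h hs δ
  have hr : 27 * scaleR l s (-ε) * scaleR l s (-δ) = -1 := by
    rw [← hε]; exact scaleR_mul h3 h ε
  have hr0 : 27 * scaleR l s (-ε) * scaleR l s (-δ) ≠ 0 := by
    rw [hr]; exact neg_ne_zero.mpr one_ne_zero
  have hW := isThreeForm_epsCurve h3 h hs ε
  have hW' := isThreeForm_epsCurve h3 h hs δ
  have e1 : coeffA l s ε = -27 * (-27 * coeffA l s ε * scaleR l s (-ε) ^ 2) *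
      scaleR l s (-δ) ^ 2 := by rw [← eA, ← eA']
  have e2 : coeffB l s ε = (4 * (-27 * coeffA l s ε * scaleR l s (-ε) ^ 2) +
      27 * ((4 * coeffA l s ε + 27 * coeffB l s ε) * scaleR l s (-ε) ^ 2)) *
      scaleR l s (-δ) ^ 2 := by rw [← eA, ← eB, ← eB']
  have hW'' := hW
  rw [e1, e2] at hW''
  rw [eA, eB] at hW'
  have r1 := right_ne_zero_of_mul (left_ne_zero_of_mul hr0)
  have r2 := right_ne_zero_of_mul hr0
  refine ⟨threeHom hW hW' h2 h3 r1, threeHom hW' hW'' h2 h3 r2, fun x y hxy ↦ ⟨?_, ?_⟩,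
    fun x y hxy ↦ ⟨?_, ?_⟩, threeHom_threeHom hW hW' h2 h3 r1 r2 hr hW''⟩
  · exact threeFun_kernel hW hW' hxy
  · intro hx
    have e : threeX (coeffA l s ε) (coeffB l s ε) (scaleR l s (-ε)) (x₀ l s ε) (x₀ l s δ) x y =
      psiX l s ε x y := by rw [hδ]; rfl
    rw [← e]
    exact ⟨_, threeFun_some hW hW' hxy hx⟩
  · exact threeFun_kernel hW' hW'' hxy
  · intro hx
    have e : threeX (coeffA l s δ) (coeffB l s δ) (scaleR l s (-δ)) (x₀ l s δ) (x₀ l s ε) x y =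
      psiX l s δ x y := by
      rw [show x₀ l s ε = x₀ l s (-δ) by rw [← hε]]; rfl
    have e' : threeY (coeffA l s δ) (coeffB l s δ) (scaleR l s (-δ)) (x₀ l s δ) x y =
      psiY l s δ x y := rfl
    rw [← e, ← e', eA, eB]
    exact ⟨_, threeFun_some hW' hW'' hxy hx⟩

/-- The two parameters differ by `4 (1 - l) l ε s`. Both `l = 0` and `l = 1` are excluded, since
they give the singular values `Λ = 1` and `Λ = 0`. -/
lemma bigLambda_ne_neg (h2 : (2 : k) ≠ 0) (h : s ^ 2 = l ^ 2 - l + 1) (hs : s ≠ 0) (ε : ℤˣ) :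
    bigLambda l s (-ε) ≠ bigLambda l s ε := by
  intro e
  have ht := legendre_ne (t := bigLambda l s ε)
  have hσ2 := (intUnits_cast_mul_sq (s := s) ε).trans h
  have hσ0 : ((ε : ℤ) : k) * s ≠ 0 := by
    rw [← pow_ne_zero_iff two_ne_zero, intUnits_cast_mul_sq]; exact pow_ne_zero 2 hs
  rw [bigLambda_eq] at ht
  rw [bigLambda_eq, bigLambda_eq, intUnits_cast_neg_mul] at e
  generalize ((ε : ℤ) : k) * s = σ at *
  have hl0 : l ≠ 0 := by
    rintro rfl
    apply ht.2
    linear_combination hσ2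
  have : 2 * 2 * ((1 - l) * l * σ) = 0 := by linear_combination -e
  exact mul_ne_zero (mul_ne_zero h2 h2)
    (mul_ne_zero (mul_ne_zero (left_ne_zero_of_mul ht.1) hl0) hσ0) this

variable {p : ℕ} [Fact p.Prime] [CharP k p]

/-- The composition of `ψ^ε` and Frobenius is a square root of `-3p`, and it fixes the points of
order two. -/
lemma exists_isFrobeniusPsi [IsAlgClosed k] (hp : p % 4 = 1) (h2 : (2 : k) ≠ 0) (h3 : (3 : k) ≠ 0)
    (h : s ^ 2 = l ^ 2 - l + 1) (hs : s ≠ 0) (hlp : l ^ p = l) (hsp : s ^ p = -s) (ε : ℤˣ)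
    (hss : IsSupersingular p (epsCurve l s ε)) :
    ∃ φ : AddMonoid.End (epsCurve l s ε).Point, IsFrobeniusPsi p l s ε φ ∧
      (∀ P, φ (φ P) = -((3 * p) • P)) ∧ ∀ T, 2 • T = 0 → φ T = T := by
  obtain ⟨δ, hδ⟩ : ∃ δ, δ = -ε := ⟨_, rfl⟩
  have hε : ε = -δ := by rw [hδ, neg_neg]
  have hF (x : k) : frobenius k p x = x ^ p := frobenius_def p x
  have hFl : frobenius k p l = l := by rw [hF, hlp]
  have hFs : frobenius k p s = -s := by rw [hF, hsp]
  have ht : frobenius k p (bigLambda l s ε) = bigLambda l s δ := by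
    rw [map_bigLambda, hFl, hFs, bigLambda_neg, hδ]
  have ht' : frobenius k p (bigLambda l s δ) = bigLambda l s ε := by
    rw [map_bigLambda, hFl, hFs, bigLambda_neg, hε]
  obtain ⟨ψ, ψ', hψ, hψ', hψψ⟩ := exists_isPsi h2 h3 h hs hδ
  set F := mapLegendre (frobenius k p) ht' with hFdef
  set F' := mapLegendre (frobenius k p) ht with hFdef'
  -- Frobenius conjugates `ψ'` to `ψ`. Hence `φ² = F ψ F ψ = F F' ψ' ψ`, which is -3 times the
  -- square of Frobenius.
  have hcomm (Q : (epsCurve l s δ).Point) : ψ (F Q) = F' (ψ' Q) := by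
    rcases Q with _ | ⟨x, y, hxy⟩
    · rw [← Point.zero_def, map_zero, map_zero, map_zero, map_zero]
    · obtain ⟨h', e⟩ := mapLegendre_some (frobenius k p) ht' hxy
      rw [hFdef, e]
      have hx₀ : x₀ l s ε = frobenius k p (x₀ l s δ) := by
        rw [map_x₀, hFl, hFs, x₀_neg, hε]
      by_cases hx : x = x₀ l s δ
      · rw [(hψ' x y hxy).1 hx, map_zero, (hψ _ _ h').1 (by rw [hx, hx₀])]
      · obtain ⟨i, e1⟩ := (hψ' x y hxy).2 hx
        obtain ⟨j, e2⟩ := mapLegendre_some (frobenius k p) ht i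
        obtain ⟨i', e3⟩ := (hψ _ _ h').2 (by
          rw [hx₀]; exact fun hx' ↦ hx ((frobenius k p).injective hx'))
        rw [e1, hFdef', e2, e3, Point.some.injEq, map_psiX, map_psiY, hFl, hFs, psiX_neg, psiY_neg,
          ← hε]
        exact ⟨rfl, rfl⟩
  set φ : AddMonoid.End (epsCurve l s ε).Point := F.comp ψ with hφ
  have hφP (P : (epsCurve l s ε).Point) : φ P = F (ψ P) := rfl
  have hfrob : IsFrobeniusPsi p l s ε φ := by
    refine ⟨map_zero φ, fun x y hxy ↦ ⟨fun hx ↦ ?_, fun hx ↦ ?_⟩⟩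
    · rw [hφP, (hψ x y hxy).1 hx, map_zero]; rfl
    · obtain ⟨i, e⟩ := (hψ x y hxy).2 hx
      obtain ⟨j, e'⟩ := mapLegendre_some (frobenius k p) ht' i
      rw [hφP, e]
      simp only [hF] at e'
      exact ⟨_, e'⟩
  refine ⟨φ, hfrob, ?_, ?_⟩
  -- As `l ∈ 𝔽_p`, its root `w` lies in `𝔽_{p²}`, and so does `v = w (1 - l - ε s)`, whose square is
  -- `1 - Λ`.
  · obtain ⟨w, hw⟩ := IsAlgClosed.exists_pow_nat_eq l two_pos
    have hw2 : frobenius k p (frobenius k p w) = w := by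
      have e : (frobenius k p w - w) * (frobenius k p w + w) = 0 := by
        have : frobenius k p w ^ 2 = w ^ 2 := by rw [← map_pow, hw, hFl]
        linear_combination this
      rcases mul_eq_zero.mp e with e | e
      · rw [sub_eq_zero.mp e, sub_eq_zero.mp e]
      · rw [eq_neg_of_add_eq_zero_left e, map_neg, eq_neg_of_add_eq_zero_left e, neg_neg]
    have hFF (x : k) : x ^ p ^ 2 = frobenius k p (frobenius k p x) := by
      rw [hF, hF, ← pow_mul, sq]
    have hσ2 := (intUnits_cast_mul_sq (s := s) ε).trans h
    obtain ⟨-, hpF⟩ := hss.smul_eq_frobenius_sq hp h2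
      (by rw [← hF, ht, hδ]; exact bigLambda_ne_neg h2 h hs ε)
      (v := w * (1 - l - ((ε : ℤ) : k) * s)) (by
        rw [bigLambda_eq, mul_pow, hw]
        linear_combination hσ2) (by
        rw [hFF]
        simp only [map_mul, map_sub, map_one, map_intCast, hFl, hFs, hw2, map_neg, neg_neg])
    have hFFp (P : (epsCurve l s ε).Point) : F (F' P) = p • P := by
      rcases P with _ | ⟨x, y, hxy⟩
      · rw [← Point.zero_def, map_zero, map_zero, smul_zero]
      · obtain ⟨i, e⟩ := mapLegendre_some (frobenius k p) ht hxy
        obtain ⟨j, e'⟩ := mapLegendre_some (frobenius k p) ht' i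
        obtain ⟨i', e''⟩ := hpF x y hxy
        rw [e'', hFdef', e, hFdef, e', Point.some.injEq, hFF, hFF]
        exact ⟨rfl, rfl⟩
    intro P
    rw [hφP, hφP, hcomm, hψψ, hFFp, smul_neg, mul_comm, mul_smul]
  · have hW := isThreeForm_epsCurve h3 h hs ε
    -- The ordinate of a kernel point has square `A B² ≠ 0`.
    have htor {x : k} (hx : (epsCurve l s ε).Nonsingular x 0) : x ≠ x₀ l s ε := by
      rintro rfl
      have := (hW.equation_iff _ _).mp hx.1
      refine mul_ne_zero hW.mul_ne_zero (right_ne_zero_of_mul hW.mul_ne_zero) ?_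
      linear_combination -this
    have hp0 : p ≠ 0 := (Fact.out : p.Prime).ne_zero
    have hpsiY {x : k} : psiY l s ε x 0 ^ p = 0 := by
      rw [psiY]
      simp [hp0]
    have h0 : φ (pt₀ _) = pt₀ _ := by
      obtain ⟨i, e⟩ := (hfrob.2 0 0 (legendre_nonsingular_iff.mpr (by ring))).2 (htor
        (legendre_nonsingular_iff.mpr (by ring)))
      rw [pt₀, e, Point.some.injEq, psiX_zero h3 h hs ε
        (htor (legendre_nonsingular_iff.mpr (by ring))).symm]
      exact ⟨zero_pow hp0, hpsiY⟩
    have h1 : φ (pt₁ _) = pt₁ _ := by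
      obtain ⟨i, e⟩ := (hfrob.2 1 0 (legendre_nonsingular_iff.mpr (by ring))).2 (htor
        (legendre_nonsingular_iff.mpr (by ring)))
      rw [pt₁, e, Point.some.injEq, psiX_one h3 h hs ε
        (htor (legendre_nonsingular_iff.mpr (by ring)))]
      exact ⟨one_pow _, hpsiY⟩
    rintro (_ | ⟨x, y, hxy⟩) hT
    · exact map_zero φ
    · obtain rfl := (two_smul_eq_zero_iff h2 hxy).mp hT
      have e := legendre_nonsingular_iff.mp hxy
      rw [zero_pow two_ne_zero, eq_comm, mul_eq_zero, mul_eq_zero] at e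
      rcases e with (rfl | e) | e
      · exact h0
      · obtain rfl := sub_eq_zero.mp e
        exact h1
      · obtain rfl := sub_eq_zero.mp e
        obtain ⟨i, e⟩ := add_of_slope (W := epsCurve l s ε) rfl rfl
          (legendre_nonsingular_iff.mpr (by ring) : (epsCurve l s ε).Nonsingular 0 0)
          (legendre_nonsingular_iff.mpr (by ring) : (epsCurve l s ε).Nonsingular 1 0)
          zero_ne_one (m := 0) (x₃ := bigLambda l s ε) (y₃ := 0) (by ring)
          (by simp only [epsCurve, legendre]; ring) (by ring)
        rw [← e]
        change φ (pt₀ _ + pt₁ _) = pt₀ _ + pt₁ _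
        rw [map_add, h0, h1]

end FrobeniusPsi

/-! ### Embedding an imaginary quadratic order into a ring -/

section Quadratic

variable {S : Type*} [Ring S] {b : S} {c : ℤ}

open Polynomial in
/-- If `1` and a root `b` of `X² - X + c` are linearly independent, then `X² - X + c` generates the
ideal of the integral polynomials that vanish at `b`. -/
lemma aeval_eq_zero_iff_modByMonic (hb : b * b = b - c)
    (hi : ∀ n m : ℤ, (n : S) + m * b = 0 → n = 0 ∧ m = 0) (q : ℤ[X]) :
    aeval b q = 0 ↔ q %ₘ (X ^ 2 - X + C c) = 0 := by
  have hmon : (X ^ 2 - X + C c : ℤ[X]).Monic := by monicity!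
  have hdeg : (X ^ 2 - X + C c : ℤ[X]).natDegree = 2 := by compute_degree!
  have h0 : aeval b (X ^ 2 - X + C c : ℤ[X]) = 0 := by
    simp [sq, hb]
  have hq : aeval b q = aeval b (q %ₘ (X ^ 2 - X + C c)) := by
    conv_lhs => rw [← modByMonic_add_div q (X ^ 2 - X + C c)]
    rw [map_add, map_mul, h0, zero_mul, add_zero]
  rw [hq]
  refine ⟨fun h ↦ ?_, fun h ↦ by rw [h, map_zero]⟩
  obtain ⟨m, n, e⟩ := exists_eq_X_add_C_of_natDegree_le_one
    (Nat.lt_succ_iff.mp (hdeg ▸ natDegree_modByMonic_lt q hmon (by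
      intro h1; rw [h1, natDegree_one] at hdeg; omega)))
  rw [e] at h ⊢
  obtain ⟨rfl, rfl⟩ := hi n m (by simpa [add_comm] using h)
  simp

open Polynomial in
/-- A ring that is generated by an element `a` with `a² = a - c` maps into every ring with such an
element `b`. -/
lemma exists_injective_adjoin {R : Type*} [CommRing R] {a : R}
    (ha : a * a = a - c) (hia : ∀ n m : ℤ, (n : R) + m * a = 0 → n = 0 ∧ m = 0)
    (hb : b * b = b - c) (hib : ∀ n m : ℤ, (n : S) + m * b = 0 → n = 0 ∧ m = 0) :
    ∃ f : Algebra.adjoin ℤ {a} →+* S, Function.Injective f ∧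
      f ⟨a, Algebra.subset_adjoin rfl⟩ = b := by
  have hmem (q : ℤ[X]) : aeval a q ∈ Algebra.adjoin ℤ {a} := by
    rw [Algebra.adjoin_singleton_eq_range_aeval]; exact ⟨q, rfl⟩
  set g : ℤ[X] →+* Algebra.adjoin ℤ {a} := (aeval a : ℤ[X] →ₐ[ℤ] R).toRingHom.codRestrict
    (Algebra.adjoin ℤ {a}) hmem with hg
  have hgq (q : ℤ[X]) : (g q : R) = aeval a q := rfl
  have hsurj : Function.Surjective g := by
    rintro ⟨x, hx⟩
    rw [Algebra.adjoin_singleton_eq_range_aeval] at hx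
    obtain ⟨q, rfl⟩ := hx
    exact ⟨q, rfl⟩
  -- Both evaluations have the kernel generated by `X² - X + c`.
  have hker (q : ℤ[X]) : g q = 0 ↔ aeval b q = 0 := by
    rw [aeval_eq_zero_iff_modByMonic hb hib, ← aeval_eq_zero_iff_modByMonic ha hia, ← hgq,
      ZeroMemClass.coe_eq_zero]
  set f := g.liftOfSurjective hsurj
    ⟨(aeval b : ℤ[X] →ₐ[ℤ] S).toRingHom, fun q hq ↦ (hker q).mp hq⟩ with hf
  have hfg (q : ℤ[X]) : f (g q) = aeval b q :=
    g.liftOfRightInverse_comp_apply _ (Function.rightInverse_surjInv hsurj) _ q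
  refine ⟨f, (injective_iff_map_eq_zero f).mpr fun x hx ↦ ?_, ?_⟩
  · obtain ⟨q, rfl⟩ := hsurj x
    exact (hker q).mpr (hfg q ▸ hx)
  · have : (⟨a, Algebra.subset_adjoin rfl⟩ : Algebra.adjoin ℤ {a}) = g X :=
      Subtype.ext (by rw [hgq, aeval_X])
    rw [this, hfg, aeval_X]

/-- If no nonzero integer vanishes in `S`, then `1` and a root of `X² - X + c` with negative
discriminant are linearly independent. -/
lemma quadratic_independent (hb : b * b = b - c) (hc : 1 < 4 * c)
    (hS : ∀ n : ℤ, (n : S) = 0 → n = 0) (n m : ℤ) (h : (n : S) + m * b = 0) : n = 0 ∧ m = 0 := by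
  -- The norm of `n + m b`: its conjugate is `n + m - m b`. The resulting form is positive definite
  -- because `4c > 1`.
  have hN : ((n * n + n * m + c * (m * m) : ℤ) : S) = 0 := by
    have e1 : ((n : S) + m * b) * ((n : S) + m - m * b) = 0 := by rw [h, zero_mul]
    have hnb : b * (n : S) = n * b := (Int.cast_commute n b).symm
    have hmb : b * (m : S) = m * b := (Int.cast_commute m b).symm
    have e2 : ((n : S) + m * b) * ((n : S) + m - m * b) = n * n + n * m + c * (m * m) := by
      have h3 : (m : S) * b * (m * b) = m * m * b - c * (m * m) := by
        rw [mul_assoc, ← mul_assoc b, hmb, mul_assoc (m : S) b b, hb, ← mul_assoc, mul_sub,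
          (Int.cast_commute c ((m : S) * m)).eq]
      have h4 : (m : S) * b * n = n * m * b := by
        rw [mul_assoc, hnb, ← mul_assoc, (Int.cast_commute m (n : S)).eq]
      have h5 : (m : S) * b * m = m * m * b := by
        rw [mul_assoc, hmb, ← mul_assoc]
      rw [add_mul, mul_sub, mul_add, mul_sub, mul_add, h3, h4, h5, ← mul_assoc]
      abel
    push_cast
    rw [← e2, e1]
  have := hS _ hN
  have hm : m = 0 := by
    by_contra hm
    have : 0 < m * m := mul_self_pos.mpr hm
    nlinarith [sq_nonneg (2 * n + m)]
  subst hm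
  simpa using this

end Quadratic

lemma sqrtNegThreeMul_sq (p : ℕ) : sqrtNegThreeMul p * sqrtNegThreeMul p = -(3 * p) := by
  have h : (Real.sqrt (3 * p) : ℂ) * Real.sqrt (3 * p) = 3 * p := by
    rw [← Complex.ofReal_mul, Real.mul_self_sqrt (by positivity)]
    push_cast
    rfl
  rw [sqrtNegThreeMul]
  linear_combination Complex.I * Complex.I * h + (3 * p : ℂ) * Complex.I_mul_I

lemma exists_injective_quadOrder {p : ℕ} {c : ℤ} (hc : 4 * c = 1 + 3 * p) {S : Type*}
    [Ring S] {b : S} (hb : b * b = b - c) (hS : ∀ n : ℤ, (n : S) = 0 → n = 0) :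
    ∃ f : quadOrder p →+* S, Function.Injective f ∧
      f ⟨sqrtNegThreeMul p, sqrtNegThreeMul_mem p⟩ = b + b - 1 := by
  have hc' : (4 : ℂ) * c = 1 + 3 * p := by exact_mod_cast hc
  have ha : (1 + sqrtNegThreeMul p) / 2 * ((1 + sqrtNegThreeMul p) / 2) =
      (1 + sqrtNegThreeMul p) / 2 - c := by
    linear_combination sqrtNegThreeMul_sq p / 4 + hc' / 4
  have hc1 : 1 < 4 * c := by omega
  obtain ⟨f, hf, hfa⟩ := exists_injective_adjoin ha
    (quadratic_independent ha hc1 fun n hn ↦ by exact_mod_cast hn) hb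
    (quadratic_independent hb hc1 hS)
  refine ⟨f, hf, ?_⟩
  have e : (⟨sqrtNegThreeMul p, sqrtNegThreeMul_mem p⟩ : quadOrder p) =
      ⟨_, Algebra.subset_adjoin rfl⟩ + ⟨_, Algebra.subset_adjoin rfl⟩ - 1 :=
    Subtype.ext (by
      change sqrtNegThreeMul p = (1 + sqrtNegThreeMul p) / 2 + (1 + sqrtNegThreeMul p) / 2 - 1
      ring)
  rw [e]
  change f (⟨_, Algebra.subset_adjoin rfl⟩ + ⟨_, Algebra.subset_adjoin rfl⟩ - 1) = _
  rw [map_sub, map_add, map_one]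
  exact congrArg₂ (fun x y ↦ x + y - 1) hfa hfa

/-! ### The endomorphism `(1 + φ) / 2` -/

section EndRing

variable {k : Type*} [Field k] [IsAlgClosed k] [DecidableEq k] {t : k} [(legendre t).IsElliptic]

lemma intCast_endRing_eq_zero (h2 : (2 : k) ≠ 0) (n : ℤ) (hn : (n : endRing (legendre t)) = 0) :
    n = 0 := by
  by_contra h0
  obtain ⟨P, hP⟩ := exists_zsmul_ne_zero (t := t) h2 n.natAbs (Int.natAbs_ne_zero.mpr h0)
  have e : n • P = 0 := by
    have := DFunLike.congr_fun (congrArg Subtype.val hn) P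
    simpa using this
  apply hP
  rw [← natCast_zsmul, Int.natCast_natAbs]
  rcases abs_choice n with h | h <;> rw [h]
  · exact e
  · rw [neg_smul, e, neg_zero]

/-- An endomorphism `φ` with `φ² = -3p` that fixes the points of order two gives a root
`(1 + φ) / 2` of `X² - X + c`, where `4c = 1 + 3p`. -/
lemma exists_mul_self_eq_sub (h2 : (2 : k) ≠ 0) {n : ℕ} {c : ℤ} (hc : 4 * c = 1 + n)
    {φ : AddMonoid.End (legendre t).Point} (hφ : φ ∈ endRing (legendre t))
    (hφφ : ∀ P, φ (φ P) = -(n • P)) (hφT : ∀ T, 2 • T = 0 → φ T = T) :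
    ∃ β : endRing (legendre t), β * β = β - c ∧ (β + β - 1 : endRing (legendre t)).1 = φ := by
  obtain ⟨β, hβ, hββ⟩ := exists_two_smul_eq h2 (add_mem (one_mem _) hφ) fun T hT ↦ by
    change T + φ T = 0
    rw [hφT T hT, ← two_smul ℕ, hT]
  refine ⟨⟨β, hβ⟩, Subtype.ext ?_, ?_⟩
  · ext Q : 1
    -- On `Q = 4P` both applications of `β` can be evaluated through `2β = 1 + φ`, without dividing
    -- points.
    obtain ⟨R, rfl⟩ := exists_half h2 Q
    obtain ⟨P, rfl⟩ := exists_half h2 R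
    have hβP (P) : β P + β P = P + φ P := DFunLike.congr_fun hββ P
    have hcP : ((c : endRing (legendre t)).1 : AddMonoid.End _) (2 • 2 • P) = P + n • P := by
      have : ((c : endRing (legendre t)).1 : AddMonoid.End _) (2 • 2 • P) = c • 2 • 2 • P := by
        simp
      rw [this, ← natCast_zsmul, ← natCast_zsmul, smul_smul, smul_smul, ← natCast_zsmul,
        ← one_add_zsmul, ← hc]
      congr 1
      push_cast
      ring
    change β (β (2 • 2 • P)) = β (2 • 2 • P) -
      ((c : endRing (legendre t)).1 : AddMonoid.End _) (2 • 2 • P)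
    rw [hcP, two_smul ℕ (2 • P), two_smul ℕ P]
    have e1 : β (P + P + (P + P)) = P + φ P + (P + φ P) := by
      rw [map_add, map_add, hβP]
    rw [e1]
    have e2 : β (P + φ P + (P + φ P)) = P + φ P + φ (P + φ P) := by
      rw [map_add β (P + φ P), hβP]
    rw [e2, map_add, hφφ]
    abel
  · change β + β - 1 = φ
    rw [hββ, add_sub_cancel_left]

end EndRing

end EllipticEnd

/-! ### The theorem -/

open EllipticEnd in
theorem proposition4p2 (p : ℕ) [Fact p.Prime] (hp : p ≡ 1 [MOD 4])
    [DecidableEq (AlgebraicClosure (ZMod p))]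
    (l : ZMod p) (s : AlgebraicClosure (ZMod p)) (hs : s ^ 2 = algebraMap _ _ (l ^ 2 - l + 1))
    [∀ ε : ℤˣ, (EllipticEnd.epsCurve (algebraMap _ _ l) s ε).IsElliptic]
    (hss : ∀ ε : ℤˣ, EllipticEnd.IsSupersingular p
      (EllipticEnd.epsCurve (algebraMap _ _ l) s ε))
    (ε : ℤˣ) :
    ∃ f : EllipticEnd.quadOrder p →+*
        EllipticEnd.endRing (EllipticEnd.epsCurve (algebraMap _ _ l) s ε),
      Function.Injective f ∧
      EllipticEnd.IsFrobeniusPsi p (algebraMap _ _ l) s ε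
        (f ⟨EllipticEnd.sqrtNegThreeMul p, EllipticEnd.sqrtNegThreeMul_mem p⟩).1 := by
  have hp4 : p % 4 = 1 := hp
  have hpp : p.Prime := Fact.out
  have hndvd {n : ℕ} (h0 : 0 < n) (hn : n < 5) : (n : AlgebraicClosure (ZMod p)) ≠ 0 := by
    rw [Ne, CharP.cast_eq_zero_iff _ p]
    intro h
    have := Nat.le_of_dvd h0 h
    have := hpp.two_le
    omega
  have h2 : (2 : AlgebraicClosure (ZMod p)) ≠ 0 := mod_cast hndvd (n := 2) (by simp) (by simp)
  have h3 : (3 : AlgebraicClosure (ZMod p)) ≠ 0 := mod_cast hndvd (n := 3) (by simp) (by simp)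
  have hlp : (algebraMap (ZMod p) (AlgebraicClosure (ZMod p)) l) ^ p = algebraMap _ _ l := by
    rw [← map_pow, ZMod.pow_card]
  have h : s ^ 2 = (algebraMap (ZMod p) (AlgebraicClosure (ZMod p)) l) ^ 2 -
      algebraMap _ _ l + 1 := by
    rw [hs]; simp
  -- Otherwise `Λ` would lie in `𝔽_p`, against `not_isSupersingular_of_mod_four`.
  have hsne : s ^ p ≠ s := by
    intro e
    obtain ⟨s₀, rfl⟩ : ∃ s₀, algebraMap (ZMod p) (AlgebraicClosure (ZMod p)) s₀ = s := by
      have := (Subfield.mem_bot_iff_pow_eq_self (F := AlgebraicClosure (ZMod p)) (p := p)).mpr e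
      obtain ⟨n, rfl⟩ := (mem_bot_iff_intCast p _).mp this
      exact ⟨n, map_intCast _ n⟩
    have e' : bigLambda (algebraMap (ZMod p) (AlgebraicClosure (ZMod p)) l)
        (algebraMap _ _ s₀) 1 = algebraMap _ _ (bigLambda l s₀ 1) := by simp [bigLambda]
    -- The parameter is generalized so that the ellipticity instance is transported along the
    -- equality with it.
    have key : ∀ t : AlgebraicClosure (ZMod p), ∀ _ : (legendre t).IsElliptic,
        t = algebraMap _ _ (bigLambda l s₀ 1) → ¬ IsSupersingular p (legendre t) := by
      rintro t ht rfl
      exact not_isSupersingular_of_mod_four hp4 _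
    exact key _ _ e' (hss 1)
  have hsp : s ^ p = -s := by
    have : (s ^ p - s) * (s ^ p + s) = 0 := by
      have : (s ^ p) ^ 2 = s ^ 2 := by
        rw [← pow_mul, mul_comm, pow_mul, hs, ← map_pow, ZMod.pow_card]
      linear_combination this
    exact eq_neg_of_add_eq_zero_left
      ((mul_eq_zero.mp this).resolve_left (sub_ne_zero.mpr hsne))
  have hs0 : s ≠ 0 := by
    rintro rfl
    exact hsne (zero_pow hpp.ne_zero)
  obtain ⟨φ, hφ, hφφ, hφT⟩ := exists_isFrobeniusPsi hp4 h2 h3 h hs0 hlp hsp ε (hss ε)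
  -- Integral because `p ≡ 1 (mod 4)` makes `1 + 3p` divisible by 4.
  obtain ⟨c, hc⟩ : ∃ c : ℤ, 4 * c = 1 + 3 * p := ⟨(1 + 3 * p) / 4, by omega⟩
  obtain ⟨β, hβ, hβφ⟩ := exists_mul_self_eq_sub h2 (n := 3 * p) (c := c) (by push_cast; exact hc)
    (Or.inr hφ.isRational) hφφ hφT
  obtain ⟨f, hf, hfs⟩ := exists_injective_quadOrder hc hβ (intCast_endRing_eq_zero h2)
  exact ⟨f, hf, by rw [hfs, hβφ]; exact hφ⟩
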